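/- Let $\Omega\subset\mathbb{R}^n$ be open, and let $C^1_0(\Omega,\mathbb{R}^n)$ denote the $C^1$ vector fields $u$ on $\Omega$ such that $u$ and $Du$ vanish at $\partial\Omega$ and at infinity. Let $V\subset C^1_0(\Omega,\mathbb{R}^n)$ be an admissible reproducing kernel Hilbert space, i.e. there is a constant $C>0$ with $\|u\|_\infty+\|Du\|_\infty\le C\|u\|_V$ for all $u\in V$, and let $K:\Omega\times\Omega\to\mathbb{R}^{n\times n}$ be its reproducing kernel. Let $X^2=L^2([0,1],V)$. For $v\in X^2$ let $\varphi^v_t:\Omega\to\Omega$, $0\le t\le 1$, be the flow of $v$, i.e. $\varphi^v_t(x)=x+\int_0^t v(\tau,\varphi^v_\tau(x))\,d\tau$, and put $\varphi^v_{s,t}=\varphi^v_t\circ(\varphi^v_s)^{-1}$. Let $Y$ be a real Hilbert space (the data space, e.g. an $L^2$ space), $N\ge 1$, $t_i=i/N$, $\mu_2\in\mathbb{R}$, let $T_t:L^2(\Omega,\mathbb{R})\to Y$ be bounded linear operators with adjoints $T_t^*$, and let $g_t\in Y$. Let $f\in L^2(\Omega,\mathbb{R})$ be differentiable on $\Omega$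 with $\nabla f\in L^2(\Omega,\mathbb{R}^n)$. Define $$J_f(v)=\frac1N\sum_{i=1}^N\Bigl[\bigl\|T_{t_i}(f\circ\varphi^v_{t_i,0})-g_{t_i}\bigr\|_Y^2+\mu_2\int_0^{t_i}\|v(\tau,\cdot)\|_V^2\,d\tau\Bigr],\qquad v\in X^2,$$ $$h^{f,v}_{\tau,t}=\begin{cases}|D\varphi^v_{\tau,t}|\;T_t^*\bigl(T_t(f\circ\varphi^v_{t,0})-g_t\bigr)\circ\varphi^v_{\tau,t},&\tau\le t,\\0,&t<\tau,\end{cases}\qquad v_{\tau,t}=\begin{cases}v(\tau,\cdot),&\tau\le t,\\0,&t<\tau,\end{cases}$$ where $|D\varphi|$ is the Jacobian determinant. Then $J_f$ is well defined: for every $v\in X^2$ the flow exists, each $\varphi^v_s$ ($0\le s\le 1$) is a bijection of $\Omega$, each $\varphi^v_{s,t}$ ($0\le s,t\le 1$) is $C^1$ on $\Omega$, and $f\circ\varphi^v_{s,0}\in L^2(\Omega)$. Moreover $J_f:X^2\to\mathbb{R}$ is differentiable at every $v\in X^2$, and its $X^2$-gradient is $$\nabla J_f(v)(t,x)=-\frac2N\int_\Omega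 K(x,y)\,\nabla(f\circ\varphi^v_{t,0})(y)\sum_{\{i\ge1:\,t_i\ge t\}}h^{f,v}_{t,t_i}(y)\,dy+\frac{2\mu_2}{N}\sum_{\{i\ge1:\,t_i\ge t\}}v_{t,t_i}(x)$$ for almost every $t\in[0,1]$ and all $x\in\Omega$, where the integrand is integrable over $\Omega$ for all $t\in[0,1]$, $x\in\Omega$. -/

import Mathlib

/-!
Extended by zero to all of `ℝⁿ`, the fields of an admissible space form a linear family that is
bounded in `C¹` by the norm of `V`. For such a family the trajectory equation satisfies the
Carathéodory conditions, and Grönwall's inequality shows that the flow is strictly differentiable in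
the velocity and the initial point, uniformly over the initial points. Its derivative in the
direction `h` is given by variation of constants: `∫ Dφ_{τ,t} (h_τ ∘ φ_{s,τ}) dτ`, integrated over
`τ` from `s` to `t`.

Since `f` is merely differentiable, with `∇f ∈ L²`, the map `v ↦ f ∘ φ_{t,0}` is first
differentiated pointwise along lines. Its derivative is the product of `Df ∘ φ_{t,0}`, which depends
continuously on `v` in `L²`, and of the uniformly bounded derivative of the flow, so it is a
bounded operator into `L²` that depends continuously on `v`, and the mean value inequality in `L²`
makes it a Fréchet derivative.

In `⟨G, D(f ∘ φ_{t,0}) h⟩`, Fubini's theorem and the change of variables `z = φ_{t,τ}(y)` move the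
integration to the points where `h_τ` is evaluated; the Jacobian factor of `h_{τ,t}` arises there.
What remains is the integral over `τ` of the pairings `∫_Ω ⟨b_τ, h_τ⟩` with integrable vector fields
`b_τ`, and the reproducing kernel turns each of them into the inner product in `V` of `h_τ` with
`∫_Ω K(·, y) b_τ(y) dy`.
-/

open MeasureTheory Set
open scoped Gradient

noncomputable section

/-- The space `L²([0,1], V)` of time-dependent velocity fields. -/
abbrev VelocitySpace (V : Type*) [NormedAddCommGroup V] : Type _ :=
  Lp V 2 (volume.restrict (Icc (0 : ℝ) 1))

/-- The space `L²(Ω, ℝ)` of images on `Ω`. -/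
abbrev ImageSpace {n : ℕ} (Ω : Set (EuclideanSpace ℝ (Fin n))) : Type :=
  Lp ℝ 2 (volume.restrict Ω)

/-- The element of `L²(Ω, ℝ)` represented by `u` (by convention `0` if `u` is not
square-integrable on `Ω`). -/
def toImage {n : ℕ} (Ω : Set (EuclideanSpace ℝ (Fin n))) (u : EuclideanSpace ℝ (Fin n) → ℝ) :
    ImageSpace Ω :=
  open Classical in if h : MemLp u 2 (volume.restrict Ω) then h.toLp u else 0

/-- Membership in `C¹₀(Ω, ℝⁿ)`: `u` is continuously differentiable on `Ω`, and `u` and `Du` vanish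
at the boundary of `Ω` and at infinity. Only the values of `u` on the open set `Ω` matter. -/
structure IsC10 {n : ℕ} (Ω : Set (EuclideanSpace ℝ (Fin n)))
    (u : EuclideanSpace ℝ (Fin n) → EuclideanSpace ℝ (Fin n)) : Prop where
  contDiffOn : ContDiffOn ℝ 1 u Ω
  vanish : ∀ ε : ℝ, 0 < ε → ∃ K : Set (EuclideanSpace ℝ (Fin n)), IsCompact K ∧ K ⊆ Ω ∧
    ∀ x ∈ Ω \ K, ‖u x‖ < ε ∧ ‖fderiv ℝ u x‖ < ε

section Velocity

variable {n : ℕ} {Ω : Set (EuclideanSpace ℝ (Fin n))}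
  {V : Type*} [NormedAddCommGroup V] [InnerProductSpace ℝ V]
  [RKHS ℝ V Ω (EuclideanSpace ℝ (Fin n))]

/-- The vector field on `Ω` given by an element of `V`, extended by zero to `ℝⁿ`. -/
def vectorField (u : V) : EuclideanSpace ℝ (Fin n) → EuclideanSpace ℝ (Fin n) :=
  Function.extend (Subtype.val : Ω → EuclideanSpace ℝ (Fin n)) (fun x => u x) 0

variable (V) in
/-- `V` is admissible: it is contained in `C¹₀(Ω, ℝⁿ)`, and
`sup ‖u‖ + sup ‖Du‖ ≤ C ‖u‖_V` for some constant `C`. -/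
structure IsAdmissible : Prop where
  isC10 : ∀ u : V, IsC10 Ω (vectorField u)
  bound : ∃ C : ℝ, 0 < C ∧ ∀ u : V, ∀ x ∈ Ω, ∀ y ∈ Ω,
    ‖vectorField u x‖ + ‖fderiv ℝ (vectorField u) y‖ ≤ C * ‖u‖

/-- `φ` is the flow on `Ω`, for times in `[0,1]`, of the time-dependent velocity field `v`:
`∂ₜ φₜ(x) = v(t, φₜ(x))`, `φ₀(x) = x`, in integrated form. -/
structure IsFlow (v : ℝ → V) (φ : ℝ → EuclideanSpace ℝ (Fin n) → EuclideanSpace ℝ (Fin n)) :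
    Prop where
  mapsTo : ∀ t ∈ Icc (0 : ℝ) 1, MapsTo (φ t) Ω Ω
  intervalIntegrable : ∀ x ∈ Ω,
    IntervalIntegrable (fun τ => vectorField (v τ) (φ τ x)) volume 0 1
  eq : ∀ x ∈ Ω, ∀ t ∈ Icc (0 : ℝ) 1, φ t x = x + ∫ τ in (0 : ℝ)..t, vectorField (v τ) (φ τ x)

/-- The flow `φₜᵛ` of `v`. -/
def flow (v : VelocitySpace V) :
    ℝ → EuclideanSpace ℝ (Fin n) → EuclideanSpace ℝ (Fin n) :=
  open Classical in
  if h : ∃ φ : ℝ → EuclideanSpace ℝ (Fin n) → EuclideanSpace ℝ (Fin n), IsFlow (⇑v) φ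
  then h.choose else fun _ x => x

/-- `φ_{s,t}ᵛ = φₜᵛ ∘ (φₛᵛ)⁻¹`, the inverse being that of `φₛᵛ` as a self-map of `Ω`. -/
def flowBetween (v : VelocitySpace V) (s t : ℝ) :
    EuclideanSpace ℝ (Fin n) → EuclideanSpace ℝ (Fin n) :=
  flow v t ∘ Function.invFunOn (flow v s) Ω

variable {Y : Type*} [NormedAddCommGroup Y] [InnerProductSpace ℝ Y]

/-- The registration functional
`J_f(v) = (1/N) ∑ᵢ (‖T_{tᵢ}(f ∘ φ_{tᵢ,0}ᵛ) - g_{tᵢ}‖² + μ₂ ∫₀^{tᵢ} ‖v(τ)‖²_V dτ)`, `tᵢ = i/N`. -/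
def registrationFunctional (N : ℕ) (T : ℝ → ImageSpace Ω →L[ℝ] Y) (g : ℝ → Y) (μ₂ : ℝ)
    (f : EuclideanSpace ℝ (Fin n) → ℝ) (v : VelocitySpace V) : ℝ :=
  (1 / (N : ℝ)) * ∑ i ∈ Finset.Icc 1 N,
    (‖T ((i : ℝ) / N) (toImage Ω (f ∘ flowBetween v ((i : ℝ) / N) 0)) - g ((i : ℝ) / N)‖ ^ 2
      + μ₂ * ∫ τ in (0 : ℝ)..((i : ℝ) / N), ‖v τ‖ ^ 2)

/-- `h_{τ,t} = |Dφ_{τ,t}| · T_t*(T_t(f ∘ φ_{t,0}) - g_t) ∘ φ_{τ,t}` if `τ ≤ t`, and `0` otherwise. -/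
def hTerm [CompleteSpace Y] (T : ℝ → ImageSpace Ω →L[ℝ] Y) (g : ℝ → Y)
    (f : EuclideanSpace ℝ (Fin n) → ℝ) (v : VelocitySpace V) (τ t : ℝ)
    (y : EuclideanSpace ℝ (Fin n)) : ℝ :=
  if τ ≤ t then
    (fderiv ℝ (flowBetween v τ t) y).det *
      (ContinuousLinearMap.adjoint (T t) (T t (toImage Ω (f ∘ flowBetween v t 0)) - g t))
        (flowBetween v τ t y)
  else 0

/-- `v_{τ,t} = v(τ)` if `τ ≤ t`, and `0` otherwise. -/
def truncatedVelocity (v : VelocitySpace V) (τ t : ℝ) : V :=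
  if τ ≤ t then v τ else 0

/-- The integrand
`K(x,y) ∇(f ∘ φ_{t,0})(y) ∑_{i ≥ 1, tᵢ ≥ t} h_{t,tᵢ}(y)`, with `K` the reproducing kernel of `V`. -/
def gradientIntegrand [CompleteSpace V] [CompleteSpace Y] (N : ℕ)
    (T : ℝ → ImageSpace Ω →L[ℝ] Y) (g : ℝ → Y)
    (f : EuclideanSpace ℝ (Fin n) → ℝ) (v : VelocitySpace V) (t : ℝ) (x y : Ω) :
    EuclideanSpace ℝ (Fin n) :=
  RKHS.kernel V x y
    ((∑ i ∈ (Finset.Icc 1 N).filter (fun i : ℕ => t ≤ (i : ℝ) / N), hTerm T g f v t ((i : ℝ) / N) (y : _)) •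
      ∇ (f ∘ flowBetween v t 0) (y : EuclideanSpace ℝ (Fin n)))

end Velocity

end

open Filter Topology

local notation "μI" => (volume.restrict (Icc (0 : ℝ) 1) : Measure ℝ)

section Primitive

instance isProbabilityMeasure_unitInterval : IsProbabilityMeasure μI :=
  ⟨by simp⟩

variable {G : Type*} [NormedAddCommGroup G] [NormedSpace ℝ G]

lemma intervalIntegral_unitInterval_eq_indicator (m : ℝ → G) (s t : ℝ) :
    ∫ τ in s..t, m τ ∂μI = ∫ τ in s..t, (Icc (0 : ℝ) 1).indicator m τ := by
  simp only [intervalIntegral, integral_indicator measurableSet_Icc,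
    Measure.restrict_restrict measurableSet_Icc, Measure.restrict_restrict measurableSet_Ioc,
    inter_comm]

lemma norm_intervalIntegral_le_integral {m : ℝ → G} (hm : Integrable m μI) (s t : ℝ) :
    ‖∫ τ in s..t, m τ ∂μI‖ ≤ ∫ τ, ‖m τ‖ ∂μI :=
  intervalIntegral.norm_integral_le_integral_norm_uIoc.trans
    (setIntegral_le_integral hm.norm (ae_of_all _ fun _ => norm_nonneg _))

lemma abs_intervalIntegral_of_nonneg {a : ℝ → ℝ} (ha : ∀ τ, 0 ≤ a τ) (s t : ℝ) :
    |∫ τ in s..t, a τ ∂μI| = ∫ τ in uIoc s t, a τ ∂μI := by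
  rw [intervalIntegral.abs_integral_eq_abs_integral_uIoc, abs_of_nonneg (integral_nonneg ha)]

/-- `M` is an antiderivative of the integrable function `m` on `[0,1]`, in integrated form. As `m`
is only integrated against the restriction of Lebesgue measure, `M` is constant on each side of
`[0,1]`; this makes it a globally bounded function of `t ∈ ℝ`. -/
structure IsPrimitive (M m : ℝ → G) : Prop where
  integrable : Integrable m μI
  sub_eq : ∀ s t, M t - M s = ∫ τ in s..t, m τ ∂μI

lemma isPrimitive_intervalIntegral {m : ℝ → G} (hm : Integrable m μI) (s : ℝ) :
    IsPrimitive (fun t => ∫ τ in s..t, m τ ∂μI) m :=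
  ⟨hm, fun r t => by
    rw [sub_eq_iff_eq_add', intervalIntegral.integral_add_adjacent_intervals] <;>
      exact hm.intervalIntegrable⟩

namespace IsPrimitive

variable {M m : ℝ → G}

lemma eq_add (hM : IsPrimitive M m) (s t : ℝ) : M t = M s + ∫ τ in s..t, m τ ∂μI := by
  rw [← hM.sub_eq]; abel

lemma const_add (hM : IsPrimitive M m) (c : G) : IsPrimitive (fun t => c + M t) m :=
  ⟨hM.integrable, fun s t => by rw [add_sub_add_left_eq_sub, hM.sub_eq]⟩

lemma congr_ae {m' : ℝ → G} (hM : IsPrimitive M m) (h : m =ᵐ[μI] m') : IsPrimitive M m' :=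
  ⟨hM.integrable.congr h, fun s t => by
    rw [hM.sub_eq, intervalIntegral.integral_congr_ae (h.mono fun _ hτ _ => hτ)]⟩

lemma clm_comp [CompleteSpace G] {G' : Type*} [NormedAddCommGroup G'] [NormedSpace ℝ G']
    [CompleteSpace G'] (hM : IsPrimitive M m) (L : G →L[ℝ] G') :
    IsPrimitive (fun t => L (M t)) fun t => L (m t) :=
  ⟨L.integrable_comp hM.integrable, fun s t => by
    rw [← map_sub, hM.sub_eq, L.intervalIntegral_comp_comm hM.integrable.intervalIntegrable]⟩

lemma norm_sub_le (hM : IsPrimitive M m) (s t : ℝ) :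
    ‖M t - M s‖ ≤ |∫ τ in s..t, ‖m τ‖ ∂μI| := by
  rw [hM.sub_eq]; exact intervalIntegral.norm_integral_le_abs_integral_norm

lemma exists_forall_norm_le (hM : IsPrimitive M m) : ∃ c, ∀ t, ‖M t‖ ≤ c :=
  ⟨‖M 0‖ + ∫ τ, ‖m τ‖ ∂μI, fun t => by
    rw [hM.eq_add 0 t]
    exact norm_add_le_of_le le_rfl (norm_intervalIntegral_le_integral hM.integrable 0 t)⟩

lemma continuous (hM : IsPrimitive M m) : Continuous M := by
  rw [funext fun t => hM.eq_add 0 t]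
  exact continuous_const.add
    (intervalIntegral.continuous_primitive (fun _ _ => hM.integrable.intervalIntegrable) 0)

variable [CompleteSpace G]

lemma ae_hasDerivAt (hM : IsPrimitive M m) :
    ∀ᵐ t, HasDerivAt M ((Icc (0 : ℝ) 1).indicator m t) t := by
  have hm : Integrable ((Icc (0 : ℝ) 1).indicator m) :=
    (integrable_indicator_iff measurableSet_Icc).2 hM.integrable
  filter_upwards [LocallyIntegrable.ae_hasDerivAt_integral hm.locallyIntegrable] with t ht
  rw [funext fun t => hM.eq_add 0 t]
  simp only [intervalIntegral_unitInterval_eq_indicator]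
  exact (ht 0).const_add _

end IsPrimitive

lemma absolutelyContinuousOnInterval_of_norm_sub_le {G : Type*} [NormedAddCommGroup G]
    {M : ℝ → G} {g : ℝ → ℝ}
    (hg : Integrable g μI) (hM : ∀ s t, ‖M t - M s‖ ≤ |∫ τ in s..t, g τ ∂μI|) (s t : ℝ) :
    AbsolutelyContinuousOnInterval M s t := by
  have hg' : Integrable ((Icc (0 : ℝ) 1).indicator g) :=
    (integrable_indicator_iff measurableSet_Icc).2 hg
  refine squeeze_zero (fun _ => Finset.sum_nonneg fun _ _ => dist_nonneg) (fun E => ?_)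
    (hg'.intervalIntegrable.absolutelyContinuousOnInterval_intervalIntegral
      (left_mem_uIcc (a := s) (b := t)))
  refine Finset.sum_le_sum fun i _ => ?_
  rw [dist_comm, dist_comm (∫ _ in _.._, _), dist_eq_norm, Real.dist_eq]
  refine (hM _ _).trans_eq ?_
  rw [intervalIntegral_unitInterval_eq_indicator, intervalIntegral.integral_interval_sub_left] <;>
    exact hg'.intervalIntegrable

theorem isPrimitive_of_norm_sub_le [CompleteSpace G] {M m : ℝ → G} {g : ℝ → ℝ}
    (hm : Integrable m μI) (hg : Integrable g μI)
    (hM : ∀ s t, ‖M t - M s‖ ≤ |∫ τ in s..t, g τ ∂μI|)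
    (hd : ∀ᵐ t, HasDerivAt M ((Icc (0 : ℝ) 1).indicator m t) t) : IsPrimitive M m := by
  refine ⟨hm, fun s t => ?_⟩
  have hP := isPrimitive_intervalIntegral hm s
  have hac : AbsolutelyContinuousOnInterval (fun r => M r - ∫ τ in s..r, m τ ∂μI) s t :=
    (absolutelyContinuousOnInterval_of_norm_sub_le hg hM s t).fun_sub
      (absolutelyContinuousOnInterval_of_norm_sub_le hm.norm hP.norm_sub_le s t)
  obtain ⟨c, hc⟩ := hac.const_of_ae_hasDerivAt_zero <| by
    filter_upwards [hd, hP.ae_hasDerivAt] with r hMr hPr _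
    simpa using hMr.fun_sub hPr
  have hs := hc s left_mem_uIcc
  have ht := hc t right_mem_uIcc
  rw [intervalIntegral.integral_same, sub_zero] at hs
  rw [hs, ← ht, sub_sub_cancel]

namespace IsPrimitive

variable {G₁ G₂ : Type*} [NormedAddCommGroup G₁] [NormedSpace ℝ G₁]
  [NormedAddCommGroup G₂] [NormedSpace ℝ G₂] {M m : ℝ → G₁} {N n : ℝ → G₂}

lemma integrable_bilin_left (B : G₁ →L[ℝ] G₂ →L[ℝ] G) (hm : Integrable m μI)
    (hN : Continuous N) : Integrable (fun t => B (m t) (N t)) μI := by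
  obtain ⟨c, hc⟩ := isCompact_Icc.exists_bound_of_continuousOn (s := Icc (0 : ℝ) 1) hN.continuousOn
  refine Integrable.mono' ((hm.norm.const_mul ‖B‖).mul_const c)
    (B.aestronglyMeasurable_comp₂ hm.1 hN.aestronglyMeasurable) ?_
  refine (ae_restrict_iff' measurableSet_Icc).2 (ae_of_all _ fun t ht => ?_)
  exact (B.le_opNorm₂ _ _).trans (mul_le_mul_of_nonneg_left (hc t ht) (by positivity))

theorem bilin [CompleteSpace G] [CompleteSpace G₁] [CompleteSpace G₂] (B : G₁ →L[ℝ] G₂ →L[ℝ] G)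
    (hM : IsPrimitive M m) (hN : IsPrimitive N n) :
    IsPrimitive (fun t => B (M t) (N t)) fun t => B (m t) (N t) + B (M t) (n t) := by
  obtain ⟨c, hc⟩ := hM.exists_forall_norm_le
  obtain ⟨d, hd⟩ := hN.exists_forall_norm_le
  have hmN := integrable_bilin_left B hM.integrable hN.continuous
  have hMn := integrable_bilin_left B.flip hN.integrable hM.continuous
  have hg₁ := (hM.integrable.norm.const_mul (‖B‖ * d))
  have hg₂ := (hN.integrable.norm.const_mul (‖B‖ * c))
  refine isPrimitive_of_norm_sub_le (hmN.add hMn) (hg₁.add hg₂) (fun s t => ?_) ?_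
  · have hc0 : 0 ≤ c := (norm_nonneg _).trans (hc 0)
    have hd0 : 0 ≤ d := (norm_nonneg _).trans (hd 0)
    calc ‖B (M t) (N t) - B (M s) (N s)‖
        = ‖B (M t - M s) (N t) + B (M s) (N t - N s)‖ := by simp
      _ ≤ ‖B‖ * ‖M t - M s‖ * ‖N t‖ + ‖B‖ * ‖M s‖ * ‖N t - N s‖ :=
          norm_add_le_of_le (B.le_opNorm₂ _ _) (B.le_opNorm₂ _ _)
      _ ≤ ‖B‖ * |∫ τ in s..t, ‖m τ‖ ∂μI| * d + ‖B‖ * c * |∫ τ in s..t, ‖n τ‖ ∂μI| := by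
          gcongr
          exacts [hM.norm_sub_le s t, hd t, hc s, hN.norm_sub_le s t]
      _ = |∫ τ in s..t, (‖B‖ * d * ‖m τ‖ + ‖B‖ * c * ‖n τ‖) ∂μI| := by
          rw [abs_intervalIntegral_of_nonneg (fun _ => norm_nonneg _),
            abs_intervalIntegral_of_nonneg (fun _ => norm_nonneg _),
            abs_intervalIntegral_of_nonneg (fun _ => by positivity),
            integral_add hg₁.restrict hg₂.restrict, integral_const_mul, integral_const_mul]
          ring
  · filter_upwards [hM.ae_hasDerivAt, hN.ae_hasDerivAt] with t hMt hNt
    convert! B.hasDerivAt_of_bilinear (fun _ => hMt) (fun _ => hNt) using 1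
    by_cases ht : t ∈ Icc (0 : ℝ) 1 <;> simp [ht, add_comm]

theorem comp_contDiff {α a : ℝ → ℝ} (hα : IsPrimitive α a) {φ : ℝ → ℝ} (hφ : ContDiff ℝ 1 φ) :
    IsPrimitive (φ ∘ α) fun t => deriv φ (α t) * a t := by
  obtain ⟨c, hc⟩ := hα.exists_forall_norm_le
  have hφ' : Continuous (deriv φ) := hφ.continuous_deriv le_rfl
  obtain ⟨K, hK⟩ := (isCompact_Icc (a := -c) (b := c)).exists_bound_of_continuousOn
    hφ'.continuousOn
  have hα_mem (t : ℝ) : α t ∈ Icc (-c) c := abs_le.1 (hc t)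
  have hK0 : 0 ≤ K := (norm_nonneg _).trans (hK _ (hα_mem 0))
  have hd (x : ℝ) : HasDerivAt φ (deriv φ x) x :=
    (hφ.differentiable one_ne_zero x).hasDerivAt
  refine isPrimitive_of_norm_sub_le ?_ (hα.integrable.norm.const_mul K) (fun s t => ?_) ?_
  · simpa only [mul_comm, ContinuousLinearMap.mul_apply',
      Function.comp_apply] using
      integrable_bilin_left (ContinuousLinearMap.mul ℝ ℝ) hα.integrable (hφ'.comp hα.continuous)
  · refine ((convex_Icc (-c) c).norm_image_sub_le_of_norm_hasDerivWithin_le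
      (fun x _ => (hd x).hasDerivWithinAt) hK (hα_mem s) (hα_mem t)).trans ?_
    rw [intervalIntegral.integral_const_mul, abs_mul, abs_of_nonneg hK0]
    gcongr
    exact hα.norm_sub_le s t
  · filter_upwards [hα.ae_hasDerivAt] with t ht
    convert! (hd (α t)).comp t ht using 1
    by_cases h : t ∈ Icc (0 : ℝ) 1 <;> simp [h]

end IsPrimitive

end Primitive

section Gronwall

lemma setIntegral_mul_exp_abs_primitive {a : ℝ → ℝ} (ha : Integrable a μI) (ha0 : ∀ τ, 0 ≤ a τ)
    {k : ℝ} (hk : k ≠ 0) (s t : ℝ) :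
    ∫ τ in uIoc s t, a τ * Real.exp (k * |∫ σ in s..τ, a σ ∂μI|) ∂μI =
      (Real.exp (k * |∫ σ in s..t, a σ ∂μI|) - 1) / k := by
  have hexp (c r q : ℝ) : ∫ τ in r..q, c * Real.exp (c * ∫ σ in s..τ, a σ ∂μI) * a τ ∂μI =
      Real.exp (c * ∫ σ in s..q, a σ ∂μI) - Real.exp (c * ∫ σ in s..r, a σ ∂μI) := by
    have hφ : ContDiff ℝ 1 fun x => Real.exp (c * x) := by fun_prop
    refine Eq.trans (intervalIntegral.integral_congr fun τ _ => ?_)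
      (((isPrimitive_intervalIntegral ha s).comp_contDiff hφ).sub_eq r q).symm
    have := ((hasDerivAt_id (∫ σ in s..τ, a σ ∂μI)).const_mul c).exp.deriv
    simp only [id, mul_one] at this
    simp only [this, mul_comm]
  rw [eq_div_iff hk]
  rcases le_total s t with h | h
  · rw [uIoc_of_le h, ← intervalIntegral.integral_of_le h, ← intervalIntegral.integral_mul_const,
      abs_of_nonneg (intervalIntegral.integral_nonneg_of_forall h ha0)]
    have := hexp k s t
    rw [intervalIntegral.integral_same, mul_zero, Real.exp_zero] at this
    rw [← this]
    refine intervalIntegral.integral_congr fun τ hτ => ?_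
    rw [uIcc_of_le h] at hτ
    simp only [abs_of_nonneg (intervalIntegral.integral_nonneg_of_forall hτ.1 ha0)]
    ring
  · have habs {τ : ℝ} (hτ : τ ≤ s) : k * |∫ σ in s..τ, a σ ∂μI| = -k * ∫ σ in s..τ, a σ ∂μI := by
      rw [intervalIntegral.integral_symm, abs_neg,
        abs_of_nonneg (intervalIntegral.integral_nonneg_of_forall hτ ha0), mul_neg, neg_mul,
        neg_neg]
    rw [uIoc_of_ge h, ← intervalIntegral.integral_of_le h, ← intervalIntegral.integral_mul_const,
      habs h]
    have := hexp (-k) t s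
    rw [intervalIntegral.integral_same, mul_zero, Real.exp_zero] at this
    rw [← neg_sub, ← this, ← intervalIntegral.integral_neg]
    refine intervalIntegral.integral_congr fun τ hτ => ?_
    rw [uIcc_of_le h] at hτ
    simp only [habs hτ.2]
    ring

lemma integrable_mul_of_continuous {a ρ : ℝ → ℝ} (ha : Integrable a μI) (hρ : Continuous ρ) :
    Integrable (fun τ => a τ * ρ τ) μI :=
  IsPrimitive.integrable_bilin_left (ContinuousLinearMap.mul ℝ ℝ) ha hρ

lemma continuous_abs_primitive {a : ℝ → ℝ} (ha : Integrable a μI) (s : ℝ) :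
    Continuous fun t => |∫ τ in s..t, a τ ∂μI| :=
  (isPrimitive_intervalIntegral ha s).continuous.abs

/-- Grönwall's inequality: `exp (-|∫_s^t a|) * ρ t` cannot exceed `b` at a maximum point. -/
theorem le_mul_exp_of_le_add_setIntegral {a ρ : ℝ → ℝ} (ha : Integrable a μI)
    (ha0 : ∀ τ, 0 ≤ a τ) (hρ : Continuous ρ) {b s : ℝ}
    (h : ∀ t, ρ t ≤ b + ∫ τ in uIoc s t, a τ * ρ τ ∂μI) (t : ℝ) :
    ρ t ≤ b * Real.exp |∫ τ in s..t, a τ ∂μI| := by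
  set A : ℝ → ℝ := fun t => |∫ τ in s..t, a τ ∂μI| with hA
  have hAcont : Continuous A := continuous_abs_primitive ha s
  obtain ⟨r, hr, hmax⟩ := isCompact_uIcc.exists_isMaxOn (nonempty_uIcc (a := s) (b := t))
    (f := fun τ => ρ τ * Real.exp (-A τ)) (by fun_prop)
  set m := ρ r * Real.exp (-A r) with hm
  have hle {τ : ℝ} (hτ : τ ∈ uIcc s t) : ρ τ ≤ m * Real.exp (A τ) := by
    have := hmax hτ
    rw [mem_ofPred_eq] at this
    rwa [← div_le_iff₀ (Real.exp_pos _), div_eq_mul_inv, ← Real.exp_neg]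
  have hint : ∫ τ in uIoc s r, a τ * ρ τ ∂μI ≤ m * (Real.exp (A r) - 1) :=
    calc ∫ τ in uIoc s r, a τ * ρ τ ∂μI
        ≤ ∫ τ in uIoc s r, m * (a τ * Real.exp (A τ)) ∂μI := by
          refine setIntegral_mono_on (integrable_mul_of_continuous ha hρ).integrableOn
            ((integrable_mul_of_continuous ha (by fun_prop)).const_mul m).integrableOn
            measurableSet_uIoc fun τ hτ => ?_
          rw [mul_left_comm]
          exact mul_le_mul_of_nonneg_left
            (hle (uIcc_subset_uIcc_left hr (uIoc_subset_uIcc hτ))) (ha0 τ)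
      _ = m * (Real.exp (A r) - 1) := by
          rw [integral_const_mul, hA]
          simpa using congrArg (m * ·) (setIntegral_mul_exp_abs_primitive ha ha0 one_ne_zero s r)
  have hr_eq : ρ r = m * Real.exp (A r) := by
    rw [hm, mul_assoc, ← Real.exp_add, neg_add_cancel, Real.exp_zero, mul_one]
  have hmb : m ≤ b := by linarith [h r]
  exact (hle right_mem_uIcc).trans (mul_le_mul_of_nonneg_right hmb (Real.exp_pos _).le)

end Gronwall

section Caratheodory

variable {G : Type*} [NormedAddCommGroup G]

/-- Carathéodory conditions on a time-dependent vector field: `F` is Lipschitz in the space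
variable with an integrable constant `a`, and integrable along every continuous curve. -/
structure IsCaratheodory (F : ℝ → G → G) (a : ℝ → ℝ) : Prop where
  integrable_lip : Integrable a μI
  lip_nonneg : ∀ τ, 0 ≤ a τ
  lip : ∀ τ x y, ‖F τ x - F τ y‖ ≤ a τ * ‖x - y‖
  integrable_comp : ∀ x : ℝ → G, Continuous x → Integrable (fun τ => F τ (x τ)) μI

variable [NormedSpace ℝ G]

/-- `x` solves `x' = F(t,x)`, `x(s) = x₀` in integrated form; `F` acts only at times in `[0,1]`. -/
structure IsSolution (F : ℝ → G → G) (s : ℝ) (x₀ : G) (x : ℝ → G) : Prop where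
  apply_initial : x s = x₀
  isPrimitive : IsPrimitive x fun τ => F τ (x τ)

namespace IsSolution

variable {F : ℝ → G → G} {s : ℝ} {x₀ : G} {x : ℝ → G}

lemma continuous (hx : IsSolution F s x₀ x) : Continuous x := hx.isPrimitive.continuous

lemma eq (hx : IsSolution F s x₀ x) (t : ℝ) : x t = x₀ + ∫ τ in s..t, F τ (x τ) ∂μI := by
  rw [hx.isPrimitive.eq_add s t, hx.apply_initial]

lemma restart (hx : IsSolution F s x₀ x) (r : ℝ) : IsSolution F r (x r) x :=
  ⟨rfl, hx.isPrimitive⟩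

end IsSolution

namespace IsCaratheodory

variable {F : ℝ → G → G} {a : ℝ → ℝ}

lemma isSolution_of_eq (hF : IsCaratheodory F a) {s : ℝ} {x₀ : G} {x : ℝ → G} (hx : Continuous x)
    (h : ∀ t, x t = x₀ + ∫ τ in s..t, F τ (x τ) ∂μI) : IsSolution F s x₀ x := by
  refine ⟨by simpa using h s, ?_⟩
  simpa only [← h] using
    (isPrimitive_intervalIntegral (hF.integrable_comp x hx) s).const_add x₀

lemma norm_integral_sub_integral_le (hF : IsCaratheodory F a) {x y : ℝ → G} (hx : Continuous x)
    (hy : Continuous y) (s t : ℝ) :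
    ‖(∫ τ in s..t, F τ (x τ) ∂μI) - ∫ τ in s..t, F τ (y τ) ∂μI‖ ≤
      ∫ τ in uIoc s t, a τ * ‖x τ - y τ‖ ∂μI := by
  have hFx := hF.integrable_comp x hx
  have hFy := hF.integrable_comp y hy
  rw [← intervalIntegral.integral_sub hFx.intervalIntegrable hFy.intervalIntegrable]
  exact intervalIntegral.norm_integral_le_integral_norm_uIoc.trans <|
    integral_mono (hFx.sub hFy).norm.integrableOn
      (integrable_mul_of_continuous hF.integrable_lip (hx.sub hy).norm).integrableOn
      fun τ => hF.lip τ _ _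

theorem norm_sub_le (hF : IsCaratheodory F a) {s : ℝ} {x₀ : G} {x : ℝ → G}
    (hx : IsSolution F s x₀ x) {y : ℝ → G} (hy : Continuous y) {e : ℝ}
    (h : ∀ t, ‖y t - x₀ - ∫ τ in s..t, F τ (y τ) ∂μI‖ ≤ e) (t : ℝ) :
    ‖y t - x t‖ ≤ Real.exp (∫ τ, a τ ∂μI) * e := by
  have he : 0 ≤ e := (norm_nonneg _).trans (h 0)
  have hgronwall := le_mul_exp_of_le_add_setIntegral hF.integrable_lip hF.lip_nonneg
    (hy.sub hx.continuous).norm (b := e) (s := s) (fun t => by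
      have hsplit : y t - x t = (y t - x₀ - ∫ τ in s..t, F τ (y τ) ∂μI)
          + ((∫ τ in s..t, F τ (y τ) ∂μI) - ∫ τ in s..t, F τ (x τ) ∂μI) := by
        rw [hx.eq t]; abel
      simp only [Pi.sub_apply]
      rw [hsplit]
      exact norm_add_le_of_le (h t) (hF.norm_integral_sub_integral_le hy hx.continuous s t)) t
  rw [mul_comm]
  refine hgronwall.trans (mul_le_mul_of_nonneg_left (Real.exp_le_exp.2 ?_) he)
  simpa only [Real.norm_eq_abs, abs_of_nonneg (hF.lip_nonneg _)] using
    norm_intervalIntegral_le_integral hF.integrable_lip s t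

lemma eq_of_isSolution (hF : IsCaratheodory F a) {s : ℝ} {x₀ : G} {x y : ℝ → G}
    (hx : IsSolution F s x₀ x) (hy : IsSolution F s x₀ y) : x = y := by
  funext t
  have := hF.norm_sub_le hx hy.continuous (e := 0) (fun t => by rw [hy.eq t]; simp) t
  rw [mul_zero, norm_le_zero_iff, sub_eq_zero] at this
  exact this.symm

/-- The Picard operator `x ↦ x₀ + ∫_s^t F(τ, x(τ)) dτ`, conjugated by the weight
`exp (2 |∫_s^t a|)` so that it becomes a contraction of the bounded continuous curves. -/
noncomputable def weightedPicard (hF : IsCaratheodory F a) (s : ℝ) (x₀ : G)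
    (y : BoundedContinuousFunction ℝ G) : BoundedContinuousFunction ℝ G :=
  have hw (c : ℝ) : Continuous fun t => Real.exp (c * |∫ σ in s..t, a σ ∂μI|) :=
    ((continuous_abs_primitive hF.integrable_lip s).const_mul c).rexp
  have hint := hF.integrable_comp _ ((hw 2).smul y.continuous)
  BoundedContinuousFunction.ofNormedAddCommGroup
    (fun t => Real.exp (-2 * |∫ σ in s..t, a σ ∂μI|) •
      (x₀ + ∫ τ in s..t, F τ (Real.exp (2 * |∫ σ in s..τ, a σ ∂μI|) • y τ) ∂μI))
    ((hw (-2)).smul ((isPrimitive_intervalIntegral hint s).const_add x₀).continuous)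
    (‖x₀‖ + ∫ τ, ‖F τ (Real.exp (2 * |∫ σ in s..τ, a σ ∂μI|) • y τ)‖ ∂μI)
    fun t => by
      rw [norm_smul, Real.norm_of_nonneg (Real.exp_pos _).le]
      refine (mul_le_of_le_one_left (norm_nonneg _) (Real.exp_le_one_iff.2 ?_)).trans
        (norm_add_le_of_le le_rfl (norm_intervalIntegral_le_integral hint s t))
      linarith [abs_nonneg (∫ σ in s..t, a σ ∂μI)]

lemma contractingWith_weightedPicard (hF : IsCaratheodory F a) (s : ℝ) (x₀ : G) :
    ContractingWith (1 / 2) (hF.weightedPicard s x₀) := by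
  refine ⟨by rw [← NNReal.coe_lt_coe]; norm_num, LipschitzWith.of_dist_le_mul fun y z => ?_⟩
  rw [BoundedContinuousFunction.dist_le (by positivity)]
  intro t
  set A : ℝ → ℝ := fun t => |∫ σ in s..t, a σ ∂μI| with hA
  have hAcont : Continuous A := continuous_abs_primitive hF.integrable_lip s
  have hcont (y : BoundedContinuousFunction ℝ G) : Continuous fun τ => Real.exp (2 * A τ) • y τ :=
    (by fun_prop : Continuous fun τ => Real.exp (2 * A τ)).smul y.continuous
  have hexp : Real.exp (-2 * A t) * Real.exp (2 * A t) = 1 := by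
    rw [← Real.exp_add, neg_mul, neg_add_cancel, Real.exp_zero]
  have hint : ∫ τ in uIoc s t, a τ * ‖Real.exp (2 * A τ) • y τ - Real.exp (2 * A τ) • z τ‖ ∂μI ≤
      dist y z * (Real.exp (2 * A t) / 2) :=
    calc _ ≤ ∫ τ in uIoc s t, dist y z * (a τ * Real.exp (2 * A τ)) ∂μI := by
          refine integral_mono (integrable_mul_of_continuous hF.integrable_lip
            ((hcont y).sub (hcont z)).norm).integrableOn
            ((integrable_mul_of_continuous hF.integrable_lip
              (by fun_prop)).const_mul _).integrableOn fun τ => ?_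
          simp only [← smul_sub, norm_smul, Real.norm_of_nonneg (Real.exp_pos _).le, ← dist_eq_norm]
          rw [← mul_assoc, mul_comm (dist y z)]
          exact mul_le_mul_of_nonneg_left (BoundedContinuousFunction.dist_coe_le_dist τ)
            (mul_nonneg (hF.lip_nonneg τ) (Real.exp_pos _).le)
      _ = dist y z * ((Real.exp (2 * A t) - 1) / 2) := by
          rw [integral_const_mul, hA,
            setIntegral_mul_exp_abs_primitive hF.integrable_lip hF.lip_nonneg two_ne_zero]
      _ ≤ dist y z * (Real.exp (2 * A t) / 2) := by gcongr; linarith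
  calc dist (hF.weightedPicard s x₀ y t) (hF.weightedPicard s x₀ z t)
      = ‖Real.exp (-2 * A t) • ((x₀ + ∫ τ in s..t, F τ (Real.exp (2 * A τ) • y τ) ∂μI)
          - (x₀ + ∫ τ in s..t, F τ (Real.exp (2 * A τ) • z τ) ∂μI))‖ := by
        rw [smul_sub]; exact dist_eq_norm _ _
    _ = Real.exp (-2 * A t) * ‖(∫ τ in s..t, F τ (Real.exp (2 * A τ) • y τ) ∂μI)
          - ∫ τ in s..t, F τ (Real.exp (2 * A τ) • z τ) ∂μI‖ := by
        rw [add_sub_add_left_eq_sub, norm_smul, Real.norm_of_nonneg (Real.exp_pos _).le]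
    _ ≤ Real.exp (-2 * A t) * (dist y z * (Real.exp (2 * A t) / 2)) := by
        gcongr
        exact (hF.norm_integral_sub_integral_le (hcont y) (hcont z) s t).trans hint
    _ = dist y z / 2 * (Real.exp (-2 * A t) * Real.exp (2 * A t)) := by ring
    _ = ((1 / 2 : NNReal) : ℝ) * dist y z := by rw [hexp]; push_cast; ring

theorem exists_isSolution [CompleteSpace G] (hF : IsCaratheodory F a) (s : ℝ) (x₀ : G) :
    ∃ x, IsSolution F s x₀ x := by
  obtain ⟨y, hy, -⟩ :=
    (hF.contractingWith_weightedPicard s x₀).exists_fixedPoint 0 (edist_ne_top _ _)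
  refine ⟨fun t => Real.exp (2 * |∫ σ in s..t, a σ ∂μI|) • y t, hF.isSolution_of_eq
    (((continuous_abs_primitive hF.integrable_lip s).const_mul 2).rexp.smul y.continuous)
    fun t => ?_⟩
  have hyt : y t = hF.weightedPicard s x₀ y t := by rw [hy.eq]
  conv_lhs => rw [hyt]
  simp only [weightedPicard, BoundedContinuousFunction.coe_ofNormedAddCommGroup, smul_smul,
    ← Real.exp_add, neg_mul, add_neg_cancel, Real.exp_zero, one_smul]

end IsCaratheodory

end Caratheodory

section ModulusOfContinuity

variable {E F : Type*} [NormedAddCommGroup E] [NormedAddCommGroup F]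

/-- The modulus of continuity `δ ↦ sup {‖D x - D y‖ : ‖x - y‖ ≤ δ}` of a map `D` of bounded
oscillation; the supremum is meaningless for other maps. -/
noncomputable def modulusOfContinuity (D : E → F) (δ : ℝ) : ℝ :=
  ⨆ p : {p : E × E // ‖p.1 - p.2‖ ≤ δ}, ‖D p.1.1 - D p.1.2‖

lemma modulusOfContinuity_nonneg (D : E → F) (δ : ℝ) : 0 ≤ modulusOfContinuity D δ :=
  Real.iSup_nonneg fun _ => norm_nonneg _

lemma modulusOfContinuity_le {D : E → F} {δ c : ℝ} (hc : 0 ≤ c)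
    (h : ∀ x y, ‖x - y‖ ≤ δ → ‖D x - D y‖ ≤ c) : modulusOfContinuity D δ ≤ c :=
  Real.iSup_le (fun p => h p.1.1 p.1.2 p.2) hc

lemma norm_sub_le_modulusOfContinuity {D : E → F} {c δ : ℝ} (hD : ∀ x y, ‖D x - D y‖ ≤ c)
    {x y : E} (hxy : ‖x - y‖ ≤ δ) : ‖D x - D y‖ ≤ modulusOfContinuity D δ :=
  le_ciSup (f := fun p : {p : E × E // ‖p.1 - p.2‖ ≤ δ} => ‖D p.1.1 - D p.1.2‖)
    ⟨c, by rintro _ ⟨p, rfl⟩; exact hD _ _⟩ ⟨(x, y), hxy⟩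

lemma tendsto_modulusOfContinuity {D : E → F} (hD : UniformContinuous D) :
    Tendsto (modulusOfContinuity D) (𝓝[>] 0) (𝓝 0) := by
  rw [Metric.tendsto_nhds]
  intro ε hε
  obtain ⟨δ, hδ, h⟩ := Metric.uniformContinuous_iff.1 hD (ε / 2) (half_pos hε)
  filter_upwards [Ioo_mem_nhdsGT hδ] with r hr
  rw [dist_zero_right, Real.norm_of_nonneg (modulusOfContinuity_nonneg D r)]
  refine (modulusOfContinuity_le (half_pos hε).le fun x y hxy => ?_).trans_lt (half_lt_self hε)
  rw [← dist_eq_norm] at hxy ⊢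
  exact (h (hxy.trans_lt hr.2)).le

end ModulusOfContinuity

section BoundedFamily

variable {V E : Type*} [NormedAddCommGroup V] [NormedSpace ℝ V]
  [NormedAddCommGroup E] [NormedSpace ℝ E]

/-- A linear family of vector fields on `E`, bounded in `C¹` by the norm of the parameter space `V`,
and with uniformly continuous derivatives. -/
structure IsBoundedC1Family (X : V →ₗ[ℝ] (E → E)) (C : ℝ) : Prop where
  pos : 0 < C
  norm_le : ∀ u x, ‖X u x‖ ≤ C * ‖u‖
  contDiff : ∀ u, ContDiff ℝ 1 (X u)
  norm_fderiv_le : ∀ u x, ‖fderiv ℝ (X u) x‖ ≤ C * ‖u‖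
  uniformContinuous_fderiv : ∀ u, UniformContinuous (fderiv ℝ (X u))

namespace IsBoundedC1Family

variable {X : V →ₗ[ℝ] (E → E)} {C : ℝ}

lemma differentiable (hX : IsBoundedC1Family X C) (u : V) : Differentiable ℝ (X u) :=
  (hX.contDiff u).differentiable one_ne_zero

lemma norm_sub_le (hX : IsBoundedC1Family X C) (u : V) (x y : E) :
    ‖X u x - X u y‖ ≤ C * ‖u‖ * ‖x - y‖ :=
  convex_univ.norm_image_sub_le_of_norm_fderiv_le (fun z _ => hX.differentiable u z)
    (fun z _ => hX.norm_fderiv_le u z) (mem_univ y) (mem_univ x)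

lemma fderiv_sub (hX : IsBoundedC1Family X C) (u w : V) (x : E) :
    fderiv ℝ (X (u - w)) x = fderiv ℝ (X u) x - fderiv ℝ (X w) x := by
  rw [map_sub]
  exact _root_.fderiv_sub (hX.differentiable u x) (hX.differentiable w x)

lemma continuous_eval (hX : IsBoundedC1Family X C) : Continuous fun p : V × E => X p.1 p.2 := by
  refine continuous_prod_of_continuous_lipschitzWith _ C.toNNReal
    (fun u => (hX.contDiff u).continuous) fun x => LipschitzWith.of_dist_le_mul fun u w => ?_
  simp only [dist_eq_norm]
  rw [Real.coe_toNNReal _ hX.pos.le, ← Pi.sub_apply, ← map_sub]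
  exact hX.norm_le _ x

lemma continuous_fderiv (hX : IsBoundedC1Family X C) :
    Continuous fun p : V × E => fderiv ℝ (X p.1) p.2 := by
  refine continuous_prod_of_continuous_lipschitzWith _ C.toNNReal
    (fun u => (hX.contDiff u).continuous_fderiv one_ne_zero)
    fun x => LipschitzWith.of_dist_le_mul fun u w => ?_
  simp only [dist_eq_norm]
  rw [Real.coe_toNNReal _ hX.pos.le, ← hX.fderiv_sub]
  exact hX.norm_fderiv_le _ x

lemma norm_fderiv_sub_le (hX : IsBoundedC1Family X C) (u : V) (x y : E) :
    ‖fderiv ℝ (X u) x - fderiv ℝ (X u) y‖ ≤ 2 * C * ‖u‖ :=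
  (_root_.norm_sub_le _ _).trans (by linarith [hX.norm_fderiv_le u x, hX.norm_fderiv_le u y])

lemma modulusOfContinuity_fderiv_le (hX : IsBoundedC1Family X C) (u : V) (δ : ℝ) :
    modulusOfContinuity (fderiv ℝ (X u)) δ ≤ 2 * C * ‖u‖ :=
  modulusOfContinuity_le (mul_nonneg (by linarith [hX.pos]) (norm_nonneg _))
    fun x y _ => hX.norm_fderiv_sub_le u x y

lemma modulusOfContinuity_fderiv_le_add (hX : IsBoundedC1Family X C) (u w : V) (δ : ℝ) :
    modulusOfContinuity (fderiv ℝ (X u)) δ ≤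
      modulusOfContinuity (fderiv ℝ (X w)) δ + 2 * C * ‖u - w‖ := by
  refine modulusOfContinuity_le (add_nonneg (modulusOfContinuity_nonneg _ δ)
    (mul_nonneg (by linarith [hX.pos]) (norm_nonneg _))) fun x y hxy => ?_
  have hsplit : fderiv ℝ (X u) x - fderiv ℝ (X u) y = (fderiv ℝ (X w) x - fderiv ℝ (X w) y)
      + (fderiv ℝ (X (u - w)) x - fderiv ℝ (X (u - w)) y) := by
    rw [hX.fderiv_sub, hX.fderiv_sub]; abel
  rw [hsplit]
  exact norm_add_le_of_le (norm_sub_le_modulusOfContinuity (hX.norm_fderiv_sub_le w) hxy)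
    (hX.norm_fderiv_sub_le _ x y)

lemma continuous_modulusOfContinuity_fderiv (hX : IsBoundedC1Family X C) (δ : ℝ) :
    Continuous fun u => modulusOfContinuity (fderiv ℝ (X u)) δ := by
  refine (LipschitzWith.of_le_add_mul (2 * C).toNNReal fun u w => ?_).continuous
  rw [Real.coe_toNNReal _ (by linarith [hX.pos]), dist_eq_norm]
  exact hX.modulusOfContinuity_fderiv_le_add u w δ

lemma norm_sub_sub_fderiv_le (hX : IsBoundedC1Family X C) (u : V) {x y z : E} {δ : ℝ}
    (hy : ‖y - x‖ ≤ δ) (hz : ‖z - x‖ ≤ δ) :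
    ‖X u y - X u z - fderiv ℝ (X u) x (y - z)‖ ≤
      modulusOfContinuity (fderiv ℝ (X u)) δ * ‖y - z‖ :=
  (convex_closedBall x δ).norm_image_sub_le_of_norm_fderiv_le' (𝕜 := ℝ)
    (fun w _ => hX.differentiable u w)
    (fun _ hw => norm_sub_le_modulusOfContinuity (hX.norm_fderiv_sub_le u)
      (mem_closedBall_iff_norm.1 hw))
    (mem_closedBall_iff_norm.2 hz) (mem_closedBall_iff_norm.2 hy)

variable {v : ℝ → V}

lemma aestronglyMeasurable_modulusOfContinuity (hX : IsBoundedC1Family X C)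
    (hv : AEStronglyMeasurable v μI) (δ : ℝ) :
    AEStronglyMeasurable (fun τ => modulusOfContinuity (fderiv ℝ (X (v τ))) δ) μI :=
  (hX.continuous_modulusOfContinuity_fderiv δ).comp_aestronglyMeasurable hv

lemma norm_modulusOfContinuity_le (hX : IsBoundedC1Family X C) (u : V) (δ : ℝ) :
    ‖modulusOfContinuity (fderiv ℝ (X u)) δ‖ ≤ 2 * C * ‖u‖ := by
  rw [Real.norm_of_nonneg (modulusOfContinuity_nonneg _ _)]
  exact hX.modulusOfContinuity_fderiv_le u δ

lemma integrable_modulusOfContinuity (hX : IsBoundedC1Family X C) (hv : Integrable v μI) (δ : ℝ) :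
    Integrable (fun τ => modulusOfContinuity (fderiv ℝ (X (v τ))) δ) μI :=
  (hv.norm.const_mul (2 * C)).mono' (hX.aestronglyMeasurable_modulusOfContinuity hv.1 δ)
    (ae_of_all _ fun _ => hX.norm_modulusOfContinuity_le _ δ)

lemma tendsto_integral_modulusOfContinuity (hX : IsBoundedC1Family X C) (hv : Integrable v μI) :
    Tendsto (fun δ => ∫ τ, modulusOfContinuity (fderiv ℝ (X (v τ))) δ ∂μI) (𝓝[>] 0) (𝓝 0) := by
  simpa only [integral_zero] using tendsto_integral_filter_of_dominated_convergence
    (fun τ => 2 * C * ‖v τ‖)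
    (.of_forall fun δ => hX.aestronglyMeasurable_modulusOfContinuity hv.1 δ)
    (.of_forall fun δ => ae_of_all _ fun τ => hX.norm_modulusOfContinuity_le _ δ)
    (hv.norm.const_mul _)
    (ae_of_all _ fun τ => tendsto_modulusOfContinuity (hX.uniformContinuous_fderiv (v τ)))

end IsBoundedC1Family

end BoundedFamily

section VelocityNorm

variable {V : Type*} [NormedAddCommGroup V]

lemma integrable_velocity (v : Lp V 2 μI) : Integrable v μI :=
  (Lp.memLp v).integrable one_le_two

lemma integral_norm_velocity_le (v : Lp V 2 μI) : ∫ τ, ‖v τ‖ ∂μI ≤ ‖v‖ := by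
  rw [integral_norm_eq_lintegral_enorm (Lp.aestronglyMeasurable v),
    ← eLpNorm_one_eq_lintegral_enorm, Lp.norm_def]
  exact ENNReal.toReal_mono (Lp.memLp v).2.ne
    (eLpNorm_le_eLpNorm_of_exponent_le one_le_two (Lp.aestronglyMeasurable v))

variable {G : Type*} [NormedAddCommGroup G] [NormedSpace ℝ G]

lemma norm_intervalIntegral_le_of_norm_le {f : ℝ → G} {g : ℝ → ℝ} (hg : Integrable g μI)
    (h : ∀ᵐ τ ∂μI, ‖f τ‖ ≤ g τ) (s t : ℝ) : ‖∫ τ in s..t, f τ ∂μI‖ ≤ ∫ τ, g τ ∂μI :=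
  calc ‖∫ τ in s..t, f τ ∂μI‖ ≤ ∫ τ in uIoc s t, ‖f τ‖ ∂μI :=
        intervalIntegral.norm_integral_le_integral_norm_uIoc
    _ ≤ ∫ τ in uIoc s t, g τ ∂μI := integral_mono_of_nonneg (ae_of_all _ fun _ => norm_nonneg _)
        hg.restrict (ae_restrict_of_ae h)
    _ ≤ ∫ τ, g τ ∂μI :=
        setIntegral_le_integral hg (h.mono fun _ hτ => (norm_nonneg _).trans hτ)

lemma norm_intervalIntegral_le_mul_norm {f : ℝ → G} {c : ℝ} (hc : 0 ≤ c) (v : Lp V 2 μI)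
    (h : ∀ᵐ τ ∂μI, ‖f τ‖ ≤ c * ‖v τ‖) (s t : ℝ) : ‖∫ τ in s..t, f τ ∂μI‖ ≤ c * ‖v‖ := by
  refine (norm_intervalIntegral_le_of_norm_le
    ((integrable_velocity v).norm.const_mul c) h s t).trans ?_
  rw [integral_const_mul]
  exact mul_le_mul_of_nonneg_left (integral_norm_velocity_le v) hc

end VelocityNorm

section Flow

variable {V E : Type*} [NormedAddCommGroup V] [NormedSpace ℝ V]
  [NormedAddCommGroup E] [NormedSpace ℝ E]
  {X : V →ₗ[ℝ] (E → E)} {C : ℝ}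

namespace IsBoundedC1Family

lemma coeFn_sub_velocity (X : V →ₗ[ℝ] (E → E)) (v w : Lp V 2 μI) :
    ∀ᵐ τ ∂μI, ∀ x, X ((v - w : Lp V 2 μI) τ) x = X (v τ) x - X (w τ) x := by
  filter_upwards [Lp.coeFn_sub v w] with τ hτ x
  rw [hτ, Pi.sub_apply, map_sub, Pi.sub_apply]

lemma isCaratheodory (hX : IsBoundedC1Family X C) (v : Lp V 2 μI) :
    IsCaratheodory (fun τ => X (v τ)) fun τ => C * ‖v τ‖ where
  integrable_lip := (integrable_velocity v).norm.const_mul C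
  lip_nonneg _ := mul_nonneg hX.pos.le (norm_nonneg _)
  lip τ x y := hX.norm_sub_le (v τ) x y
  integrable_comp _ hx := ((integrable_velocity v).norm.const_mul C).mono'
    (hX.continuous_eval.comp_aestronglyMeasurable
      ((Lp.aestronglyMeasurable v).prodMk hx.aestronglyMeasurable))
    (ae_of_all _ fun _ => hX.norm_le _ _)

lemma integrable_fderiv_comp (hX : IsBoundedC1Family X C) (v : Lp V 2 μI) {x : ℝ → E}
    (hx : Continuous x) : Integrable (fun τ => fderiv ℝ (X (v τ)) (x τ)) μI :=
  ((integrable_velocity v).norm.const_mul C).mono'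
    (hX.continuous_fderiv.comp_aestronglyMeasurable
      ((Lp.aestronglyMeasurable v).prodMk hx.aestronglyMeasurable))
    (ae_of_all _ fun _ => hX.norm_fderiv_le _ _)

lemma isCaratheodory_linearized (hX : IsBoundedC1Family X C) (v h : Lp V 2 μI) {x : ℝ → E}
    (hx : Continuous x) :
    IsCaratheodory (fun τ z => fderiv ℝ (X (v τ)) (x τ) z + X (h τ) (x τ))
      fun τ => C * ‖v τ‖ where
  integrable_lip := (integrable_velocity v).norm.const_mul C
  lip_nonneg _ := mul_nonneg hX.pos.le (norm_nonneg _)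
  lip τ y z := by
    rw [add_sub_add_right_eq_sub, ← map_sub]
    exact ContinuousLinearMap.le_of_opNorm_le _ (hX.norm_fderiv_le _ _) _
  integrable_comp z hz := by
    refine Integrable.add ?_ ((hX.isCaratheodory h).integrable_comp x hx)
    have hbound := (integrable_mul_of_continuous (integrable_velocity v).norm hz.norm).const_mul C
    refine hbound.mono' ((ContinuousLinearMap.id ℝ (E →L[ℝ] E)).aestronglyMeasurable_comp₂
      (hX.integrable_fderiv_comp v hx).1 hz.aestronglyMeasurable) (ae_of_all _ fun τ => ?_)
    rw [← mul_assoc]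
    exact ContinuousLinearMap.le_of_opNorm_le _ (hX.norm_fderiv_le _ _) _

lemma exp_integral_lip_le (hX : IsBoundedC1Family X C) (v : Lp V 2 μI) :
    Real.exp (∫ τ, C * ‖v τ‖ ∂μI) ≤ Real.exp (C * ‖v‖) := by
  rw [integral_const_mul]
  exact Real.exp_le_exp.2 (mul_le_mul_of_nonneg_left (integral_norm_velocity_le v) hX.pos.le)

end IsBoundedC1Family

variable [CompleteSpace E]

open Classical in
/-- The flow of `v ∈ L²([0,1], V)` from time `s` to time `t`, for a family of fields `X`; its value
is arbitrary where the integral equation is not solvable. -/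
noncomputable def familyFlow (X : V →ₗ[ℝ] (E → E)) (v : Lp V 2 μI) (s t : ℝ) (y : E) : E :=
  if h : ∃ x, IsSolution (fun τ => X (v τ)) s y x then h.choose t else y

namespace IsBoundedC1Family

lemma isSolution_familyFlow (hX : IsBoundedC1Family X C) (v : Lp V 2 μI) (s : ℝ) (y : E) :
    IsSolution (fun τ => X (v τ)) s y (fun t => familyFlow X v s t y) := by
  have h : ∃ x, IsSolution (fun τ => X (v τ)) s y x := (hX.isCaratheodory v).exists_isSolution s y
  simp only [familyFlow, dif_pos h]
  exact h.choose_spec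

lemma familyFlow_eq (hX : IsBoundedC1Family X C) {v : Lp V 2 μI} {s : ℝ} {y : E} {x : ℝ → E}
    (hx : IsSolution (fun τ => X (v τ)) s y x) (t : ℝ) : familyFlow X v s t y = x t :=
  congrFun ((hX.isCaratheodory v).eq_of_isSolution (hX.isSolution_familyFlow v s y) hx) t

lemma familyFlow_self (hX : IsBoundedC1Family X C) (v : Lp V 2 μI) (s : ℝ) (y : E) :
    familyFlow X v s s y = y := (hX.isSolution_familyFlow v s y).apply_initial

lemma familyFlow_familyFlow (hX : IsBoundedC1Family X C) (v : Lp V 2 μI) (s r t : ℝ) (y : E) :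
    familyFlow X v r t (familyFlow X v s r y) = familyFlow X v s t y :=
  hX.familyFlow_eq ((hX.isSolution_familyFlow v s y).restart r) t

lemma continuous_familyFlow_time (hX : IsBoundedC1Family X C) (v : Lp V 2 μI) (s : ℝ) (y : E) :
    Continuous fun t => familyFlow X v s t y := (hX.isSolution_familyFlow v s y).continuous

lemma norm_familyFlow_sub_self_le (hX : IsBoundedC1Family X C) (v : Lp V 2 μI) (s t : ℝ) (y : E) :
    ‖familyFlow X v s t y - y‖ ≤ C * ‖v‖ := by
  rw [(hX.isSolution_familyFlow v s y).eq t, add_sub_cancel_left]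
  exact norm_intervalIntegral_le_mul_norm hX.pos.le v (ae_of_all _ fun _ => hX.norm_le _ _) s t

lemma norm_familyFlow_sub_le (hX : IsBoundedC1Family X C) (v w : Lp V 2 μI) (s t : ℝ) (y z : E) :
    ‖familyFlow X v s t y - familyFlow X w s t z‖ ≤
      Real.exp (C * ‖w‖) * (‖y - z‖ + C * ‖v - w‖) := by
  have hCv : 0 ≤ C * ‖v - w‖ := mul_nonneg hX.pos.le (norm_nonneg _)
  have hc := hX.continuous_familyFlow_time v s y
  refine ((hX.isCaratheodory w).norm_sub_le (hX.isSolution_familyFlow w s z) hc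
    (e := ‖y - z‖ + C * ‖v - w‖) (fun r => ?_) t).trans
    (mul_le_mul_of_nonneg_right (hX.exp_integral_lip_le w) (by positivity))
  have hdefect : familyFlow X v s r y - z - ∫ τ in s..r, X (w τ) (familyFlow X v s τ y) ∂μI =
      (y - z) + ∫ τ in s..r, (X (v τ) (familyFlow X v s τ y)
        - X (w τ) (familyFlow X v s τ y)) ∂μI := by
    rw [intervalIntegral.integral_sub
      ((hX.isCaratheodory v).integrable_comp _ hc).intervalIntegrable
      ((hX.isCaratheodory w).integrable_comp _ hc).intervalIntegrable,
      (hX.isSolution_familyFlow v s y).eq r]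
    abel
  rw [hdefect]
  refine norm_add_le_of_le le_rfl (norm_intervalIntegral_le_mul_norm hX.pos.le _ ?_ _ _)
  filter_upwards [coeFn_sub_velocity X v w] with τ hτ
  rw [← hτ]
  exact hX.norm_le _ _

lemma continuous_familyFlow (hX : IsBoundedC1Family X C) :
    Continuous fun p : Lp V 2 μI × ℝ × ℝ × E => familyFlow X p.1 p.2.1 p.2.2.1 p.2.2.2 := by
  rw [continuous_iff_continuousAt]
  rintro ⟨v, s, t, y⟩
  have hcont : Continuous fun p : Lp V 2 μI × ℝ × ℝ × E => familyFlow X v s p.2.2.1 y :=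
    (hX.continuous_familyFlow_time v s y).comp (by fun_prop)
  have hdiff : Tendsto (fun p : Lp V 2 μI × ℝ × ℝ × E => familyFlow X p.1 p.2.1 p.2.2.1 p.2.2.2
      - familyFlow X v s p.2.2.1 y) (𝓝 (v, s, t, y)) (𝓝 0) := by
    refine squeeze_zero_norm (a := fun p : Lp V 2 μI × ℝ × ℝ × E => Real.exp (C * ‖v‖) *
        (‖p.2.2.2 - familyFlow X v s p.2.1 y‖ + C * ‖p.1 - v‖)) (fun p => ?_) ?_
    · rw [← hX.familyFlow_familyFlow v s p.2.1 p.2.2.1 y]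
      exact hX.norm_familyFlow_sub_le _ _ _ _ _ _
    · have hc : Continuous fun p : Lp V 2 μI × ℝ × ℝ × E => familyFlow X v s p.2.1 y :=
        (hX.continuous_familyFlow_time v s y).comp (by fun_prop)
      have hbound : Continuous fun p : Lp V 2 μI × ℝ × ℝ × E => Real.exp (C * ‖v‖) *
        (‖p.2.2.2 - familyFlow X v s p.2.1 y‖ + C * ‖p.1 - v‖) := by fun_prop
      simpa [hX.familyFlow_self] using hbound.tendsto (v, s, t, y)
  simpa [ContinuousAt] using hdiff.add (hcont.tendsto (v, s, t, y))

lemma continuous_familyFlow_point (hX : IsBoundedC1Family X C) (v : Lp V 2 μI) (s t : ℝ) :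
    Continuous (familyFlow X v s t) :=
  hX.continuous_familyFlow.comp (by fun_prop : Continuous fun y : E =>
    ((v, s, t, y) : Lp V 2 μI × ℝ × ℝ × E))

end IsBoundedC1Family

end Flow

section LinearizedFlow

variable {V E : Type*} [NormedAddCommGroup V] [NormedSpace ℝ V]
  [NormedAddCommGroup E] [NormedSpace ℝ E]
  {X : V →ₗ[ℝ] (E → E)} {C : ℝ}

namespace IsBoundedC1Family

lemma norm_eval_sub_sub_linearized_le (hX : IsBoundedC1Family X C) (u u₁ u₂ : V) {x x₁ x₂ : E}
    {δ : ℝ} (h₁ : ‖x₁ - x‖ ≤ δ) (h₂ : ‖x₂ - x‖ ≤ δ) :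
    ‖X u₁ x₁ - X u₂ x₂ - (fderiv ℝ (X u) x (x₁ - x₂) + (X u₁ x - X u₂ x))‖ ≤ C * δ * ‖u₁ - u₂‖
      + (C * ‖u₂ - u‖ + modulusOfContinuity (fderiv ℝ (X u)) δ) * ‖x₁ - x₂‖ := by
  have hsplit : X u₁ x₁ - X u₂ x₂ - (fderiv ℝ (X u) x (x₁ - x₂) + (X u₁ x - X u₂ x)) =
      (X (u₁ - u₂) x₁ - X (u₁ - u₂) x) + ((X (u₂ - u) x₁ - X (u₂ - u) x₂)
      + (X u x₁ - X u x₂ - fderiv ℝ (X u) x (x₁ - x₂))) := by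
    simp only [map_sub, Pi.sub_apply]
    abel
  rw [hsplit, add_mul]
  refine norm_add_le_of_le ((hX.norm_sub_le _ _ _).trans ?_)
    (norm_add_le_of_le (hX.norm_sub_le _ _ _) (hX.norm_sub_sub_fderiv_le u h₁ h₂))
  rw [mul_right_comm]
  exact mul_le_mul_of_nonneg_right (mul_le_mul_of_nonneg_left h₁ hX.pos.le) (norm_nonneg _)

lemma norm_integral_sub_linearized_le (hX : IsBoundedC1Family X C) (v v₁ v₂ : Lp V 2 μI)
    {x x₁ x₂ : ℝ → E} {δ D : ℝ} (h₁ : ∀ τ, ‖x₁ τ - x τ‖ ≤ δ) (h₂ : ∀ τ, ‖x₂ τ - x τ‖ ≤ δ)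
    (h₁₂ : ∀ τ, ‖x₁ τ - x₂ τ‖ ≤ D) (s t : ℝ) :
    ‖∫ τ in s..t, (X (v₁ τ) (x₁ τ) - X (v₂ τ) (x₂ τ) - (fderiv ℝ (X (v τ)) (x τ) (x₁ τ - x₂ τ)
        + X ((v₁ - v₂ : Lp V 2 μI) τ) (x τ))) ∂μI‖ ≤ C * δ * ‖v₁ - v₂‖
      + (C * ‖v₂ - v‖ + ∫ τ, modulusOfContinuity (fderiv ℝ (X (v τ))) δ ∂μI) * D := by
  have hC := hX.pos
  have hδ : 0 ≤ δ := (norm_nonneg _).trans (h₁ 0)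
  have hD : 0 ≤ D := (norm_nonneg _).trans (h₁₂ 0)
  have hi₁ := (integrable_velocity (v₁ - v₂)).norm.const_mul (C * δ)
  have hi₂ := (integrable_velocity (v₂ - v)).norm.const_mul C
  have hi₃ := hX.integrable_modulusOfContinuity (integrable_velocity v) δ
  refine (norm_intervalIntegral_le_of_norm_le (hi₁.add ((hi₂.add hi₃).mul_const D)) ?_ s t).trans ?_
  · filter_upwards [Lp.coeFn_sub v₁ v₂, Lp.coeFn_sub v₂ v] with τ h h'
    simp only [Pi.add_apply, h, h', Pi.sub_apply, map_sub X]
    refine (hX.norm_eval_sub_sub_linearized_le (v τ) (v₁ τ) (v₂ τ) (h₁ τ) (h₂ τ)).trans ?_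
    gcongr
    exacts [add_nonneg (by positivity) (modulusOfContinuity_nonneg _ _), h₁₂ τ]
  · rw [integral_add' hi₁ ((hi₂.add hi₃).mul_const D), integral_const_mul, integral_mul_const,
      integral_add' hi₂ hi₃, integral_const_mul]
    gcongr <;> exact integral_norm_velocity_le _

lemma tendsto_linearizationRate (hX : IsBoundedC1Family X C) (v : Lp V 2 μI) (A B : ℝ) :
    Tendsto (fun δ => Real.exp (C * ‖v‖) * (C * δ + (C * (A * δ)
      + ∫ τ, modulusOfContinuity (fderiv ℝ (X (v τ))) δ ∂μI) *
        (Real.exp (C * (‖v‖ + A * δ)) * B))) (𝓝[>] 0) (𝓝 0) := by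
  have hid : Tendsto (fun δ : ℝ => δ) (𝓝[>] 0) (𝓝 0) := nhdsWithin_le_nhds
  have hexp : Tendsto (fun δ => Real.exp (C * (‖v‖ + A * δ)) * B) (𝓝[>] 0)
      (𝓝 (Real.exp (C * (‖v‖ + A * 0)) * B)) :=
    ((Real.continuous_exp.tendsto _).comp
      (((hid.const_mul A).const_add ‖v‖).const_mul C)).mul_const B
  simpa using ((hid.const_mul C).add ((((hid.const_mul A).const_mul C).add
    (hX.tendsto_integral_modulusOfContinuity (integrable_velocity v))).mul hexp)).const_mul
      (Real.exp (C * ‖v‖))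

variable [CompleteSpace E]

lemma norm_familyFlow_sub_sub_linearized_le (hX : IsBoundedC1Family X C) {v v₁ v₂ : Lp V 2 μI}
    {y y₁ y₂ : E} {δ : ℝ} (h₁ : Real.exp (C * ‖v‖) * (‖y₁ - y‖ + C * ‖v₁ - v‖) ≤ δ)
    (h₂ : Real.exp (C * ‖v‖) * (‖y₂ - y‖ + C * ‖v₂ - v‖) ≤ δ) (s t : ℝ) {η : ℝ → E}
    (hη : IsSolution (fun τ z => fderiv ℝ (X (v τ)) (familyFlow X v s τ y) z
      + X ((v₁ - v₂ : Lp V 2 μI) τ) (familyFlow X v s τ y)) s (y₁ - y₂) η) :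
    ‖familyFlow X v₁ s t y₁ - familyFlow X v₂ s t y₂ - η t‖ ≤ Real.exp (C * ‖v‖) *
      (C * δ * ‖v₁ - v₂‖ + (C * ‖v₂ - v‖ + ∫ τ, modulusOfContinuity (fderiv ℝ (X (v τ))) δ ∂μI)
        * (Real.exp (C * ‖v₂‖) * (‖y₁ - y₂‖ + C * ‖v₁ - v₂‖))) := by
  have hx := hX.continuous_familyFlow_time v s y
  have hx₁ := hX.continuous_familyFlow_time v₁ s y₁
  have hx₂ := hX.continuous_familyFlow_time v₂ s y₂
  have hrem := hX.norm_integral_sub_linearized_le v v₁ v₂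
    (fun τ => (hX.norm_familyFlow_sub_le v₁ v s τ y₁ y).trans h₁)
    (fun τ => (hX.norm_familyFlow_sub_le v₂ v s τ y₂ y).trans h₂)
    (fun τ => hX.norm_familyFlow_sub_le v₁ v₂ s τ y₁ y₂)
  refine ((hX.isCaratheodory_linearized v (v₁ - v₂) hx).norm_sub_le hη (hx₁.sub hx₂)
    (fun r => ?_) t).trans (mul_le_mul_of_nonneg_right (hX.exp_integral_lip_le v)
      ((norm_nonneg _).trans (hrem s t)))
  refine le_of_eq_of_le (congrArg norm ?_) (hrem s r)
  have hI₁ := ((hX.isCaratheodory v₁).integrable_comp _ hx₁).intervalIntegrable (a := s) (b := r)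
  have hI₂ := ((hX.isCaratheodory v₂).integrable_comp _ hx₂).intervalIntegrable (a := s) (b := r)
  have hI₃ := ((hX.isCaratheodory_linearized v (v₁ - v₂) hx).integrable_comp _
    (hx₁.sub hx₂)).intervalIntegrable (a := s) (b := r)
  simp only [Pi.sub_apply] at hI₃ ⊢
  rw [intervalIntegral.integral_sub (hI₁.sub hI₂) hI₃,
    intervalIntegral.integral_sub hI₁ hI₂, (hX.isSolution_familyFlow v₁ s y₁).eq r,
    (hX.isSolution_familyFlow v₂ s y₂).eq r]
  abel

/-- Strict differentiability of the flow at `(v, y)`, stated as an estimate in order to be uniform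
in the times `s`, `t` and the point `y`. -/
theorem exists_norm_familyFlow_sub_sub_le (hX : IsBoundedC1Family X C) (v : Lp V 2 μI) {ε : ℝ}
    (hε : 0 < ε) : ∃ r > 0, ∀ v₁ v₂ : Lp V 2 μI, ∀ y y₁ y₂ : E, ‖v₁ - v‖ ≤ r → ‖v₂ - v‖ ≤ r →
      ‖y₁ - y‖ ≤ r → ‖y₂ - y‖ ≤ r → ∀ s t, ∀ η : ℝ → E,
      IsSolution (fun τ z => fderiv ℝ (X (v τ)) (familyFlow X v s τ y) z
        + X ((v₁ - v₂ : Lp V 2 μI) τ) (familyFlow X v s τ y)) s (y₁ - y₂) η →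
      ‖familyFlow X v₁ s t y₁ - familyFlow X v₂ s t y₂ - η t‖ ≤
        ε * (‖v₁ - v₂‖ + ‖y₁ - y₂‖) := by
  have hC := hX.pos
  set A := (Real.exp (C * ‖v‖) * (1 + C))⁻¹ with hA
  have : 0 < A := by positivity
  obtain ⟨δ, hδε, hδ : 0 < δ⟩ :=
    (((hX.tendsto_linearizationRate v A (1 + C)).eventually_le_const hε).and
      self_mem_nhdsWithin).exists
  refine ⟨A * δ, by positivity, fun v₁ v₂ y y₁ y₂ hv₁ hv₂ hy₁ hy₂ s t η hη => ?_⟩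
  have hnear : ∀ {w : Lp V 2 μI} {z : E}, ‖w - v‖ ≤ A * δ → ‖z - y‖ ≤ A * δ →
      Real.exp (C * ‖v‖) * (‖z - y‖ + C * ‖w - v‖) ≤ δ := fun hw hz =>
    calc _ ≤ Real.exp (C * ‖v‖) * (A * δ + C * (A * δ)) := by gcongr
      _ = δ := by rw [hA]; field_simp
  have hv₂' : ‖v₂‖ ≤ ‖v‖ + A * δ := (norm_le_norm_add_norm_sub' v₂ v).trans (by gcongr)
  have hm : 0 ≤ ∫ τ, modulusOfContinuity (fderiv ℝ (X (v τ))) δ ∂μI :=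
    integral_nonneg fun _ => modulusOfContinuity_nonneg _ _
  set d := ‖v₁ - v₂‖ + ‖y₁ - y₂‖
  have hvd : ‖v₁ - v₂‖ ≤ d := le_add_of_nonneg_right (norm_nonneg _)
  have hyd : ‖y₁ - y₂‖ + C * ‖v₁ - v₂‖ ≤ (1 + C) * d := by
    nlinarith [norm_nonneg (v₁ - v₂), norm_nonneg (y₁ - y₂)]
  calc _ ≤ _ := hX.norm_familyFlow_sub_sub_linearized_le (hnear hv₁ hy₁) (hnear hv₂ hy₂) s t hη
    _ ≤ Real.exp (C * ‖v‖) * (C * δ * d + (C * (A * δ)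
        + ∫ τ, modulusOfContinuity (fderiv ℝ (X (v τ))) δ ∂μI)
          * (Real.exp (C * (‖v‖ + A * δ)) * ((1 + C) * d))) := by gcongr
    _ = _ * d := by ring
    _ ≤ ε * d := mul_le_mul_of_nonneg_right hδε (by positivity)

end IsBoundedC1Family

end LinearizedFlow

section StrictDifferentiability

lemma continuous_of_forall_hasStrictFDerivAt {𝕜 E F : Type*} [NontriviallyNormedField 𝕜]
    [NormedAddCommGroup E] [NormedSpace 𝕜 E] [NormedAddCommGroup F] [NormedSpace 𝕜 F]
    {f : E → F} {f' : E → E →L[𝕜] F} (hf : ∀ x, HasStrictFDerivAt f (f' x) x) :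
    Continuous f' := by
  rw [continuous_iff_continuousAt]
  refine fun x => Metric.tendsto_nhds.2 fun ε hε => ?_
  have hlip : ∀ᶠ p : E × E in 𝓝 x ×ˢ 𝓝 x,
      ‖f p.1 - f p.2 - f' x (p.1 - p.2)‖ ≤ ε / 2 * ‖p.1 - p.2‖ := by
    rw [← nhds_prod_eq]
    exact (hf x).isLittleO.bound (half_pos hε)
  obtain ⟨P, hP, Q, hQ, hPQ⟩ := eventually_prod_iff.1 hlip
  filter_upwards [hQ, hP.eventually_nhds] with y hy hPy
  rw [dist_eq_norm]
  refine lt_of_le_of_lt (((hf y).hasFDerivAt.sub (f' x).hasFDerivAt).le_of_lip' (half_pos hε).le ?_)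
    (half_lt_self hε)
  filter_upwards [hPy] with z hz
  simpa only [Pi.sub_apply, map_sub, sub_sub_sub_comm] using hPQ hz hy

end StrictDifferentiability

section FlowDerivative

variable {V E : Type*} [NormedAddCommGroup V] [NormedSpace ℝ V]
  [NormedAddCommGroup E] [NormedSpace ℝ E]
  {X : V →ₗ[ℝ] (E → E)} {C : ℝ}

namespace IsBoundedC1Family

lemma isCaratheodory_fderiv_comp (hX : IsBoundedC1Family X C) (v : Lp V 2 μI) {x : ℝ → E}
    (hx : Continuous x) :
    IsCaratheodory (fun τ (M : E →L[ℝ] E) => (fderiv ℝ (X (v τ)) (x τ)).comp M)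
      fun τ => C * ‖v τ‖ where
  integrable_lip := (integrable_velocity v).norm.const_mul C
  lip_nonneg _ := mul_nonneg hX.pos.le (norm_nonneg _)
  lip τ M N := by
    rw [← ContinuousLinearMap.comp_sub]
    exact (ContinuousLinearMap.opNorm_comp_le _ _).trans
      (mul_le_mul_of_nonneg_right (hX.norm_fderiv_le _ _) (norm_nonneg _))
  integrable_comp _ hM := IsPrimitive.integrable_bilin_left (ContinuousLinearMap.compL ℝ E E E)
    (hX.integrable_fderiv_comp v hx) hM

variable [CompleteSpace E]

lemma hasStrictFDerivAt_familyFlow_of_isSolution (hX : IsBoundedC1Family X C) (v : Lp V 2 μI)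
    {s : ℝ} {y : E} {M : ℝ → E →L[ℝ] E}
    (hM : IsSolution (fun τ M => (fderiv ℝ (X (v τ)) (familyFlow X v s τ y)).comp M) s
      (ContinuousLinearMap.id ℝ E) M) (t : ℝ) : HasStrictFDerivAt (familyFlow X v s t) (M t) y := by
  refine HasStrictFDerivAt.of_isLittleO (Asymptotics.isLittleO_iff.2 fun ε hε => ?_)
  obtain ⟨r, hr, hlip⟩ := hX.exists_norm_familyFlow_sub_sub_le v hε
  have hsol (k : E) : IsSolution (fun τ z => fderiv ℝ (X (v τ)) (familyFlow X v s τ y) z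
      + X ((v - v : Lp V 2 μI) τ) (familyFlow X v s τ y)) s k fun t => M t k := by
    refine ⟨by simp [hM.apply_initial],
      (hM.isPrimitive.clm_comp (ContinuousLinearMap.apply ℝ E k)).congr_ae
        (.of_forall fun τ => by simp)⟩
  filter_upwards [Metric.closedBall_mem_nhds (y, y) hr] with p hp
  rw [Metric.mem_closedBall, Prod.dist_eq, max_le_iff, dist_eq_norm, dist_eq_norm] at hp
  simpa using hlip v v y p.1 p.2 (by simpa using hr.le) (by simpa using hr.le) hp.1 hp.2 s t _
    (hsol (p.1 - p.2))

theorem isSolution_fderiv_familyFlow (hX : IsBoundedC1Family X C) (v : Lp V 2 μI) (s : ℝ) (y : E) :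
    IsSolution (fun τ M => (fderiv ℝ (X (v τ)) (familyFlow X v s τ y)).comp M) s
      (ContinuousLinearMap.id ℝ E) fun t => fderiv ℝ (familyFlow X v s t) y := by
  obtain ⟨M, hM⟩ := (hX.isCaratheodory_fderiv_comp v
    (hX.continuous_familyFlow_time v s y)).exists_isSolution s (ContinuousLinearMap.id ℝ E)
  rwa [funext fun t => (hX.hasStrictFDerivAt_familyFlow_of_isSolution v hM t).hasFDerivAt.fderiv]

lemma hasStrictFDerivAt_familyFlow (hX : IsBoundedC1Family X C) (v : Lp V 2 μI) (s t : ℝ) (y : E) :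
    HasStrictFDerivAt (familyFlow X v s t) (fderiv ℝ (familyFlow X v s t) y) y :=
  hX.hasStrictFDerivAt_familyFlow_of_isSolution v (hX.isSolution_fderiv_familyFlow v s y) t

lemma hasFDerivAt_familyFlow (hX : IsBoundedC1Family X C) (v : Lp V 2 μI) (s t : ℝ) (y : E) :
    HasFDerivAt (familyFlow X v s t) (fderiv ℝ (familyFlow X v s t) y) y :=
  (hX.hasStrictFDerivAt_familyFlow v s t y).hasFDerivAt

lemma continuous_fderiv_familyFlow (hX : IsBoundedC1Family X C) (v : Lp V 2 μI) (s t : ℝ) :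
    Continuous (fderiv ℝ (familyFlow X v s t)) :=
  continuous_of_forall_hasStrictFDerivAt (hX.hasStrictFDerivAt_familyFlow v s t)

theorem contDiff_familyFlow (hX : IsBoundedC1Family X C) (v : Lp V 2 μI) (s t : ℝ) :
    ContDiff ℝ 1 (familyFlow X v s t) :=
  contDiff_one_iff_fderiv.2 ⟨fun y => (hX.hasFDerivAt_familyFlow v s t y).differentiableAt,
    hX.continuous_fderiv_familyFlow v s t⟩

lemma norm_fderiv_familyFlow_le (hX : IsBoundedC1Family X C) (v : Lp V 2 μI) (s t : ℝ) (y : E) :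
    ‖fderiv ℝ (familyFlow X v s t) y‖ ≤ Real.exp (C * ‖v‖) :=
  (hX.hasFDerivAt_familyFlow v s t y).le_of_lip' (Real.exp_pos _).le
    (.of_forall fun z => by simpa using hX.norm_familyFlow_sub_le v v s t z y)

lemma fderiv_familyFlow_comp (hX : IsBoundedC1Family X C) (v : Lp V 2 μI) (s r t : ℝ) (y : E) :
    (fderiv ℝ (familyFlow X v r t) (familyFlow X v s r y)).comp (fderiv ℝ (familyFlow X v s r) y) =
      fderiv ℝ (familyFlow X v s t) y := by
  have hcomp := (hX.hasFDerivAt_familyFlow v r t _).comp y (hX.hasFDerivAt_familyFlow v s r y)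
  rw [← hcomp.fderiv]
  exact congrArg (fderiv ℝ · y) (funext (hX.familyFlow_familyFlow v s r t))

lemma fderiv_familyFlow_self (hX : IsBoundedC1Family X C) (v : Lp V 2 μI) (s : ℝ) (y : E) :
    fderiv ℝ (familyFlow X v s s) y = ContinuousLinearMap.id ℝ E :=
  (hX.isSolution_fderiv_familyFlow v s y).apply_initial

lemma fderiv_familyFlow_inverse_comp (hX : IsBoundedC1Family X C) (v : Lp V 2 μI) (s t : ℝ)
    (y : E) : (fderiv ℝ (familyFlow X v t s) (familyFlow X v s t y)).comp
      (fderiv ℝ (familyFlow X v s t) y) = ContinuousLinearMap.id ℝ E := by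
  rw [hX.fderiv_familyFlow_comp, hX.fderiv_familyFlow_self]

lemma fderiv_familyFlow_comp_inverse (hX : IsBoundedC1Family X C) (v : Lp V 2 μI) (s t : ℝ)
    (y : E) : (fderiv ℝ (familyFlow X v s t) y).comp
      (fderiv ℝ (familyFlow X v t s) (familyFlow X v s t y)) = ContinuousLinearMap.id ℝ E := by
  have h := hX.fderiv_familyFlow_inverse_comp v t s (familyFlow X v s t y)
  rwa [hX.familyFlow_familyFlow, hX.familyFlow_self] at h

lemma continuous_fderiv_familyFlow_inverse (hX : IsBoundedC1Family X C) (v : Lp V 2 μI) (s : ℝ)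
    (y : E) : Continuous fun t => fderiv ℝ (familyFlow X v t s) (familyFlow X v s t y) := by
  let M (t : ℝ) : (E →L[ℝ] E)ˣ :=
    ⟨fderiv ℝ (familyFlow X v s t) y, fderiv ℝ (familyFlow X v t s) (familyFlow X v s t y),
      hX.fderiv_familyFlow_comp_inverse v s t y, hX.fderiv_familyFlow_inverse_comp v s t y⟩
  have hinv : (fun t => fderiv ℝ (familyFlow X v t s) (familyFlow X v s t y)) =
      Ring.inverse ∘ fun t => fderiv ℝ (familyFlow X v s t) y :=
    funext fun t => (Ring.inverse_unit (M t)).symm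
  rw [hinv]
  refine continuous_iff_continuousAt.2 fun t => ContinuousAt.comp ?_
    (hX.isSolution_fderiv_familyFlow v s y).continuous.continuousAt
  exact NormedRing.inverse_continuousAt (M t)

theorem det_fderiv_familyFlow_pos (hX : IsBoundedC1Family X C) (v : Lp V 2 μI) (s t : ℝ) (y : E) :
    0 < (fderiv ℝ (familyFlow X v s t) y).det := by
  have hcont : Continuous fun t => (fderiv ℝ (familyFlow X v s t) y).det :=
    ContinuousLinearMap.continuous_det.comp (hX.isSolution_fderiv_familyFlow v s y).continuous
  have hself : (fderiv ℝ (familyFlow X v s s) y).det = 1 := by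
    rw [hX.fderiv_familyFlow_self]
    exact LinearMap.det_id
  have hne (r : ℝ) : (fderiv ℝ (familyFlow X v s r) y).det ≠ 0 := fun h => by
    have hdet := congrArg ContinuousLinearMap.det (hX.fderiv_familyFlow_inverse_comp v s r y)
    have hmul := LinearMap.det_comp
      (fderiv ℝ (familyFlow X v r s) (familyFlow X v s r y) : E →ₗ[ℝ] E)
      (fderiv ℝ (familyFlow X v s r) y : E →ₗ[ℝ] E)
    rw [← hX.fderiv_familyFlow_self v s y, hself] at hdet
    exact one_ne_zero (hdet.symm.trans (hmul.trans (mul_eq_zero_of_right _ h)))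
  by_contra! hneg
  obtain ⟨r, -, hr⟩ := intermediate_value_uIcc (a := s) (b := t) hcont.continuousOn
    (mem_uIcc.2 (.inr ⟨hneg, hself ▸ zero_le_one⟩))
  exact hne r hr

end IsBoundedC1Family

end FlowDerivative

section FlowVariation

variable {V E : Type*} [NormedAddCommGroup V] [NormedSpace ℝ V]
  [NormedAddCommGroup E] [NormedSpace ℝ E]
  {X : V →ₗ[ℝ] (E → E)} {C : ℝ}

/-- The effect at time `t`, on the trajectory of `v` through `y` at time `s`, of perturbing the
velocity at time `τ` by `h τ`. -/
noncomputable def flowVariationIntegrand (X : V →ₗ[ℝ] (E → E)) (v h : Lp V 2 μI) (s t : ℝ) (y : E)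
    (τ : ℝ) : E :=
  fderiv ℝ (familyFlow X v τ t) (familyFlow X v s τ y) (X (h τ) (familyFlow X v s τ y))

/-- The derivative of `v ↦ φ_{s,t}ᵛ(y)` in the direction `h`, in the form given by variation of
constants. -/
noncomputable def flowVariation (X : V →ₗ[ℝ] (E → E)) (v h : Lp V 2 μI) (s t : ℝ) (y : E) : E :=
  ∫ τ in s..t, flowVariationIntegrand X v h s t y τ ∂μI

lemma flowVariation_smul (X : V →ₗ[ℝ] (E → E)) (c : ℝ) (v h : Lp V 2 μI) (s t : ℝ) (y : E) :
    flowVariation X v (c • h) s t y = c • flowVariation X v h s t y := by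
  rw [flowVariation, flowVariation, ← intervalIntegral.integral_smul]
  refine intervalIntegral.integral_congr_ae ((Lp.coeFn_smul c h).mono fun τ hτ _ => ?_)
  simp only [flowVariationIntegrand, hτ, Pi.smul_apply, map_smul]

variable [CompleteSpace E]

namespace IsBoundedC1Family

lemma flowVariationIntegrand_eq_fderiv (hX : IsBoundedC1Family X C) (v h : Lp V 2 μI) (s t : ℝ)
    (y : E) (τ : ℝ) :
    flowVariationIntegrand X v h s t y τ =
      fderiv ℝ (familyFlow X v s t) y (flowVariationIntegrand X v h s s y τ) := by
  have hcomp := hX.fderiv_familyFlow_comp v τ s t (familyFlow X v s τ y)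
  rw [hX.familyFlow_familyFlow, hX.familyFlow_self] at hcomp
  rw [flowVariationIntegrand, ← hcomp, ContinuousLinearMap.comp_apply, flowVariationIntegrand]

lemma norm_flowVariationIntegrand_le (hX : IsBoundedC1Family X C) (v h : Lp V 2 μI) (s t : ℝ)
    (y : E) (τ : ℝ) :
    ‖flowVariationIntegrand X v h s t y τ‖ ≤ Real.exp (C * ‖v‖) * C * ‖h τ‖ := by
  rw [mul_assoc]
  exact ContinuousLinearMap.le_of_opNorm_le_of_le _ (hX.norm_fderiv_familyFlow_le v τ t _)
    (hX.norm_le _ _)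

lemma integrable_flowVariationIntegrand (hX : IsBoundedC1Family X C) (v h : Lp V 2 μI) (s t : ℝ)
    (y : E) : Integrable (flowVariationIntegrand X v h s t y) μI := by
  have hfield := (hX.isCaratheodory h).integrable_comp _ (hX.continuous_familyFlow_time v s y)
  rw [funext (hX.flowVariationIntegrand_eq_fderiv v h s t y)]
  exact ContinuousLinearMap.integrable_comp _ (IsPrimitive.integrable_bilin_left
    (ContinuousLinearMap.apply ℝ E) hfield (hX.continuous_fderiv_familyFlow_inverse v s y))

lemma flowVariation_add (hX : IsBoundedC1Family X C) (v g h : Lp V 2 μI) (s t : ℝ) (y : E) :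
    flowVariation X v (g + h) s t y = flowVariation X v g s t y + flowVariation X v h s t y := by
  rw [flowVariation, flowVariation, flowVariation, ← intervalIntegral.integral_add
    (hX.integrable_flowVariationIntegrand v g s t y).intervalIntegrable
    (hX.integrable_flowVariationIntegrand v h s t y).intervalIntegrable]
  refine intervalIntegral.integral_congr_ae ((Lp.coeFn_add g h).mono fun τ hτ _ => ?_)
  simp only [flowVariationIntegrand, hτ, Pi.add_apply, map_add]

lemma norm_flowVariation_le (hX : IsBoundedC1Family X C) (v h : Lp V 2 μI) (s t : ℝ) (y : E) :
    ‖flowVariation X v h s t y‖ ≤ Real.exp (C * ‖v‖) * C * ‖h‖ :=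
  norm_intervalIntegral_le_mul_norm (mul_nonneg (Real.exp_pos _).le hX.pos.le) h
    (ae_of_all _ (hX.norm_flowVariationIntegrand_le v h s t y)) s t

lemma continuous_flowVariation (hX : IsBoundedC1Family X C) (v h : Lp V 2 μI) (s t : ℝ) :
    Continuous (flowVariation X v h s t) := by
  refine intervalIntegral.continuous_of_dominated_interval
    (fun y => (hX.integrable_flowVariationIntegrand v h s t y).aestronglyMeasurable.restrict)
    (fun y => ae_of_all _ fun τ _ => hX.norm_flowVariationIntegrand_le v h s t y τ)
    ((integrable_velocity h).norm.const_mul _).intervalIntegrable (ae_of_all _ fun τ _ => ?_)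
  have hflow := hX.continuous_familyFlow_point v s τ
  exact ((hX.continuous_fderiv_familyFlow v τ t).comp hflow).clm_apply
    ((hX.contDiff (h τ)).continuous.comp hflow)

theorem isSolution_flowVariation (hX : IsBoundedC1Family X C) (v h : Lp V 2 μI) (s : ℝ) (y : E) :
    IsSolution (fun τ z => fderiv ℝ (X (v τ)) (familyFlow X v s τ y) z
      + X (h τ) (familyFlow X v s τ y)) s 0 fun t => flowVariation X v h s t y := by
  have hfactor (t : ℝ) : flowVariation X v h s t y = fderiv ℝ (familyFlow X v s t) y
      (∫ τ in s..t, flowVariationIntegrand X v h s s y τ ∂μI) := by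
    rw [flowVariation, ← ContinuousLinearMap.intervalIntegral_comp_comm _
      (hX.integrable_flowVariationIntegrand v h s s y).intervalIntegrable]
    simp only [hX.flowVariationIntegrand_eq_fderiv v h s t y]
  have hinverse (τ : ℝ) : fderiv ℝ (familyFlow X v s τ) y
      (flowVariationIntegrand X v h s s y τ) = X (h τ) (familyFlow X v s τ y) :=
    DFunLike.congr_fun (hX.fderiv_familyFlow_comp_inverse v s τ y) _
  refine ⟨intervalIntegral.integral_same, ?_⟩
  simp only [hfactor]
  simpa only [hinverse, ContinuousLinearMap.id_apply, ContinuousLinearMap.comp_apply] using!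
    IsPrimitive.bilin (ContinuousLinearMap.id ℝ (E →L[ℝ] E))
    (hX.isSolution_fderiv_familyFlow v s y).isPrimitive
    (isPrimitive_intervalIntegral (hX.integrable_flowVariationIntegrand v h s s y) s)

open scoped BoundedContinuousFunction

/-- The displacement `φ_{s,t}ᵛ - id`, as an element of the space of bounded continuous fields, in
which the dependence of the flow on `v` is measured. -/
noncomputable def flowDisplacement (hX : IsBoundedC1Family X C) (s t : ℝ) (v : Lp V 2 μI) :
    E →ᵇ E :=
  .ofNormedAddCommGroup (fun y => familyFlow X v s t y - y)
    ((hX.continuous_familyFlow_point v s t).sub continuous_id) (C * ‖v‖)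
    (hX.norm_familyFlow_sub_self_le v s t)

/-- `h ↦ flowVariation X v h s t` as a bounded operator into the bounded continuous fields. -/
noncomputable def flowVariationCLM (hX : IsBoundedC1Family X C) (s t : ℝ) (v : Lp V 2 μI) :
    Lp V 2 μI →L[ℝ] (E →ᵇ E) :=
  LinearMap.mkContinuous
    { toFun h := .ofNormedAddCommGroup (flowVariation X v h s t)
        (hX.continuous_flowVariation v h s t) _ (hX.norm_flowVariation_le v h s t)
      map_add' g h := BoundedContinuousFunction.ext (hX.flowVariation_add v g h s t)
      map_smul' c h := BoundedContinuousFunction.ext (flowVariation_smul X c v h s t) }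
    (Real.exp (C * ‖v‖) * C) fun h =>
      BoundedContinuousFunction.norm_ofNormedAddCommGroup_le _
        (mul_nonneg (mul_nonneg (Real.exp_pos _).le hX.pos.le) (norm_nonneg _))
        (hX.norm_flowVariation_le v h s t)

theorem hasStrictFDerivAt_flowDisplacement (hX : IsBoundedC1Family X C) (s t : ℝ)
    (v : Lp V 2 μI) :
    HasStrictFDerivAt (hX.flowDisplacement s t) (hX.flowVariationCLM s t v) v := by
  refine HasStrictFDerivAt.of_isLittleO (Asymptotics.isLittleO_iff.2 fun ε hε => ?_)
  obtain ⟨r, hr, hlip⟩ := hX.exists_norm_familyFlow_sub_sub_le v hε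
  filter_upwards [Metric.closedBall_mem_nhds (v, v) hr] with p hp
  rw [Metric.mem_closedBall, Prod.dist_eq, max_le_iff, dist_eq_norm, dist_eq_norm] at hp
  refine (BoundedContinuousFunction.norm_le (by positivity)).2 fun y => ?_
  have hsol := hX.isSolution_flowVariation v (p.1 - p.2) s y
  rw [← sub_self y] at hsol
  have hy : ‖y - y‖ ≤ r := by simpa only [sub_self, norm_zero] using hr.le
  have hbound := hlip p.1 p.2 y y y hp.1 hp.2 hy hy s t _ hsol
  rw [sub_self, norm_zero, add_zero] at hbound
  change ‖familyFlow X p.1 s t y - y - (familyFlow X p.2 s t y - y)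
    - flowVariation X v (p.1 - p.2) s t y‖ ≤ _
  rwa [sub_sub_sub_cancel_right]

lemma continuous_flowVariationCLM (hX : IsBoundedC1Family X C) (s t : ℝ) :
    Continuous (hX.flowVariationCLM s t) :=
  continuous_of_forall_hasStrictFDerivAt (hX.hasStrictFDerivAt_flowDisplacement s t)

lemma continuous_uncurry_flowVariation (hX : IsBoundedC1Family X C) (h : Lp V 2 μI) (s t : ℝ) :
    Continuous fun p : Lp V 2 μI × E => flowVariation X p.1 h s t p.2 :=
  (((hX.continuous_flowVariationCLM s t).clm_apply (continuous_const (y := h))).comp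
    continuous_fst).eval continuous_snd

lemma hasFDerivAt_familyFlow_velocity (hX : IsBoundedC1Family X C) (s t : ℝ) (v : Lp V 2 μI)
    (y : E) : HasFDerivAt (fun w => familyFlow X w s t y)
      ((BoundedContinuousFunction.evalCLM ℝ y).comp (hX.flowVariationCLM s t v)) v := by
  have hdisp := (BoundedContinuousFunction.evalCLM ℝ y).hasFDerivAt.comp v
    (hX.hasStrictFDerivAt_flowDisplacement s t v).hasFDerivAt
  simpa [Function.comp_def, flowDisplacement] using hdisp.add_const y

end IsBoundedC1Family

end FlowVariation

section FlowOnDomain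

variable {V E : Type*} [NormedAddCommGroup V] [NormedSpace ℝ V]
  [NormedAddCommGroup E] [NormedSpace ℝ E] [CompleteSpace E]
  {X : V →ₗ[ℝ] (E → E)} {C : ℝ} {Ω : Set E}

namespace IsBoundedC1Family

-- A trajectory that leaves `Ω` rests where it does so, hence has always been there.
lemma familyFlow_mem (hX : IsBoundedC1Family X C) (h0 : ∀ u, ∀ x ∉ Ω, X u x = 0)
    (v : Lp V 2 μI) (s t : ℝ) {y : E} (hy : y ∈ Ω) : familyFlow X v s t y ∈ Ω := by
  by_contra hexit
  have hrest : IsSolution (fun τ => X (v τ)) t (familyFlow X v s t y)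
      (fun _ => familyFlow X v s t y) := by
    refine ⟨rfl, ?_, fun r r' => ?_⟩ <;> simp [h0 _ _ hexit]
  have hback := hX.familyFlow_eq hrest s
  rw [hX.familyFlow_familyFlow, hX.familyFlow_self] at hback
  exact hexit (hback ▸ hy)

lemma leftInverse_familyFlow (hX : IsBoundedC1Family X C) (v : Lp V 2 μI) (s t : ℝ) :
    Function.LeftInverse (familyFlow X v t s) (familyFlow X v s t) := fun y => by
  rw [hX.familyFlow_familyFlow, hX.familyFlow_self]

lemma preimage_familyFlow (hX : IsBoundedC1Family X C) (h0 : ∀ u, ∀ x ∉ Ω, X u x = 0)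
    (v : Lp V 2 μI) (s t : ℝ) : familyFlow X v s t ⁻¹' Ω = Ω :=
  Subset.antisymm
    (fun y hy => hX.leftInverse_familyFlow v s t y ▸ hX.familyFlow_mem h0 v t s hy)
    fun _ hy => hX.familyFlow_mem h0 v s t hy

lemma bijOn_familyFlow (hX : IsBoundedC1Family X C) (h0 : ∀ u, ∀ x ∉ Ω, X u x = 0)
    (v : Lp V 2 μI) (s t : ℝ) : BijOn (familyFlow X v s t) Ω Ω :=
  ⟨fun _ hy => hX.familyFlow_mem h0 v s t hy, (hX.leftInverse_familyFlow v s t).injective.injOn,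
    fun y hy => ⟨familyFlow X v t s y, hX.familyFlow_mem h0 v t s hy,
      hX.leftInverse_familyFlow v t s y⟩⟩

lemma exists_abs_det_fderiv_familyFlow_le [FiniteDimensional ℝ E] (hX : IsBoundedC1Family X C)
    (R : ℝ) : ∃ c : ℝ, ∀ v : Lp V 2 μI, ‖v‖ ≤ R → ∀ s t z,
      |(fderiv ℝ (familyFlow X v s t) z).det| ≤ c := by
  obtain ⟨c, hc⟩ := (isCompact_closedBall (0 : E →L[ℝ] E)
    (Real.exp (C * R))).exists_bound_of_continuousOn
    (f := fun A : E →L[ℝ] E => A.det) ContinuousLinearMap.continuous_det.continuousOn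
  refine ⟨c, fun v hv s t z => ?_⟩
  refine hc _ (mem_closedBall_zero_iff.2 ((hX.norm_fderiv_familyFlow_le v s t z).trans ?_))
  exact Real.exp_le_exp.2 (mul_le_mul_of_nonneg_left hv hX.pos.le)

variable [FiniteDimensional ℝ E] [MeasurableSpace E] [BorelSpace E] {m : Measure E}
  [m.IsAddHaarMeasure]

lemma setIntegral_eq_setIntegral_familyFlow (hX : IsBoundedC1Family X C)
    (h0 : ∀ u, ∀ x ∉ Ω, X u x = 0) (hΩ : MeasurableSet Ω) (v : Lp V 2 μI) (s t : ℝ) {F : Type*}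
    [NormedAddCommGroup F] [NormedSpace ℝ F] (g : E → F) :
    ∫ y in Ω, g y ∂m =
      ∫ z in Ω, (fderiv ℝ (familyFlow X v s t) z).det • g (familyFlow X v s t z) ∂m := by
  have hbij := hX.bijOn_familyFlow h0 v s t
  have hcov := integral_image_eq_integral_abs_det_fderiv_smul m hΩ
    (fun x _ => (hX.hasFDerivAt_familyFlow v s t x).hasFDerivWithinAt) hbij.injOn g
  simpa only [hbij.image_eq, abs_of_pos (hX.det_fderiv_familyFlow_pos v s t _)] using hcov

lemma exists_map_familyFlow_le (hX : IsBoundedC1Family X C) (h0 : ∀ u, ∀ x ∉ Ω, X u x = 0)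
    (hΩ : MeasurableSet Ω) (R : ℝ) :
    ∃ c : ENNReal, c ≠ ⊤ ∧ ∀ v : Lp V 2 μI, ‖v‖ ≤ R → ∀ s t,
      (m.restrict Ω).map (familyFlow X v s t) ≤ c • m.restrict Ω := by
  obtain ⟨c, hc⟩ := hX.exists_abs_det_fderiv_familyFlow_le R
  refine ⟨ENNReal.ofReal c, ENNReal.ofReal_ne_top, fun v hv s t => ?_⟩
  refine Measure.le_iff.2 fun A hA => ?_
  have hpreimage : familyFlow X v s t ⁻¹' A ∩ Ω = familyFlow X v t s '' (A ∩ Ω) := by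
    rw [image_eq_preimage_of_inverse (hX.leftInverse_familyFlow v t s)
      (hX.leftInverse_familyFlow v s t), preimage_inter, hX.preimage_familyFlow h0]
  have hflow := (hX.continuous_familyFlow_point v s t).measurable
  calc (m.restrict Ω).map (familyFlow X v s t) A
    _ = m (familyFlow X v t s '' (A ∩ Ω)) := by
        rw [Measure.map_apply hflow hA, Measure.restrict_apply (hflow hA), hpreimage]
    _ = ∫⁻ z in A ∩ Ω, ENNReal.ofReal |(fderiv ℝ (familyFlow X v t s) z).det| ∂m :=
        (lintegral_abs_det_fderiv_eq_addHaar_image m (hA.inter hΩ)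
          (fun x _ => (hX.hasFDerivAt_familyFlow v t s x).hasFDerivWithinAt)
          (hX.leftInverse_familyFlow v t s).injective.injOn).symm
    _ ≤ ∫⁻ _ in A ∩ Ω, ENNReal.ofReal c ∂m :=
        lintegral_mono fun z => ENNReal.ofReal_le_ofReal (hc v hv t s z)
    _ = (ENNReal.ofReal c • m.restrict Ω) A := by
        rw [setLIntegral_const, Measure.smul_apply, Measure.restrict_apply hA, smul_eq_mul]

end IsBoundedC1Family

end FlowOnDomain

section LpComposition

variable {α β F : Type*} [MeasurableSpace α] [MeasurableSpace β] [NormedAddCommGroup F]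
  {μ : Measure α} {ν : Measure β} {c p : ENNReal}

lemma eLpNorm_comp_le_of_map_le {ψ : α → β} (hψ : Measurable ψ)
    (hmap : μ.map ψ ≤ c • ν) {g : β → F} (hg : AEStronglyMeasurable g ν) :
    eLpNorm (g ∘ ψ) p μ ≤ c ^ (1 / p).toReal * eLpNorm g p ν := by
  rw [← eLpNorm_map_measure (hg.mono_ac (Measure.absolutelyContinuous_of_le_smul hmap))
    hψ.aemeasurable]
  exact eLpNorm_le_of_measure_le_smul hmap

lemma memLp_comp_of_map_le {ψ : α → β} (hψ : Measurable ψ) (hc : c ≠ ⊤)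
    (hmap : μ.map ψ ≤ c • ν) {g : β → F} (hg : MemLp g p ν) : MemLp (g ∘ ψ) p μ :=
  (hg.of_measure_le_smul hc hmap).comp_of_map hψ.aemeasurable

end LpComposition

section LpCompositionContinuity

variable {α X F ι : Type*} [MeasurableSpace α] [MetricSpace X] [ProperSpace X]
  [MeasurableSpace X] [BorelSpace X] [NormedAddCommGroup F]
  {μ : Measure α} {ν : Measure X} [IsLocallyFiniteMeasure ν] {c p : ENNReal}
  {l : Filter ι} {ψ : ι → α → X} {ψ₀ : α → X}

lemma tendsto_eLpNorm_comp_sub_of_hasCompactSupport (hp : p ≠ ⊤) (hψ₀ : Measurable ψ₀)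
    (hc : c ≠ ⊤) (hmap₀ : μ.map ψ₀ ≤ c • ν) (hlim : TendstoUniformly ψ ψ₀ l) {g : X → F}
    (hg : Continuous g) (hsupp : HasCompactSupport g) :
    Tendsto (fun i => eLpNorm (g ∘ ψ i - g ∘ ψ₀) p μ) l (𝓝 0) := by
  set K := Metric.cthickening 1 (tsupport g)
  have hK : IsCompact K := hsupp.cthickening
  have hfinite : μ (ψ₀ ⁻¹' K) ^ (1 / p.toReal) ≠ ⊤ := by
    refine ENNReal.rpow_ne_top_of_nonneg (by positivity) ?_
    rw [← Measure.map_apply hψ₀ hK.measurableSet]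
    exact ((hmap₀ K).trans_lt (ENNReal.mul_lt_top hc.lt_top hK.measure_lt_top)).ne
  have hsubset {z : X} (hz : z ∈ Function.support g) {z' : X} (hzz' : dist z' z ≤ 1) : z' ∈ K :=
    Metric.mem_cthickening_of_dist_le z' z 1 _ (subset_tsupport g hz) hzz'
  rw [ENNReal.tendsto_nhds_zero]
  intro ε hε
  obtain ⟨δ, hδ, hδε⟩ := ENNReal.exists_nnreal_pos_mul_lt hfinite hε.ne'
  rw [← ENNReal.ofReal_coe_nnreal] at hδε
  obtain ⟨η, hη, hgη⟩ := Metric.uniformContinuous_iff.1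
    (hsupp.uniformContinuous_of_continuous hg) δ hδ
  filter_upwards [Metric.tendstoUniformly_iff.1 hlim (min η 1) (lt_min hη one_pos)] with i hi
  refine (eLpNorm_sub_le_of_dist_bdd μ hp (hψ₀ hK.measurableSet) δ.coe_nonneg (fun a => ?_)
    (fun a ha => ?_) (fun a ha => ?_)).trans hδε.le
  · exact (hgη ((dist_comm _ _).trans_lt ((hi a).trans_le (min_le_left _ _)))).le
  · exact hsubset ha ((hi a).le.trans (min_le_right _ _))
  · exact hsubset ha (by simp)

theorem tendsto_eLpNorm_comp_sub [NormedSpace ℝ F] (hp1 : 1 ≤ p) (hp : p ≠ ⊤)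
    (hψ : ∀ i, Measurable (ψ i)) (hψ₀ : Measurable ψ₀) (hc : c ≠ ⊤)
    (hmap : ∀ᶠ i in l, μ.map (ψ i) ≤ c • ν) (hmap₀ : μ.map ψ₀ ≤ c • ν)
    (hlim : TendstoUniformly ψ ψ₀ l) {f : X → F} (hf : MemLp f p ν) :
    Tendsto (fun i => eLpNorm (f ∘ ψ i - f ∘ ψ₀) p μ) l (𝓝 0) := by
  rw [ENNReal.tendsto_nhds_zero]
  intro ε hε
  have hε3 : ε / 3 ≠ 0 := (ENNReal.div_pos hε.ne' (by simp)).ne'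
  obtain ⟨δ, hδ, hδε⟩ := ENNReal.exists_pos_mul_lt
    (ENNReal.rpow_ne_top_of_nonneg ENNReal.toReal_nonneg hc (y := (1 / p).toReal)) hε3
  obtain ⟨g, hsupp, hfg, hg, hgp⟩ := hf.exists_hasCompactSupport_eLpNorm_sub_le hp hδ.ne'
  have happrox {ψ : α → X} (hψ : Measurable ψ) (hmap : μ.map ψ ≤ c • ν) :
      eLpNorm ((f - g) ∘ ψ) p μ ≤ ε / 3 :=
    (eLpNorm_comp_le_of_map_le hψ hmap (hf.sub hgp).1).trans
      ((mul_le_mul_right hfg _).trans (mul_comm δ _ ▸ hδε.le))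
  filter_upwards [hmap, ENNReal.tendsto_nhds_zero.1 (tendsto_eLpNorm_comp_sub_of_hasCompactSupport
    hp hψ₀ hc hmap₀ hlim hg hsupp) (ε / 3) (pos_iff_ne_zero.2 hε3)] with i hi hgi
  have hmeas {ψ : α → X} (hψ : Measurable ψ) (hmap : μ.map ψ ≤ c • ν) {u : X → F}
      (hu : MemLp u p ν) : AEStronglyMeasurable (u ∘ ψ) μ := (memLp_comp_of_map_le hψ hc hmap hu).1
  have hsplit : f ∘ ψ i - f ∘ ψ₀ =
      (f - g) ∘ ψ i + (g ∘ ψ i - g ∘ ψ₀) - (f - g) ∘ ψ₀ := by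
    funext a
    simp only [Function.comp_apply, Pi.sub_apply, Pi.add_apply]
    abel
  rw [hsplit]
  calc eLpNorm ((f - g) ∘ ψ i + (g ∘ ψ i - g ∘ ψ₀) - (f - g) ∘ ψ₀) p μ
    _ ≤ eLpNorm ((f - g) ∘ ψ i) p μ + eLpNorm (g ∘ ψ i - g ∘ ψ₀) p μ
        + eLpNorm ((f - g) ∘ ψ₀) p μ := by
      have hfst := hmeas (hψ i) hi (hf.sub hgp)
      have hsnd := (hmeas (hψ i) hi hgp).sub (hmeas hψ₀ hmap₀ hgp)
      exact (eLpNorm_sub_le (hfst.add hsnd) (hmeas hψ₀ hmap₀ (hf.sub hgp)) hp1).trans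
        (add_le_add_left (eLpNorm_add_le hfst hsnd hp1) _)
    _ ≤ ε / 3 + ε / 3 + ε / 3 :=
      add_le_add (add_le_add (happrox (hψ i) hi) hgi) (happrox hψ₀ hmap₀)
    _ = ε := ENNReal.add_thirds ε

end LpCompositionContinuity

section LpDerivative

variable {α F : Type*} [MeasurableSpace α] [NormedAddCommGroup F] [NormedSpace ℝ F]
  [CompleteSpace F] {ν : Measure α}

lemma enorm_sub_le_lintegral_enorm_of_hasDerivAt {u a : ℝ → F}
    (hu : ∀ θ ∈ Icc (0 : ℝ) 1, HasDerivAt u (a θ) θ) (ha : AEStronglyMeasurable a μI) :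
    ‖u 1 - u 0‖ₑ ≤ ∫⁻ θ, ‖a θ‖ₑ ∂μI := by
  by_cases hint : Integrable a μI
  · have hinterval : IntervalIntegrable a volume 0 1 :=
      (intervalIntegrable_iff_integrableOn_Icc_of_le zero_le_one).2 hint
    rw [← intervalIntegral.integral_eq_sub_of_hasDerivAt (by simpa using hu) hinterval,
      intervalIntegral.integral_of_le zero_le_one, ← integral_Icc_eq_integral_Ioc]
    exact enorm_integral_le_lintegral_enorm a
  · have hinfinite : ∫⁻ θ, ‖a θ‖ₑ ∂μI = ⊤ := by
      by_contra hne
      exact hint ⟨ha, Ne.lt_top hne⟩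
    exact hinfinite ▸ le_top

theorem eLpNorm_sub_le_of_hasDerivAt [SFinite ν] {p c : ENNReal} (hp1 : 1 ≤ p) (hp : p ≠ ⊤)
    {u a : ℝ → α → F} (ha : AEStronglyMeasurable (Function.uncurry a) (Measure.prod μI ν))
    (hu : ∀ᵐ y ∂ν, ∀ θ ∈ Icc (0 : ℝ) 1, HasDerivAt (fun θ => u θ y) (a θ y) θ)
    (hac : ∀ θ ∈ Icc (0 : ℝ) 1, eLpNorm (a θ) p ν ≤ c) : eLpNorm (u 1 - u 0) p ν ≤ c := by
  lift p to NNReal using hp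
  have hp0 : p ≠ 0 := (one_pos.trans_le (ENNReal.one_le_coe_iff.1 hp1)).ne'
  have hjensen : ∀ᵐ y ∂ν, ‖u 1 y - u 0 y‖ₑ ^ (p : ℝ) ≤ ∫⁻ θ, ‖a θ y‖ₑ ^ (p : ℝ) ∂μI := by
    filter_upwards [hu, ha.prod_swap.prodMk_left] with y hy hay
    rw [← eLpNorm_nnreal_pow_eq_lintegral hp0]
    refine ENNReal.rpow_le_rpow ?_ p.coe_nonneg
    refine (enorm_sub_le_lintegral_enorm_of_hasDerivAt hy hay).trans ?_
    rw [← eLpNorm_one_eq_lintegral_enorm]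
    exact eLpNorm_le_eLpNorm_of_exponent_le hp1 hay
  rw [← ENNReal.rpow_le_rpow_iff (NNReal.coe_pos.2 (pos_iff_ne_zero.2 hp0)),
    eLpNorm_nnreal_pow_eq_lintegral hp0]
  calc ∫⁻ y, ‖(u 1 - u 0) y‖ₑ ^ (p : ℝ) ∂ν
    _ ≤ ∫⁻ y, ∫⁻ θ, ‖a θ y‖ₑ ^ (p : ℝ) ∂μI ∂ν := lintegral_mono_ae hjensen
    _ = ∫⁻ θ, ∫⁻ y, ‖a θ y‖ₑ ^ (p : ℝ) ∂ν ∂μI :=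
      lintegral_lintegral_swap (ha.prod_swap.enorm.pow_const _)
    _ ≤ ∫⁻ _, c ^ (p : ℝ) ∂μI := by
      refine setLIntegral_mono' measurableSet_Icc fun θ hθ => ?_
      rw [← eLpNorm_nnreal_pow_eq_lintegral hp0]
      exact ENNReal.rpow_le_rpow (hac θ hθ) p.coe_nonneg
    _ = c ^ (p : ℝ) := by rw [lintegral_const, measure_univ, mul_one]

/-- By the mean value inequality on segments, continuity of `D` makes up for the lack of uniformity
in the pointwise derivatives. -/
theorem hasFDerivAt_toLp_of_hasDerivAt {W : Type*} [NormedAddCommGroup W] [NormedSpace ℝ W]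
    [SFinite ν] {p : ENNReal} [hp1 : Fact (1 ≤ p)] (hp : p ≠ ⊤) {u : W → α → F}
    (hu : ∀ w, MemLp (u w) p ν) {a : W → W → α → F}
    (hua : ∀ᵐ y ∂ν, ∀ w h, HasDerivAt (fun θ : ℝ => u (w + θ • h) y) (a w h y) 0)
    (ha : ∀ w h, AEStronglyMeasurable (fun q : ℝ × α => a (w + q.1 • h) h q.2) (Measure.prod μI ν))
    {D : W → W →L[ℝ] Lp F p ν} (hD : ∀ w h, D w h =ᵐ[ν] a w h) {v : W} (hcont : ContinuousAt D v) :
    HasFDerivAt (fun w => (hu w).toLp) (D v) v := by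
  rw [hasFDerivAt_iff_isLittleO, Asymptotics.isLittleO_iff]
  intro ε hε
  obtain ⟨δ, hδ, hDδ⟩ := Metric.continuousAt_iff.1 hcont ε hε
  filter_upwards [Metric.ball_mem_nhds v hδ] with w hw
  set h := w - v with hh
  have hsegment (θ : ℝ) (hθ : θ ∈ Icc (0 : ℝ) 1) :
      eLpNorm (a (v + θ • h) h - ⇑(D v h)) p ν ≤ ‖ε * ‖h‖‖ₑ := by
    have hdist : dist (v + θ • h) v < δ := by
      rw [dist_self_add_left, norm_smul, Real.norm_of_nonneg hθ.1]
      exact (mul_le_of_le_one_left (norm_nonneg h) hθ.2).trans_lt (dist_eq_norm w v ▸ hw)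
    have hae : a (v + θ • h) h - ⇑(D v h) =ᵐ[ν] (D (v + θ • h) - D v) h :=
      ((hD _ h).symm.sub EventuallyEq.rfl).trans (Lp.coeFn_sub _ _).symm
    rw [eLpNorm_congr_ae hae, ← Lp.enorm_def, enorm_le_iff_norm_le, norm_mul, norm_norm]
    refine (ContinuousLinearMap.le_of_opNorm_le _ ?_ h)
    exact dist_eq_norm (D _) _ ▸ (hDδ hdist).le.trans (le_abs_self ε)
  have hderiv : ∀ᵐ y ∂ν, ∀ θ ∈ Icc (0 : ℝ) 1, HasDerivAt
      (fun θ : ℝ => (u (v + θ • h) - θ • ⇑(D v h)) y) ((a (v + θ • h) h - ⇑(D v h)) y) θ := by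
    filter_upwards [hua] with y hy θ _
    have hshift := (hy (v + θ • h) h).scomp_of_eq θ ((hasDerivAt_id θ).sub_const θ)
      (sub_self θ).symm
    simp only [Function.comp_def, id_eq, one_smul, add_assoc, ← add_smul,
      add_sub_cancel] at hshift
    simpa using! hshift.sub ((hasDerivAt_id θ).smul_const (D v h y))
  have hremainder := eLpNorm_sub_le_of_hasDerivAt hp1.out hp
    ((ha v h).sub (Lp.aestronglyMeasurable (D v h)).comp_snd) hderiv hsegment
  simp only [one_smul, zero_smul, add_zero, sub_zero, hh, add_sub_cancel] at hremainder
  rw [← Real.norm_of_nonneg (mul_nonneg hε.le (norm_nonneg h)), ← enorm_le_iff_norm_le]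
  rwa [← Lp.toLp_coeFn (D v h) (Lp.memLp _), ← MemLp.toLp_sub, ← MemLp.toLp_sub, Lp.enorm_toLp,
    sub_right_comm]

end LpDerivative

section BoundedContinuousPairing

open scoped BoundedContinuousFunction ENNReal

variable {α F : Type*} [MeasurableSpace α] [TopologicalSpace α] [OpensMeasurableSpace α]
  [NormedAddCommGroup F] [SecondCountableTopologyEither α F]

lemma memLp_top_boundedContinuousFunction (ν : Measure α) (g : α →ᵇ F) : MemLp g ∞ ν :=
  memLp_top_of_bound g.continuous.aestronglyMeasurable ‖g‖ (ae_of_all _ g.norm_coe_le_norm)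

/-- The inclusion of the bounded continuous functions into `L^∞`. -/
noncomputable def boundedContinuousToLpTop [NormedSpace ℝ F] (ν : Measure α) :
    (α →ᵇ F) →L[ℝ] Lp F ∞ ν :=
  LinearMap.mkContinuous
    { toFun g := (memLp_top_boundedContinuousFunction ν g).toLp g
      map_add' _ _ := rfl
      map_smul' _ _ := rfl }
    1 fun g => by
      refine (Lp.norm_toLp g (memLp_top_boundedContinuousFunction ν g)).trans_le ?_
      rw [one_mul, eLpNorm_exponent_top]
      exact ENNReal.toReal_le_of_le_ofReal (norm_nonneg g)
        (eLpNormEssSup_le_of_ae_bound (ae_of_all _ g.norm_coe_le_norm))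

lemma coeFn_boundedContinuousToLpTop [NormedSpace ℝ F] (ν : Measure α) (g : α →ᵇ F) :
    boundedContinuousToLpTop ν g =ᵐ[ν] g :=
  (memLp_top_boundedContinuousFunction ν g).coeFn_toLp

end BoundedContinuousPairing

section CompositionWithFlow

open scoped BoundedContinuousFunction ENNReal

variable {V E F : Type*} [NormedAddCommGroup V] [NormedSpace ℝ V]
  [NormedAddCommGroup E] [NormedSpace ℝ E] [NormedAddCommGroup F]
  {X : V →ₗ[ℝ] (E → E)} {C : ℝ}

/-- The derivative of `v ↦ f ∘ φ_{s,t}ᵛ` in the direction `h`, at the point `y`. -/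
noncomputable def compVariation [NormedSpace ℝ F] (X : V →ₗ[ℝ] (E → E)) (f : E → F) (s t : ℝ)
    (v h : Lp V 2 μI) (y : E) : F :=
  fderiv ℝ f (familyFlow X v s t y) (flowVariation X v h s t y)

variable [CompleteSpace E]

namespace IsBoundedC1Family

lemma hasDerivAt_comp_familyFlow [NormedSpace ℝ F] (hX : IsBoundedC1Family X C) {f : E → F}
    {s t : ℝ} {v : Lp V 2 μI} {y : E} (hf : DifferentiableAt ℝ f (familyFlow X v s t y))
    (h : Lp V 2 μI) :
    HasDerivAt (fun θ : ℝ => f (familyFlow X (v + θ • h) s t y)) (compVariation X f s t v h y)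
      0 := by
  have hline : HasDerivAt (fun θ : ℝ => v + θ • h) h 0 := by
    simpa using! ((hasDerivAt_id (0 : ℝ)).smul_const h).const_add v
  have hflow := (hX.hasFDerivAt_familyFlow_velocity s t v y).comp_hasDerivAt_of_eq 0 hline (by simp)
  exact hf.hasFDerivAt.comp_hasDerivAt_of_eq 0 hflow (by simp)

lemma tendstoUniformly_familyFlow (hX : IsBoundedC1Family X C) (s t : ℝ) (v : Lp V 2 μI) :
    TendstoUniformly (fun w => familyFlow X w s t) (familyFlow X v s t) (𝓝 v) := by
  have hbound : Tendsto (fun w => Real.exp (C * ‖v‖) * (C * ‖w - v‖)) (𝓝 v) (𝓝 0) := by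
    have hcont : Continuous fun w : Lp V 2 μI => Real.exp (C * ‖v‖) * (C * ‖w - v‖) := by fun_prop
    simpa using hcont.tendsto v
  refine Metric.tendstoUniformly_iff.2 fun ε hε => ?_
  filter_upwards [hbound.eventually_lt_const hε] with w hw y
  rw [dist_comm, dist_eq_norm]
  exact (hX.norm_familyFlow_sub_le w v s t y y).trans_lt (by simpa using hw)

variable [FiniteDimensional ℝ E] [MeasurableSpace E] [BorelSpace E] {Ω : Set E} {m : Measure E}
  [m.IsAddHaarMeasure] {p : ℝ≥0∞}

lemma memLp_comp_familyFlow (hX : IsBoundedC1Family X C) (h0 : ∀ u, ∀ x ∉ Ω, X u x = 0)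
    (hΩ : MeasurableSet Ω) {g : E → F} (hg : MemLp g p (m.restrict Ω))
    (s t : ℝ) (v : Lp V 2 μI) : MemLp (g ∘ familyFlow X v s t) p (m.restrict Ω) := by
  obtain ⟨c, hc, hmap⟩ := hX.exists_map_familyFlow_le (m := m) h0 hΩ ‖v‖
  exact memLp_comp_of_map_le (hX.continuous_familyFlow_point v s t).measurable hc
    (hmap v le_rfl s t) hg

variable [NormedSpace ℝ F]

lemma continuous_toLp_comp_familyFlow [Fact (1 ≤ p)] (hX : IsBoundedC1Family X C)
    (h0 : ∀ u, ∀ x ∉ Ω, X u x = 0) (hΩ : MeasurableSet Ω) (hp : p ≠ ∞) {g : E → F}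
    (hg : MemLp g p (m.restrict Ω)) (s t : ℝ) :
    Continuous fun v => (hX.memLp_comp_familyFlow h0 hΩ hg s t v).toLp := by
  refine continuous_iff_continuousAt.2 fun v => (Lp.tendsto_Lp_iff_tendsto_eLpNorm'' _ _ _ _).2 ?_
  obtain ⟨c, hc, hmap⟩ := hX.exists_map_familyFlow_le (m := m) h0 hΩ (‖v‖ + 1)
  refine tendsto_eLpNorm_comp_sub Fact.out hp
    (fun w => (hX.continuous_familyFlow_point w s t).measurable)
    (hX.continuous_familyFlow_point v s t).measurable hc ?_
    (hmap v (le_add_of_nonneg_right zero_le_one) s t) (hX.tendstoUniformly_familyFlow s t v) hg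
  filter_upwards [continuous_norm.tendsto v (Iic_mem_nhds (lt_add_one ‖v‖))] with w hw
  exact hmap w hw s t

/-- `compVariation` as a bounded operator into `L^p`: the product of `Df ∘ φ_{s,t}ᵛ ∈ L^p` with the
bounded field `flowVariation`. -/
noncomputable def compVariationCLM [Fact (1 ≤ p)] (hX : IsBoundedC1Family X C)
    (h0 : ∀ u, ∀ x ∉ Ω, X u x = 0) (hΩ : MeasurableSet Ω) {f : E → F}
    (hf' : MemLp (fderiv ℝ f) p (m.restrict Ω)) (s t : ℝ) (v : Lp V 2 μI) :
    Lp V 2 μI →L[ℝ] Lp F p (m.restrict Ω) :=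
  ((ContinuousLinearMap.id ℝ (E →L[ℝ] F)).holderL (m.restrict Ω) p ∞ p
    (hX.memLp_comp_familyFlow h0 hΩ hf' s t v).toLp).comp
      ((boundedContinuousToLpTop (m.restrict Ω)).comp (hX.flowVariationCLM s t v))

lemma continuous_compVariationCLM [Fact (1 ≤ p)] (hX : IsBoundedC1Family X C)
    (h0 : ∀ u, ∀ x ∉ Ω, X u x = 0) (hΩ : MeasurableSet Ω) (hp : p ≠ ∞) {f : E → F}
    (hf' : MemLp (fderiv ℝ f) p (m.restrict Ω)) (s t : ℝ) :
    Continuous (hX.compVariationCLM h0 hΩ hf' s t) :=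
  ((ContinuousLinearMap.continuous _).comp
    (hX.continuous_toLp_comp_familyFlow h0 hΩ hp hf' s t)).clm_comp
      (continuous_const.clm_comp (hX.continuous_flowVariationCLM s t))

lemma coeFn_compVariationCLM [Fact (1 ≤ p)] (hX : IsBoundedC1Family X C)
    (h0 : ∀ u, ∀ x ∉ Ω, X u x = 0) (hΩ : MeasurableSet Ω) {f : E → F}
    (hf' : MemLp (fderiv ℝ f) p (m.restrict Ω)) (s t : ℝ) (v h : Lp V 2 μI) :
    hX.compVariationCLM h0 hΩ hf' s t v h =ᵐ[m.restrict Ω] compVariation X f s t v h := by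
  filter_upwards [(ContinuousLinearMap.id ℝ (E →L[ℝ] F)).coeFn_holder (r := p)
      (hX.memLp_comp_familyFlow h0 hΩ hf' s t v).toLp
      (boundedContinuousToLpTop (m.restrict Ω) (hX.flowVariationCLM s t v h)),
    (hX.memLp_comp_familyFlow h0 hΩ hf' s t v).coeFn_toLp,
    coeFn_boundedContinuousToLpTop (m.restrict Ω) (hX.flowVariationCLM s t v h)]
    with y hy hderiv hfield
  rw [hderiv, hfield] at hy
  exact hy

lemma stronglyMeasurable_compVariation_line [CompleteSpace F] [SecondCountableTopology F]
    (hX : IsBoundedC1Family X C) (f : E → F) (s t : ℝ) (v h : Lp V 2 μI) :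
    StronglyMeasurable fun q : ℝ × E => compVariation X f s t (v + q.1 • h) h q.2 := by
  have hderiv : StronglyMeasurable fun q : ℝ × E =>
      fderiv ℝ f (familyFlow X (v + q.1 • h) s t q.2) :=
    (measurable_fderiv ℝ f).stronglyMeasurable.comp_measurable
      (hX.continuous_familyFlow.comp (g := fun p : Lp V 2 μI × ℝ × ℝ × E => _)
        (by fun_prop : Continuous fun q : ℝ × E => (v + q.1 • h, s, t, q.2))).measurable
  have hfield : StronglyMeasurable fun q : ℝ × E => flowVariation X (v + q.1 • h) h s t q.2 :=
    ((hX.continuous_uncurry_flowVariation h s t).comp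
      (by fun_prop : Continuous fun q : ℝ × E => (v + q.1 • h, q.2))).stronglyMeasurable
  exact isBoundedBilinearMap_apply.continuous.comp_stronglyMeasurable (hderiv.prodMk hfield)

theorem hasFDerivAt_toLp_comp_familyFlow [CompleteSpace F] [SecondCountableTopology F]
    [Fact (1 ≤ p)] (hX : IsBoundedC1Family X C) (h0 : ∀ u, ∀ x ∉ Ω, X u x = 0) (hΩ : IsOpen Ω)
    (hp : p ≠ ∞) {f : E → F} (hf : DifferentiableOn ℝ f Ω) (hfp : MemLp f p (m.restrict Ω))
    (hf' : MemLp (fderiv ℝ f) p (m.restrict Ω)) (s t : ℝ) (v : Lp V 2 μI) :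
    HasFDerivAt (fun w => (hX.memLp_comp_familyFlow h0 hΩ.measurableSet hfp s t w).toLp)
      (hX.compVariationCLM h0 hΩ.measurableSet hf' s t v) v := by
  refine hasFDerivAt_toLp_of_hasDerivAt hp _ ?_ (fun w h => ?_)
    (hX.coeFn_compVariationCLM h0 hΩ.measurableSet hf' s t)
    (hX.continuous_compVariationCLM h0 hΩ.measurableSet hp hf' s t).continuousAt
  · filter_upwards [ae_restrict_mem hΩ.measurableSet] with y hy w h
    exact hX.hasDerivAt_comp_familyFlow
      (hf.differentiableAt (hΩ.mem_nhds (hX.familyFlow_mem h0 w s t hy))) h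
  · exact (hX.stronglyMeasurable_compVariation_line f s t w h).aestronglyMeasurable

end IsBoundedC1Family

end CompositionWithFlow

section Duality

open scoped ENNReal

variable {V E F : Type*} [NormedAddCommGroup V] [NormedSpace ℝ V]
  [NormedAddCommGroup E] [NormedSpace ℝ E] [CompleteSpace E]
  [NormedAddCommGroup F] [NormedSpace ℝ F]
  {X : V →ₗ[ℝ] (E → E)} {C : ℝ} {Ω : Set E}

namespace IsBoundedC1Family

lemma fderiv_comp_familyFlow (hX : IsBoundedC1Family X C) {f : E → F} {v : Lp V 2 μI} {s t : ℝ}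
    {z : E} (hf : DifferentiableAt ℝ f (familyFlow X v s t z)) :
    fderiv ℝ (f ∘ familyFlow X v s t) z =
      (fderiv ℝ f (familyFlow X v s t z)).comp (fderiv ℝ (familyFlow X v s t) z) :=
  fderiv_comp z hf (hX.hasFDerivAt_familyFlow v s t z).differentiableAt

variable [MeasurableSpace E] [BorelSpace E]

lemma measurable_flowVariationIntegrand [FiniteDimensional ℝ E] (hX : IsBoundedC1Family X C)
    (v h : Lp V 2 μI) (s t : ℝ) :
    Measurable fun q : ℝ × E => flowVariationIntegrand X v h s t q.2 q.1 := by
  have hflow : Continuous fun q : ℝ × E => familyFlow X v s q.1 q.2 :=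
    hX.continuous_familyFlow.comp (g := fun p : Lp V 2 μI × ℝ × ℝ × E => _)
      (by fun_prop : Continuous fun q : ℝ × E => (v, s, q.1, q.2))
  have hderiv : Measurable fun q : ℝ × E =>
      fderiv ℝ (familyFlow X v q.1 t) (familyFlow X v s q.1 q.2) :=
    (measurable_fderiv_with_param ℝ (f := fun τ => familyFlow X v τ t)
      (hX.continuous_familyFlow.comp (g := fun p : Lp V 2 μI × ℝ × ℝ × E => _)
        (by fun_prop : Continuous fun q : ℝ × E => (v, q.1, t, q.2)))).comp
      (measurable_fst.prodMk hflow.measurable)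
  have hfield : StronglyMeasurable fun q : ℝ × E => X (h q.1) (familyFlow X v s q.1 q.2) :=
    hX.continuous_eval.comp_stronglyMeasurable
      (((Lp.stronglyMeasurable h).comp_measurable measurable_fst).prodMk hflow.stronglyMeasurable)
  exact isBoundedBilinearMap_apply.continuous.measurable.comp
    (hderiv.prodMk hfield.measurable)

variable [FiniteDimensional ℝ E] {m : Measure E} [m.IsAddHaarMeasure] {p q : ℝ≥0∞}

lemma memLp_fderiv_comp_familyFlow (hX : IsBoundedC1Family X C) (h0 : ∀ u, ∀ x ∉ Ω, X u x = 0)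
    (hΩ : IsOpen Ω) {f : E → F} (hf : DifferentiableOn ℝ f Ω)
    (hf' : MemLp (fderiv ℝ f) p (m.restrict Ω)) (v : Lp V 2 μI) (s t : ℝ) :
    MemLp (fderiv ℝ (f ∘ familyFlow X v s t)) p (m.restrict Ω) := by
  have hchain : (fun z => (fderiv ℝ f (familyFlow X v s t z)).comp
      (fderiv ℝ (familyFlow X v s t) z)) =ᵐ[m.restrict Ω]
        fderiv ℝ (f ∘ familyFlow X v s t) := by
    filter_upwards [ae_restrict_mem hΩ.measurableSet] with z hz
    exact (hX.fderiv_comp_familyFlow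
      (hf.differentiableAt (hΩ.mem_nhds (hX.familyFlow_mem h0 v s t hz)))).symm
  have hcomp := hX.memLp_comp_familyFlow h0 hΩ.measurableSet hf' s t v
  refine (memLp_congr_ae hchain).1 (hcomp.of_le_mul (c := Real.exp (C * ‖v‖)) ?_
    (ae_of_all _ fun z => ?_))
  · exact (ContinuousLinearMap.compL ℝ E E F).aestronglyMeasurable_comp₂ hcomp.1
      (hX.continuous_fderiv_familyFlow v s t).aestronglyMeasurable
  · rw [mul_comm]
    exact (ContinuousLinearMap.opNorm_comp_le _ _).trans
      (mul_le_mul_of_nonneg_left (hX.norm_fderiv_familyFlow_le v s t z) (norm_nonneg _))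

lemma memLp_det_smul_comp_familyFlow (hX : IsBoundedC1Family X C)
    (h0 : ∀ u, ∀ x ∉ Ω, X u x = 0) (hΩ : MeasurableSet Ω) {G : E → F}
    (hG : MemLp G p (m.restrict Ω)) (v : Lp V 2 μI) (s t : ℝ) :
    MemLp (fun z => (fderiv ℝ (familyFlow X v s t) z).det • G (familyFlow X v s t z)) p
      (m.restrict Ω) := by
  obtain ⟨c, hc⟩ := hX.exists_abs_det_fderiv_familyFlow_le ‖v‖
  have hcomp := hX.memLp_comp_familyFlow h0 hΩ hG s t v
  refine hcomp.of_le_mul (c := c) ((ContinuousLinearMap.continuous_det.comp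
    (hX.continuous_fderiv_familyFlow v s t)).aestronglyMeasurable.smul hcomp.1)
    (ae_of_all _ fun z => ?_)
  rw [norm_smul]
  exact mul_le_mul_of_nonneg_right (hc v le_rfl s t z) (norm_nonneg _)

lemma integrable_mul_fderiv_flowVariationIntegrand [p.HolderTriple q 1]
    (hX : IsBoundedC1Family X C) (h0 : ∀ u, ∀ x ∉ Ω, X u x = 0) (hΩ : MeasurableSet Ω)
    {f G : E → ℝ} (hf' : MemLp (fderiv ℝ f) q (m.restrict Ω)) (hG : MemLp G p (m.restrict Ω))
    (v h : Lp V 2 μI) (s t : ℝ) :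
    Integrable (Function.uncurry fun τ y => G y * fderiv ℝ f (familyFlow X v s t y)
      (flowVariationIntegrand X v h s t y τ)) (Measure.prod μI (m.restrict Ω)) := by
  have hspace : Integrable (fun y => ‖G y‖ * ‖fderiv ℝ f (familyFlow X v s t y)‖)
      (m.restrict Ω) :=
    memLp_one_iff_integrable.1 ((hX.memLp_comp_familyFlow h0 hΩ hf' s t v).norm.mul hG.norm)
  have htime : Integrable (fun τ => Real.exp (C * ‖v‖) * C * ‖h τ‖) μI :=
    (integrable_velocity h).norm.const_mul _
  refine (htime.mul_prod hspace).mono' (hG.1.comp_snd.mul ?_) (ae_of_all _ fun z => ?_)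
  · exact (isBoundedBilinearMap_apply.continuous.measurable.comp
      (((measurable_fderiv ℝ f).comp ((hX.continuous_familyFlow_point v s t).measurable.comp
        measurable_snd)).prodMk
          (hX.measurable_flowVariationIntegrand v h s t))).aestronglyMeasurable
  · calc ‖G z.2 * fderiv ℝ f (familyFlow X v s t z.2) (flowVariationIntegrand X v h s t z.2 z.1)‖
      _ ≤ ‖G z.2‖ * (‖fderiv ℝ f (familyFlow X v s t z.2)‖ *
            (Real.exp (C * ‖v‖) * C * ‖h z.1‖)) := by
          rw [norm_mul]
          exact mul_le_mul_of_nonneg_left (ContinuousLinearMap.le_opNorm_of_le _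
            (hX.norm_flowVariationIntegrand_le v h s t z.2 z.1)) (norm_nonneg _)
      _ = _ := by ring

end IsBoundedC1Family

end Duality

section AdjointDensity

open scoped ENNReal

variable {V E : Type*} [NormedAddCommGroup V] [NormedSpace ℝ V]
  [NormedAddCommGroup E] [InnerProductSpace ℝ E] [CompleteSpace E]
  {X : V →ₗ[ℝ] (E → E)} {C : ℝ} {Ω : Set E}

/-- The density, at time `τ`, of the adjoint of the linearization of `v ↦ f ∘ φ_{s,t}ᵛ` applied
to `G`. -/
noncomputable def adjointDensity (X : V →ₗ[ℝ] (E → E)) (f G : E → ℝ) (s t : ℝ) (v : Lp V 2 μI)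
    (τ : ℝ) (z : E) : E :=
  ((fderiv ℝ (familyFlow X v τ s) z).det * G (familyFlow X v τ s z)) •
    ∇ (f ∘ familyFlow X v τ t) z

namespace IsBoundedC1Family

lemma inner_adjointDensity_flowVariationIntegrand (hX : IsBoundedC1Family X C) (v h : Lp V 2 μI)
    (s t τ : ℝ) {f G : E → ℝ} {z : E}
    (hf : DifferentiableAt ℝ f (familyFlow X v τ t z)) :
    inner ℝ (adjointDensity X f G s t v τ z) (X (h τ) z) =
      (fderiv ℝ (familyFlow X v τ s) z).det • (G (familyFlow X v τ s z) *
        fderiv ℝ f (familyFlow X v s t (familyFlow X v τ s z))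
          (flowVariationIntegrand X v h s t (familyFlow X v τ s z) τ)) := by
  rw [adjointDensity, flowVariationIntegrand, hX.familyFlow_familyFlow, hX.familyFlow_familyFlow,
    hX.familyFlow_self, real_inner_smul_left, inner_gradient_left, hX.fderiv_comp_familyFlow hf,
    ContinuousLinearMap.comp_apply, smul_eq_mul, mul_assoc]

variable [FiniteDimensional ℝ E] [MeasurableSpace E] [BorelSpace E] {m : Measure E}
  [m.IsAddHaarMeasure] {p q : ℝ≥0∞} [p.HolderTriple q 1] {f G : E → ℝ}

lemma integrable_adjointDensity (hX : IsBoundedC1Family X C) (h0 : ∀ u, ∀ x ∉ Ω, X u x = 0)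
    (hΩ : IsOpen Ω) (hf : DifferentiableOn ℝ f Ω) (hf' : MemLp (fderiv ℝ f) q (m.restrict Ω))
    (hG : MemLp G p (m.restrict Ω)) (s t : ℝ) (v : Lp V 2 μI) (τ : ℝ) :
    Integrable (adjointDensity X f G s t v τ) (m.restrict Ω) := by
  have hgradient : MemLp (∇ (f ∘ familyFlow X v τ t)) q (m.restrict Ω) :=
    (InnerProductSpace.toDual ℝ E).symm.toContinuousLinearEquiv.toContinuousLinearMap.comp_memLp'
      (hX.memLp_fderiv_comp_familyFlow h0 hΩ hf hf' v τ t)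
  exact memLp_one_iff_integrable.1
    (hgradient.smul (hX.memLp_det_smul_comp_familyFlow h0 hΩ.measurableSet hG v τ s))

lemma setIntegral_mul_fderiv_flowVariationIntegrand (hX : IsBoundedC1Family X C)
    (h0 : ∀ u, ∀ x ∉ Ω, X u x = 0) (hΩ : IsOpen Ω) (hf : DifferentiableOn ℝ f Ω) (G : E → ℝ)
    (v h : Lp V 2 μI) (s t τ : ℝ) :
    ∫ y in Ω, G y * fderiv ℝ f (familyFlow X v s t y) (flowVariationIntegrand X v h s t y τ) ∂m =
      ∫ z in Ω, inner ℝ (adjointDensity X f G s t v τ z) (X (h τ) z) ∂m := by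
  rw [hX.setIntegral_eq_setIntegral_familyFlow h0 hΩ.measurableSet v τ s]
  refine setIntegral_congr_fun hΩ.measurableSet fun z hz => ?_
  exact (hX.inner_adjointDensity_flowVariationIntegrand v h s t τ
    (hf.differentiableAt (hΩ.mem_nhds (hX.familyFlow_mem h0 v τ t hz)))).symm

lemma integrable_setIntegral_inner_adjointDensity (hX : IsBoundedC1Family X C)
    (h0 : ∀ u, ∀ x ∉ Ω, X u x = 0) (hΩ : IsOpen Ω) (hf : DifferentiableOn ℝ f Ω)
    (hf' : MemLp (fderiv ℝ f) q (m.restrict Ω)) (hG : MemLp G p (m.restrict Ω)) (s t : ℝ)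
    (v h : Lp V 2 μI) :
    Integrable (fun τ => ∫ z in Ω, inner ℝ (adjointDensity X f G s t v τ z) (X (h τ) z) ∂m)
      μI := by
  simp only [← hX.setIntegral_mul_fderiv_flowVariationIntegrand h0 hΩ hf G v h s t]
  exact (hX.integrable_mul_fderiv_flowVariationIntegrand h0 hΩ.measurableSet hf' hG v h s
    t).integral_prod_left

/-- Fubini's theorem, followed by the change of variables `y = φ_{τ,s}ᵛ(z)` at each time `τ`. -/
theorem setIntegral_mul_compVariation (hX : IsBoundedC1Family X C)
    (h0 : ∀ u, ∀ x ∉ Ω, X u x = 0) (hΩ : IsOpen Ω) (hf : DifferentiableOn ℝ f Ω)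
    (hf' : MemLp (fderiv ℝ f) q (m.restrict Ω)) (hG : MemLp G p (m.restrict Ω)) (s t : ℝ)
    (v h : Lp V 2 μI) :
    ∫ y in Ω, G y * compVariation X f s t v h y ∂m =
      ∫ τ in s..t, ∫ z in Ω, inner ℝ (adjointDensity X f G s t v τ z) (X (h τ) z) ∂m ∂μI := by
  have hint := (hX.integrable_mul_fderiv_flowVariationIntegrand h0 hΩ.measurableSet hf' hG v h s
    t).mono_measure (Measure.prod_mono (Measure.restrict_le_self (s := uIoc s t)) le_rfl)
  have hpull (y : E) : G y * compVariation X f s t v h y = ∫ τ in s..t, G y *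
      fderiv ℝ f (familyFlow X v s t y) (flowVariationIntegrand X v h s t y τ) ∂μI := by
    rw [intervalIntegral.integral_const_mul, compVariation, flowVariation,
      ContinuousLinearMap.intervalIntegral_comp_comm _
        (hX.integrable_flowVariationIntegrand v h s t y).intervalIntegrable]
  simp only [hpull, intervalIntegral.intervalIntegral_eq_integral_uIoc, integral_smul,
    ← integral_integral_swap hint,
    hX.setIntegral_mul_fderiv_flowVariationIntegrand h0 hΩ hf G v h s t]

end IsBoundedC1Family

end AdjointDensity

section VanishingAtBoundary

variable {E F : Type*} [NormedAddCommGroup F]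

/-- `g` tends to zero at the boundary of `Ω` and at infinity, within `Ω`. -/
def VanishesAtBoundary [TopologicalSpace E] (Ω : Set E) (g : E → F) : Prop :=
  ∀ ε > 0, ∃ K, IsCompact K ∧ K ⊆ Ω ∧ ∀ x ∈ Ω \ K, ‖g x‖ < ε

namespace VanishesAtBoundary

section Topology

variable [TopologicalSpace E] {Ω : Set E} {g : E → F}

lemma tendsto_nhdsWithin [T2Space E] (hg : VanishesAtBoundary Ω g) {p : E} (hp : p ∉ Ω) :
    Tendsto g (𝓝[Ω] p) (𝓝 0) := by
  refine NormedAddGroup.tendsto_nhds_zero.2 fun ε hε => ?_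
  obtain ⟨K, hK, hKΩ, hsmall⟩ := hg ε hε
  filter_upwards [self_mem_nhdsWithin,
    mem_nhdsWithin_of_mem_nhds (hK.isClosed.compl_mem_nhds fun h => hp (hKΩ h))] with x hxΩ hxK
  exact hsmall x ⟨hxΩ, hxK⟩

lemma tendsto_cocompact (hg : VanishesAtBoundary Ω g) (h0 : ∀ x ∉ Ω, g x = 0) :
    Tendsto g (cocompact E) (𝓝 0) := by
  refine NormedAddGroup.tendsto_nhds_zero.2 fun ε hε => ?_
  obtain ⟨K, hK, -, hsmall⟩ := hg ε hε
  filter_upwards [hK.compl_mem_cocompact] with x hxK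
  by_cases hxΩ : x ∈ Ω
  · exact hsmall x ⟨hxΩ, hxK⟩
  · rwa [h0 x hxΩ, norm_zero]

lemma continuous [T2Space E] (hg : VanishesAtBoundary Ω g) (hΩ : IsOpen Ω)
    (hgΩ : ContinuousOn g Ω) (h0 : ∀ x ∉ Ω, g x = 0) : Continuous g := by
  refine continuous_iff_continuousAt.2 fun p => ?_
  by_cases hp : p ∈ Ω
  · exact hgΩ.continuousAt (hΩ.mem_nhds hp)
  · rw [ContinuousAt, h0 p hp, ← nhdsWithin_univ, ← union_compl_self Ω, nhdsWithin_union]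
    refine (hg.tendsto_nhdsWithin hp).sup (tendsto_const_nhds.congr' ?_)
    filter_upwards [self_mem_nhdsWithin] with x hx using (h0 x hx).symm

end Topology

lemma uniformContinuous [UniformSpace E] [T2Space E] {Ω : Set E} {g : E → F}
    (hg : VanishesAtBoundary Ω g) (hΩ : IsOpen Ω) (hgΩ : ContinuousOn g Ω)
    (h0 : ∀ x ∉ Ω, g x = 0) : UniformContinuous g :=
  (hg.continuous hΩ hgΩ h0).uniformContinuous_of_tendsto_cocompact (hg.tendsto_cocompact h0)

end VanishesAtBoundary

end VanishingAtBoundary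

section ExtensionByZero

variable {E F : Type*} [NormedAddCommGroup E] [NormedSpace ℝ E] [NormedAddCommGroup F]
  [NormedSpace ℝ F] {Ω : Set E} {w : E → F}

-- The mean value inequality on the part of the segment from `x` to `p` before it first leaves `Ω`.
lemma norm_le_mul_norm_sub_of_notMem (hΩ : IsOpen Ω) (hw : Continuous w)
    (hwΩ : DifferentiableOn ℝ w Ω) (h0 : ∀ x ∉ Ω, w x = 0) {s : Set E} (hs : Convex ℝ s) {ε : ℝ}
    (hε : 0 ≤ ε) (hbound : ∀ x ∈ s ∩ Ω, ‖fderiv ℝ w x‖ ≤ ε) {x p : E} (hx : x ∈ s) (hp : p ∈ s)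
    (hpΩ : p ∉ Ω) : ‖w x‖ ≤ ε * ‖x - p‖ := by
  have hline : Continuous (AffineMap.lineMap x p : ℝ → E) := AffineMap.lineMap_continuous
  obtain ⟨θ₁, ⟨hθ₁, hexit⟩, hfirst⟩ := (isCompact_Icc.inter_right
    (hΩ.isClosed_compl.preimage hline)).exists_isLeast
      (⟨1, right_mem_Icc.2 zero_le_one, by simpa using hpΩ⟩ :
        (Icc (0 : ℝ) 1 ∩ AffineMap.lineMap x p ⁻¹' Ωᶜ).Nonempty)
  have hbefore (θ : ℝ) (hθ : θ ∈ Ico 0 θ₁) : AffineMap.lineMap x p θ ∈ s ∩ Ω := by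
    have hθ' : θ ∈ Icc (0 : ℝ) 1 := ⟨hθ.1, hθ.2.le.trans hθ₁.2⟩
    exact ⟨hs.lineMap_mem hx hp hθ', not_not.1 fun h => (hfirst ⟨hθ', h⟩).not_gt hθ.2⟩
  have hderiv (θ : ℝ) (hθ : θ ∈ Ico 0 θ₁) : HasDerivWithinAt (w ∘ AffineMap.lineMap x p)
      (fderiv ℝ w (AffineMap.lineMap x p θ) (p - x)) (Ici θ) θ :=
    ((hwΩ.differentiableAt (hΩ.mem_nhds (hbefore θ hθ).2)).hasFDerivAt.comp_hasDerivAt θ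
      AffineMap.hasDerivAt_lineMap).hasDerivWithinAt
  have hmean := norm_image_sub_le_of_norm_deriv_right_le_segment (hw.comp hline).continuousOn
    hderiv (fun θ hθ => ContinuousLinearMap.le_of_opNorm_le _ (hbound _ (hbefore θ hθ)) _) θ₁
    ⟨hθ₁.1, le_rfl⟩
  rw [Function.comp_apply, Function.comp_apply, h0 _ hexit, AffineMap.lineMap_apply_zero, zero_sub,
    norm_neg, sub_zero, norm_sub_rev p x] at hmean
  exact hmean.trans (mul_le_of_le_one_right (by positivity) hθ₁.2)

lemma hasFDerivAt_zero_of_notMem (hΩ : IsOpen Ω) (hw : Continuous w)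
    (hwΩ : DifferentiableOn ℝ w Ω) (h0 : ∀ x ∉ Ω, w x = 0) {p : E} (hp : p ∉ Ω)
    (hderiv : Tendsto (fderiv ℝ w) (𝓝[Ω] p) (𝓝 0)) : HasFDerivAt w (0 : E →L[ℝ] F) p := by
  refine HasFDerivAt.of_isLittleO (Asymptotics.isLittleO_iff.2 fun ε hε => ?_)
  obtain ⟨r, hr, hsmall⟩ := Metric.mem_nhdsWithin_iff.1
    (NormedAddGroup.tendsto_nhds_zero.1 hderiv ε hε)
  filter_upwards [Metric.ball_mem_nhds p hr] with x hx
  simpa only [h0 p hp, zero_apply, sub_zero] using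
    norm_le_mul_norm_sub_of_notMem hΩ hw hwΩ h0 (convex_ball p r) hε.le
      (fun z hz => (hsmall hz).le) hx (Metric.mem_ball_self hr) hp

end ExtensionByZero

namespace IsC10

variable {n : ℕ} {Ω : Set (EuclideanSpace ℝ (Fin n))}
  {w : EuclideanSpace ℝ (Fin n) → EuclideanSpace ℝ (Fin n)}

lemma vanishesAtBoundary (hw : IsC10 Ω w) : VanishesAtBoundary Ω w := fun ε hε =>
  let ⟨K, hK, hKΩ, hsmall⟩ := hw.vanish ε hε
  ⟨K, hK, hKΩ, fun x hx => (hsmall x hx).1⟩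

lemma vanishesAtBoundary_fderiv (hw : IsC10 Ω w) : VanishesAtBoundary Ω (fderiv ℝ w) :=
  fun ε hε =>
    let ⟨K, hK, hKΩ, hsmall⟩ := hw.vanish ε hε
    ⟨K, hK, hKΩ, fun x hx => (hsmall x hx).2⟩

lemma hasFDerivAt_zero (hw : IsC10 Ω w) (hΩ : IsOpen Ω) (h0 : ∀ x ∉ Ω, w x = 0)
    {p : EuclideanSpace ℝ (Fin n)} (hp : p ∉ Ω) :
    HasFDerivAt w (0 : _ →L[ℝ] EuclideanSpace ℝ (Fin n)) p :=
  hasFDerivAt_zero_of_notMem hΩ (hw.vanishesAtBoundary.continuous hΩ hw.contDiffOn.continuousOn h0)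
    (hw.contDiffOn.differentiableOn one_ne_zero) h0 hp
    (hw.vanishesAtBoundary_fderiv.tendsto_nhdsWithin hp)

lemma uniformContinuous_fderiv (hw : IsC10 Ω w) (hΩ : IsOpen Ω) (h0 : ∀ x ∉ Ω, w x = 0) :
    UniformContinuous (fderiv ℝ w) :=
  hw.vanishesAtBoundary_fderiv.uniformContinuous hΩ
    (hw.contDiffOn.continuousOn_fderiv_of_isOpen hΩ le_rfl)
    fun _ hp => (hw.hasFDerivAt_zero hΩ h0 hp).fderiv

lemma contDiff (hw : IsC10 Ω w) (hΩ : IsOpen Ω) (h0 : ∀ x ∉ Ω, w x = 0) : ContDiff ℝ 1 w := by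
  refine contDiff_one_iff_fderiv.2 ⟨fun x => ?_, (hw.uniformContinuous_fderiv hΩ h0).continuous⟩
  by_cases hx : x ∈ Ω
  · exact (hw.contDiffOn.differentiableOn one_ne_zero).differentiableAt (hΩ.mem_nhds hx)
  · exact (hw.hasFDerivAt_zero hΩ h0 hx).differentiableAt

end IsC10

section Extension

variable {n : ℕ} {Ω : Set (EuclideanSpace ℝ (Fin n))}
  {V : Type*} [NormedAddCommGroup V] [InnerProductSpace ℝ V]
  [RKHS ℝ V Ω (EuclideanSpace ℝ (Fin n))]

lemma vectorField_of_mem (u : V) {x : EuclideanSpace ℝ (Fin n)} (hx : x ∈ Ω) :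
    vectorField u x = u ⟨x, hx⟩ :=
  Subtype.val_injective.extend_apply (fun x => u x) 0 ⟨x, hx⟩

lemma vectorField_of_notMem (u : V) {x : EuclideanSpace ℝ (Fin n)} (hx : x ∉ Ω) :
    vectorField u x = 0 :=
  Function.extend_apply' _ _ _ (by rintro ⟨y, rfl⟩; exact hx y.2)

variable (V) in
/-- `vectorField` as a linear map. -/
noncomputable def vectorFieldₗ :
    V →ₗ[ℝ] (EuclideanSpace ℝ (Fin n) → EuclideanSpace ℝ (Fin n)) where
  toFun := vectorField
  map_add' u w := by
    funext x
    by_cases hx : x ∈ Ω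
    · simp [vectorField_of_mem _ hx]
    · simp [vectorField_of_notMem _ hx]
  map_smul' c u := by
    funext x
    by_cases hx : x ∈ Ω
    · simp [vectorField_of_mem _ hx]
    · simp [vectorField_of_notMem _ hx]

lemma vectorFieldₗ_apply (u : V) : vectorFieldₗ V u = vectorField u := rfl

theorem IsAdmissible.exists_isBoundedC1Family (hV : IsAdmissible V) (hΩ : IsOpen Ω) :
    ∃ C, IsBoundedC1Family (vectorFieldₗ V) C := by
  obtain ⟨C, hC, hbound⟩ := hV.bound
  have h0 (u : V) : ∀ x ∉ Ω, vectorField u x = 0 := fun x hx => vectorField_of_notMem u hx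
  refine ⟨C, hC, fun u x => ?_, fun u => (hV.isC10 u).contDiff hΩ (h0 u), fun u x => ?_,
    fun u => (hV.isC10 u).uniformContinuous_fderiv hΩ (h0 u)⟩ <;>
    rw [vectorFieldₗ_apply] <;> by_cases hx : x ∈ Ω
  · exact (le_add_of_nonneg_right (norm_nonneg _)).trans (hbound u x hx x hx)
  · rw [h0 u x hx, norm_zero]; positivity
  · exact (le_add_of_nonneg_left (norm_nonneg _)).trans (hbound u x hx x hx)
  · rw [((hV.isC10 u).hasFDerivAt_zero hΩ (h0 u) hx).fderiv, norm_zero]; positivity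

end Extension

section TimeInterval

lemma intervalIntegral_restrict_Icc {G : Type*} [NormedAddCommGroup G] [NormedSpace ℝ G]
    (F : ℝ → G) {t : ℝ} (ht : t ∈ Icc (0 : ℝ) 1) :
    ∫ τ in (0 : ℝ)..t, F τ ∂μI = ∫ τ in (0 : ℝ)..t, F τ := by
  rw [intervalIntegral.integral_of_le ht.1, intervalIntegral.integral_of_le ht.1,
    Measure.restrict_restrict_of_subset
      (Ioc_subset_Icc_self.trans (Icc_subset_Icc_right ht.2))]

end TimeInterval

section Identification

variable {n : ℕ} {Ω : Set (EuclideanSpace ℝ (Fin n))}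
  {V : Type*} [NormedAddCommGroup V] [InnerProductSpace ℝ V]
  [RKHS ℝ V Ω (EuclideanSpace ℝ (Fin n))] {C : ℝ} {s t : ℝ}

lemma vectorFieldₗ_of_notMem (u : V) (x : EuclideanSpace ℝ (Fin n)) (hx : x ∉ Ω) :
    vectorFieldₗ V u x = 0 :=
  vectorField_of_notMem u hx

lemma isFlow_familyFlow (hX : IsBoundedC1Family (vectorFieldₗ V) C) (v : VelocitySpace V) :
    IsFlow (⇑v) (familyFlow (vectorFieldₗ V) v 0) where
  mapsTo t _ _ hx := hX.familyFlow_mem vectorFieldₗ_of_notMem v 0 t hx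
  intervalIntegrable x _ := by
    rw [intervalIntegrable_iff_integrableOn_Icc_of_le zero_le_one]
    exact (hX.isCaratheodory v).integrable_comp _ (hX.continuous_familyFlow_time v 0 x)
  eq x _ t ht := by
    rw [← intervalIntegral_restrict_Icc _ ht]
    exact (hX.isSolution_familyFlow v 0 x).eq t

lemma IsFlow.eq_familyFlow (hX : IsBoundedC1Family (vectorFieldₗ V) C) {v : VelocitySpace V}
    {φ : ℝ → EuclideanSpace ℝ (Fin n) → EuclideanSpace ℝ (Fin n)} (hφ : IsFlow (⇑v) φ)
    (ht : t ∈ Icc (0 : ℝ) 1) {x : EuclideanSpace ℝ (Fin n)} (hx : x ∈ Ω) :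
    φ t x = familyFlow (vectorFieldₗ V) v 0 t x := by
  set F : ℝ → EuclideanSpace ℝ (Fin n) := fun τ => vectorField (v τ) (φ τ x)
  have hF : Integrable F μI :=
    (intervalIntegrable_iff_integrableOn_Icc_of_le zero_le_one).1 (hφ.intervalIntegrable x hx)
  -- `φ` is only controlled on `[0,1]`; this is its extension to a solution for all times.
  set y : ℝ → EuclideanSpace ℝ (Fin n) := fun r => x + ∫ τ in (0 : ℝ)..r, F τ ∂μI with hy
  have hyφ : ∀ r ∈ Icc (0 : ℝ) 1, y r = φ r x := fun r hr => by
    rw [hφ.eq x hx r hr, hy, ← intervalIntegral_restrict_Icc F hr]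
  have hFy : F =ᵐ[μI] fun τ => vectorFieldₗ V (v τ) (y τ) := by
    filter_upwards [ae_restrict_mem measurableSet_Icc] with τ hτ
    rw [hyφ τ hτ, vectorFieldₗ_apply]
  have hsol : IsSolution (fun τ => vectorFieldₗ V (v τ)) 0 x y :=
    ⟨by simp [hy], ((isPrimitive_intervalIntegral hF 0).const_add x).congr_ae hFy⟩
  rw [hX.familyFlow_eq hsol, hyφ t ht]

lemma isFlow_flow (hX : IsBoundedC1Family (vectorFieldₗ V) C) (v : VelocitySpace V) :
    IsFlow (⇑v) (flow v) := by
  have h : ∃ φ, IsFlow (⇑v) φ := ⟨_, isFlow_familyFlow hX v⟩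
  rw [flow, dif_pos h]
  exact h.choose_spec

lemma eqOn_flow (hX : IsBoundedC1Family (vectorFieldₗ V) C) (v : VelocitySpace V)
    (ht : t ∈ Icc (0 : ℝ) 1) : EqOn (flow v t) (familyFlow (vectorFieldₗ V) v 0 t) Ω :=
  fun _ hx => (isFlow_flow hX v).eq_familyFlow hX ht hx

lemma bijOn_flow (hX : IsBoundedC1Family (vectorFieldₗ V) C) (v : VelocitySpace V)
    (ht : t ∈ Icc (0 : ℝ) 1) : BijOn (flow v t) Ω Ω :=
  (hX.bijOn_familyFlow vectorFieldₗ_of_notMem v 0 t).congr (eqOn_flow hX v ht).symm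

lemma eqOn_flowBetween (hX : IsBoundedC1Family (vectorFieldₗ V) C) (v : VelocitySpace V)
    (hs : s ∈ Icc (0 : ℝ) 1) (ht : t ∈ Icc (0 : ℝ) 1) :
    EqOn (flowBetween v s t) (familyFlow (vectorFieldₗ V) v s t) Ω := fun y hy => by
  obtain ⟨hmem, hinv⟩ : Function.invFunOn (flow v s) Ω y ∈ Ω ∧
      flow v s (Function.invFunOn (flow v s) Ω y) = y :=
    Function.invFunOn_pos ((bijOn_flow hX v hs).surjOn hy)
  rw [eqOn_flow hX v hs hmem] at hinv
  rw [flowBetween, Function.comp_apply, eqOn_flow hX v ht hmem,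
    ← hX.familyFlow_familyFlow v 0 s t, hinv]

lemma contDiffOn_flowBetween (hX : IsBoundedC1Family (vectorFieldₗ V) C) (v : VelocitySpace V)
    (hs : s ∈ Icc (0 : ℝ) 1) (ht : t ∈ Icc (0 : ℝ) 1) :
    ContDiffOn ℝ 1 (flowBetween v s t) Ω :=
  (hX.contDiff_familyFlow v s t).contDiffOn.congr (eqOn_flowBetween hX v hs ht)

variable {f : EuclideanSpace ℝ (Fin n) → ℝ}

lemma comp_flowBetween_ae_eq (hX : IsBoundedC1Family (vectorFieldₗ V) C) (hΩ : MeasurableSet Ω)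
    (v : VelocitySpace V) (hs : s ∈ Icc (0 : ℝ) 1) (ht : t ∈ Icc (0 : ℝ) 1) :
    f ∘ flowBetween v s t =ᵐ[volume.restrict Ω] f ∘ familyFlow (vectorFieldₗ V) v s t :=
  (ae_restrict_mem hΩ).mono (eqOn_flowBetween hX v hs ht).comp_left

lemma memLp_comp_flowBetween (hX : IsBoundedC1Family (vectorFieldₗ V) C) (hΩ : MeasurableSet Ω)
    (hf : MemLp f 2 (volume.restrict Ω)) (v : VelocitySpace V)
    (hs : s ∈ Icc (0 : ℝ) 1) (ht : t ∈ Icc (0 : ℝ) 1) :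
    MemLp (f ∘ flowBetween v s t) 2 (volume.restrict Ω) :=
  (hX.memLp_comp_familyFlow vectorFieldₗ_of_notMem hΩ hf s t v).ae_eq
    (comp_flowBetween_ae_eq hX hΩ v hs ht).symm

lemma toImage_comp_flowBetween (hX : IsBoundedC1Family (vectorFieldₗ V) C)
    (hΩ : MeasurableSet Ω) (hf : MemLp f 2 (volume.restrict Ω)) (v : VelocitySpace V)
    (hs : s ∈ Icc (0 : ℝ) 1) (ht : t ∈ Icc (0 : ℝ) 1) :
    toImage Ω (f ∘ flowBetween v s t) =
      (hX.memLp_comp_familyFlow vectorFieldₗ_of_notMem hΩ hf s t v).toLp := by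
  rw [toImage, dif_pos (memLp_comp_flowBetween hX hΩ hf v hs ht)]
  exact MemLp.toLp_congr _ _ (comp_flowBetween_ae_eq hX hΩ v hs ht)

lemma fderiv_flowBetween (hX : IsBoundedC1Family (vectorFieldₗ V) C) (hΩ : IsOpen Ω)
    (v : VelocitySpace V) (hs : s ∈ Icc (0 : ℝ) 1) (ht : t ∈ Icc (0 : ℝ) 1)
    {y : EuclideanSpace ℝ (Fin n)} (hy : y ∈ Ω) :
    fderiv ℝ (flowBetween v s t) y = fderiv ℝ (familyFlow (vectorFieldₗ V) v s t) y :=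
  ((eqOn_flowBetween hX v hs ht).eventuallyEq_of_mem (hΩ.mem_nhds hy)).fderiv_eq

lemma gradient_comp_flowBetween (hX : IsBoundedC1Family (vectorFieldₗ V) C) (hΩ : IsOpen Ω)
    (v : VelocitySpace V) (hs : s ∈ Icc (0 : ℝ) 1) (ht : t ∈ Icc (0 : ℝ) 1)
    {y : EuclideanSpace ℝ (Fin n)} (hy : y ∈ Ω) :
    ∇ (f ∘ flowBetween v s t) y = ∇ (f ∘ familyFlow (vectorFieldₗ V) v s t) y := by
  have h := (eqOn_flowBetween hX v hs ht).comp_left (g := f)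
  rw [gradient, gradient, (h.eventuallyEq_of_mem (hΩ.mem_nhds hy)).fderiv_eq]

end Identification

section HasDensity

variable {V : Type*} [NormedAddCommGroup V] [InnerProductSpace ℝ V]

/-- The functional `D` on `L²([0,1], V)` is integration against `k`. Being tested only against
`L²` fields, `k` need not be strongly measurable. -/
structure HasDensity (D : Lp V 2 μI →L[ℝ] ℝ) (k : ℝ → V) : Prop where
  integrable_inner : ∀ h : Lp V 2 μI, Integrable (fun τ => inner ℝ (k τ) (h τ)) μI
  eq_integral : ∀ h : Lp V 2 μI, D h = ∫ τ, inner ℝ (k τ) (h τ) ∂μI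

namespace HasDensity

variable {D D' : Lp V 2 μI →L[ℝ] ℝ} {k k' : ℝ → V}

lemma of_indicator {A : Set ℝ} (hA : MeasurableSet A)
    (hint : ∀ h : Lp V 2 μI, Integrable (fun τ => inner ℝ (k τ) (h τ)) μI)
    (heq : ∀ h : Lp V 2 μI, D h = ∫ τ in A, inner ℝ (k τ) (h τ) ∂μI) :
    HasDensity D (A.indicator k) := by
  have hinner (h : Lp V 2 μI) : (fun τ => inner ℝ (A.indicator k τ) (h τ)) =
      A.indicator fun τ => inner ℝ (k τ) (h τ) := by
    funext τ
    by_cases hτ : τ ∈ A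
    · simp only [indicator_of_mem hτ]
    · simp only [indicator_of_notMem hτ, inner_zero_left]
  refine ⟨fun h => ?_, fun h => ?_⟩
  · rw [hinner]
    exact (hint h).indicator hA
  · rw [hinner, integral_indicator hA, heq]

lemma add (hD : HasDensity D k) (hD' : HasDensity D' k') : HasDensity (D + D') (k + k') where
  integrable_inner h := by
    simp only [Pi.add_apply, inner_add_left]
    exact (hD.integrable_inner h).add (hD'.integrable_inner h)
  eq_integral h := by
    simp only [Pi.add_apply, inner_add_left]
    rw [add_apply, hD.eq_integral, hD'.eq_integral,
      integral_add (hD.integrable_inner h) (hD'.integrable_inner h)]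

lemma const_smul (hD : HasDensity D k) (c : ℝ) : HasDensity (c • D) (c • k) where
  integrable_inner h := by
    simp only [Pi.smul_apply, real_inner_smul_left]
    exact (hD.integrable_inner h).const_mul c
  eq_integral h := by
    simp only [Pi.smul_apply, real_inner_smul_left]
    rw [smul_apply, hD.eq_integral, integral_const_mul, smul_eq_mul]

lemma sum {ι : Type*} {s : Finset ι} {D : ι → Lp V 2 μI →L[ℝ] ℝ} {k : ι → ℝ → V}
    (hD : ∀ i ∈ s, HasDensity (D i) (k i)) : HasDensity (∑ i ∈ s, D i) (∑ i ∈ s, k i) where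
  integrable_inner h := by
    simp only [Finset.sum_apply, sum_inner]
    exact integrable_finsetSum s fun i hi => (hD i hi).integrable_inner h
  eq_integral h := by
    simp only [Finset.sum_apply, sum_inner]
    rw [sum_apply, integral_finsetSum s fun i hi => (hD i hi).integrable_inner h]
    exact Finset.sum_congr rfl fun i hi => (hD i hi).eq_integral h

lemma integrable_inner_const (hD : HasDensity D k) (u : V) :
    Integrable (fun τ => inner ℝ (k τ) u) μI := by
  refine (hD.integrable_inner (Lp.const 2 μI u)).congr ?_
  filter_upwards [Lp.coeFn_const (p := 2) (μ := μI) u] with τ hτ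
  rw [hτ, Function.const_apply]

lemma apply_indicatorConstLp (hD : HasDensity D k) {A : Set ℝ} (hA : MeasurableSet A) (u : V) :
    D (indicatorConstLp 2 hA (measure_ne_top μI A) u) = ∫ τ in A, inner ℝ (k τ) u ∂μI := by
  rw [hD.eq_integral, ← integral_indicator hA]
  refine integral_congr_ae ?_
  filter_upwards [indicatorConstLp_coeFn (p := 2) (hs := hA) (hμs := measure_ne_top μI A)
    (c := u)] with τ hτ
  by_cases hτA : τ ∈ A
  · rw [hτ, indicator_of_mem hτA, indicator_of_mem hτA]
  · rw [hτ, indicator_of_notMem hτA, indicator_of_notMem hτA, inner_zero_right]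

theorem inner_gradient_ae_eq [CompleteSpace V] {F : Lp V 2 μI → ℝ} {v : Lp V 2 μI}
    (hD : HasDensity D k) (hF : HasFDerivAt F D v) (u : V) :
    ∀ᵐ τ ∂μI, inner ℝ ((∇ F v : Lp V 2 μI) τ) u = inner ℝ (k τ) u := by
  refine Integrable.ae_eq_of_forall_setIntegral_eq _ _
    ((integrable_velocity (∇ F v)).inner_const u) (hD.integrable_inner_const u) fun A hA _ => ?_
  calc ∫ τ in A, inner ℝ ((∇ F v : Lp V 2 μI) τ) u ∂μI
      = ∫ τ in A, inner ℝ u ((∇ F v : Lp V 2 μI) τ) ∂μI := by simp only [real_inner_comm]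
    _ = inner ℝ (indicatorConstLp 2 hA (measure_ne_top μI A) u) (∇ F v) :=
      (L2.inner_indicatorConstLp_eq_setIntegral_inner ℝ (∇ F v : Lp V 2 μI) hA u
        (measure_ne_top μI A)).symm
    _ = D (indicatorConstLp 2 hA (measure_ne_top μI A) u) := by
      rw [real_inner_comm, inner_gradient_left, hF.fderiv]
    _ = ∫ τ in A, inner ℝ (k τ) u ∂μI := hD.apply_indicatorConstLp hA u

end HasDensity

section Restriction

variable {α : Type*} [MeasurableSpace α] {μ : Measure α}

lemma inner_LpToLpRestrictCLM (A : Set α) (w h : Lp V 2 μ) :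
    inner ℝ (LpToLpRestrictCLM α V ℝ μ 2 A w) (LpToLpRestrictCLM α V ℝ μ 2 A h) =
      ∫ x in A, inner ℝ (w x) (h x) ∂μ := by
  rw [L2.inner_def]
  refine integral_congr_ae ?_
  filter_upwards [LpToLpRestrictCLM_coeFn ℝ A w, LpToLpRestrictCLM_coeFn ℝ A h] with x hw hh
  rw [hw, hh]

theorem hasFDerivAt_setIntegral_norm_sq (A : Set α) (v : Lp V 2 μ) :
    HasFDerivAt (fun w : Lp V 2 μ => ∫ x in A, ‖w x‖ ^ 2 ∂μ)
      (2 • innerSL ℝ (LpToLpRestrictCLM α V ℝ μ 2 A v) ∘L LpToLpRestrictCLM α V ℝ μ 2 A) v := by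
  have hnorm (w : Lp V 2 μ) : ‖LpToLpRestrictCLM α V ℝ μ 2 A w‖ ^ 2 = ∫ x in A, ‖w x‖ ^ 2 ∂μ := by
    simp only [← real_inner_self_eq_norm_sq, inner_LpToLpRestrictCLM]
  simpa only [hnorm] using (LpToLpRestrictCLM α V ℝ μ 2 A).hasFDerivAt.norm_sq

end Restriction

theorem exists_hasFDerivAt_integral_norm_sq (v : Lp V 2 μI) {t : ℝ} (ht : t ∈ Icc (0 : ℝ) 1) :
    ∃ D : Lp V 2 μI →L[ℝ] ℝ,
      HasFDerivAt (fun w : Lp V 2 μI => ∫ τ in (0 : ℝ)..t, ‖w τ‖ ^ 2) D v ∧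
      HasDensity D ((Ioc 0 t).indicator fun τ => (2 : ℝ) • v τ) := by
  have hderiv := hasFDerivAt_setIntegral_norm_sq (Ioc 0 t) v
  simp only [← intervalIntegral.integral_of_le ht.1, intervalIntegral_restrict_Icc _ ht] at hderiv
  refine ⟨_, hderiv, .of_indicator measurableSet_Ioc (fun h => ?_) fun h => ?_⟩
  · simp only [real_inner_smul_left]
    exact (L2.integrable_inner v h).const_mul 2
  · simp only [real_inner_smul_left, integral_const_mul, ← inner_LpToLpRestrictCLM, smul_apply,
      ContinuousLinearMap.comp_apply, innerSL_apply_apply, nsmul_eq_mul, Nat.cast_ofNat]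

end HasDensity

section Kernel

variable {n : ℕ} {Ω : Set (EuclideanSpace ℝ (Fin n))}
  {V : Type*} [NormedAddCommGroup V] [InnerProductSpace ℝ V] [CompleteSpace V]
  [RKHS ℝ V Ω (EuclideanSpace ℝ (Fin n))] {C : ℝ}

lemma norm_kerFun_le (hX : IsBoundedC1Family (vectorFieldₗ V) C) (x : Ω) :
    ‖RKHS.kerFun V x‖ ≤ C := by
  rw [← LinearIsometryEquiv.norm_map ContinuousLinearMap.adjoint]
  refine ContinuousLinearMap.opNorm_le_bound _ hX.pos.le fun u => ?_
  rw [RKHS.adjoint_kerFun, ← vectorField_of_mem u x.2]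
  exact hX.norm_le u x

lemma continuous_kerFun (hX : IsBoundedC1Family (vectorFieldₗ V) C) :
    Continuous fun x : Ω => RKHS.kerFun V x := by
  refine (LipschitzWith.of_dist_le_mul (K := C.toNNReal) fun x y => ?_).continuous
  rw [dist_eq_norm, ← LinearIsometryEquiv.norm_map ContinuousLinearMap.adjoint, map_sub,
    Real.coe_toNNReal _ hX.pos.le]
  refine ContinuousLinearMap.opNorm_le_bound _ (mul_nonneg hX.pos.le dist_nonneg) fun u => ?_
  rw [sub_apply, RKHS.adjoint_kerFun, RKHS.adjoint_kerFun, ← vectorField_of_mem u x.2,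
    ← vectorField_of_mem u y.2, Subtype.dist_eq, dist_eq_norm, mul_right_comm]
  exact hX.norm_sub_le u x y

lemma continuous_kerFun_apply (hX : IsBoundedC1Family (vectorFieldₗ V) C) :
    Continuous fun p : Ω × EuclideanSpace ℝ (Fin n) => RKHS.kerFun V p.1 p.2 :=
  ((continuous_kerFun hX).comp continuous_fst).clm_apply continuous_snd

section Integral

variable {b : EuclideanSpace ℝ (Fin n) → EuclideanSpace ℝ (Fin n)}

lemma integrable_kerFun_apply (hX : IsBoundedC1Family (vectorFieldₗ V) C) (hΩ : MeasurableSet Ω)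
    (hb : IntegrableOn b Ω) :
    Integrable (fun y : Ω => RKHS.kerFun V y (b y)) (volume.comap Subtype.val) := by
  have hb' : Integrable (fun y : Ω => b y) (volume.comap Subtype.val) :=
    (integrableOn_iff_comap_subtypeVal hΩ).1 hb
  have hid : AEStronglyMeasurable (fun y : Ω => y) (volume.comap Subtype.val) :=
    continuous_id.aestronglyMeasurable
  have hpair : AEStronglyMeasurable (fun y : Ω => (y, b y)) (volume.comap Subtype.val) :=
    hid.prodMk hb'.aestronglyMeasurable
  have hmeas := (continuous_kerFun_apply hX).comp_aestronglyMeasurable hpair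
  exact (hb'.norm.const_mul C).mono' hmeas
    (ae_of_all _ fun y => (RKHS.kerFun V y).le_of_opNorm_le (norm_kerFun_le hX y) _)

lemma inner_integral_kerFun_apply (hX : IsBoundedC1Family (vectorFieldₗ V) C)
    (hΩ : MeasurableSet Ω) (hb : IntegrableOn b Ω) (u : V) :
    inner ℝ (∫ y : Ω, RKHS.kerFun V y (b y) ∂(volume.comap Subtype.val)) u =
      ∫ z in Ω, inner ℝ (b z) (vectorFieldₗ V u z) := by
  rw [real_inner_comm, ← integral_inner (integrable_kerFun_apply hX hΩ hb),
    ← integral_subtype_comap hΩ]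
  refine integral_congr_ae (ae_of_all _ fun y => ?_)
  simp only [RKHS.inner_kerFun, vectorFieldₗ_apply, vectorField_of_mem u y.2, real_inner_comm]

lemma integrable_kernel_apply (hX : IsBoundedC1Family (vectorFieldₗ V) C) (hΩ : MeasurableSet Ω)
    (hb : IntegrableOn b Ω) (x : Ω) :
    Integrable (fun y : Ω => RKHS.kernel V x y (b y)) (volume.comap Subtype.val) :=
  (RKHS.kerFun V x).adjoint.integrable_comp (integrable_kerFun_apply hX hΩ hb)

lemma integral_kerFun_apply_coe (hX : IsBoundedC1Family (vectorFieldₗ V) C)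
    (hΩ : MeasurableSet Ω) (hb : IntegrableOn b Ω) (x : Ω) :
    (∫ y : Ω, RKHS.kerFun V y (b y) ∂(volume.comap Subtype.val) : V) x =
      ∫ y : Ω, RKHS.kernel V x y (b y) ∂(volume.comap Subtype.val) := by
  rw [← RKHS.adjoint_kerFun, ← ContinuousLinearMap.integral_comp_comm _
    (integrable_kerFun_apply hX hΩ hb)]
  rfl

end Integral

/-- The vectors `K(·, x) e` span a dense subspace of `V`, and those with `(x, e)` in a countable
dense set suffice, so countably many null sets are enough. -/
lemma ae_eq_of_forall_inner_ae_eq (hX : IsBoundedC1Family (vectorFieldₗ V) C) {α : Type*}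
    [MeasurableSpace α] {μ : Measure α} {w r : α → V}
    (h : ∀ u : V, ∀ᵐ a ∂μ, inner ℝ (w a) u = inner ℝ (r a) u) : w =ᵐ[μ] r := by
  obtain ⟨S, hS, hSd⟩ := TopologicalSpace.exists_countable_dense
    (Ω × EuclideanSpace ℝ (Fin n))
  filter_upwards [(ae_ball_iff hS).2 fun p _ => h (RKHS.kerFun V p.1 p.2)] with a ha
  have hinner : (fun p : Ω × EuclideanSpace ℝ (Fin n) => inner ℝ (w a) (RKHS.kerFun V p.1 p.2)) =
      fun p => inner ℝ (r a) (RKHS.kerFun V p.1 p.2) :=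
    Continuous.ext_on hSd (continuous_const.inner (continuous_kerFun_apply hX))
      (continuous_const.inner (continuous_kerFun_apply hX)) ha
  refine DFunLike.ext _ _ fun x => ext_inner_right ℝ fun e => ?_
  rw [← RKHS.inner_kerFun, ← RKHS.inner_kerFun]
  exact congrFun hinner (x, e)

end Kernel

section DataTerm

variable {V E : Type*} [NormedAddCommGroup V] [InnerProductSpace ℝ V] [NormedAddCommGroup E]
  [InnerProductSpace ℝ E] [CompleteSpace E] [FiniteDimensional ℝ E] [MeasurableSpace E]
  [BorelSpace E] {m : Measure E} [m.IsAddHaarMeasure] {X : V →ₗ[ℝ] (E → E)} {C : ℝ} {f : E → ℝ}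
  {Ω : Set E}

namespace IsBoundedC1Family

lemma inner_compVariationCLM (hX : IsBoundedC1Family X C) (h0 : ∀ u, ∀ x ∉ Ω, X u x = 0)
    (hΩ : IsOpen Ω) (hf : DifferentiableOn ℝ f Ω) (hf' : MemLp (fderiv ℝ f) 2 (m.restrict Ω))
    (G : Lp ℝ 2 (m.restrict Ω)) (s t : ℝ) (v h : Lp V 2 μI) :
    inner ℝ G (hX.compVariationCLM h0 hΩ.measurableSet hf' s t v h) =
      ∫ τ in s..t, ∫ z in Ω, inner ℝ (adjointDensity X f G s t v τ z) (X (h τ) z) ∂m ∂μI := by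
  rw [← hX.setIntegral_mul_compVariation h0 hΩ hf hf' (Lp.memLp G) s t v h, L2.inner_def]
  refine integral_congr_ae ?_
  filter_upwards [hX.coeFn_compVariationCLM h0 hΩ.measurableSet hf' s t v h] with y hy
  rw [hy]
  exact mul_comm _ _

theorem hasFDerivAt_norm_sq_sub (hX : IsBoundedC1Family X C) (h0 : ∀ u, ∀ x ∉ Ω, X u x = 0)
    (hΩ : IsOpen Ω) (hf : DifferentiableOn ℝ f Ω) (hf2 : MemLp f 2 (m.restrict Ω))
    (hf' : MemLp (fderiv ℝ f) 2 (m.restrict Ω)) {Y : Type*} [NormedAddCommGroup Y]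
    [InnerProductSpace ℝ Y] [CompleteSpace Y] (T : Lp ℝ 2 (m.restrict Ω) →L[ℝ] Y) (g : Y)
    (s t : ℝ) (v : Lp V 2 μI) :
    let I := fun w => (hX.memLp_comp_familyFlow h0 hΩ.measurableSet hf2 s t w).toLp
    HasFDerivAt (fun w => ‖T (I w) - g‖ ^ 2)
      ((2 : ℝ) • innerSL ℝ (T.adjoint (T (I v) - g)) ∘L
        hX.compVariationCLM h0 hΩ.measurableSet hf' s t v) v := by
  intro I
  have hI : HasFDerivAt I (hX.compVariationCLM h0 hΩ.measurableSet hf' s t v) v :=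
    hX.hasFDerivAt_toLp_comp_familyFlow h0 hΩ ENNReal.ofNat_ne_top hf hf2 hf' s t v
  refine ((T.hasFDerivAt.comp v hI).sub_const g).norm_sq.congr_fderiv ?_
  ext h
  simp only [smul_apply, ContinuousLinearMap.comp_apply, innerSL_apply_apply, Function.comp_apply,
    ContinuousLinearMap.adjoint_inner_left, smul_eq_mul, nsmul_eq_mul, Nat.cast_ofNat]

end IsBoundedC1Family

theorem hasDensity_innerSL_comp_compVariationCLM {n : ℕ} {Ω : Set (EuclideanSpace ℝ (Fin n))}
    {V : Type*} [NormedAddCommGroup V] [InnerProductSpace ℝ V] [CompleteSpace V]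
    [RKHS ℝ V Ω (EuclideanSpace ℝ (Fin n))] {C : ℝ} (hX : IsBoundedC1Family (vectorFieldₗ V) C)
    (hΩ : IsOpen Ω) {f : EuclideanSpace ℝ (Fin n) → ℝ} (hf : DifferentiableOn ℝ f Ω)
    (hf' : MemLp (fderiv ℝ f) 2 (volume.restrict Ω)) (G : ImageSpace Ω) {s t : ℝ} (hts : t ≤ s)
    (v : VelocitySpace V) :
    HasDensity
      (innerSL ℝ G ∘L hX.compVariationCLM vectorFieldₗ_of_notMem hΩ.measurableSet hf' s t v)
      ((Ioc t s).indicator fun τ => -∫ y : Ω,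
        RKHS.kerFun V y (adjointDensity (vectorFieldₗ V) f G s t v τ y)
          ∂(volume.comap Subtype.val)) := by
  have hb (τ : ℝ) : IntegrableOn (adjointDensity (vectorFieldₗ V) f G s t v τ) Ω :=
    hX.integrable_adjointDensity vectorFieldₗ_of_notMem hΩ hf hf' (Lp.memLp G) s t v τ
  refine .of_indicator measurableSet_Ioc (fun h => ?_) fun h => ?_ <;>
    simp only [inner_neg_left, inner_integral_kerFun_apply hX hΩ.measurableSet (hb _)]
  · exact (hX.integrable_setIntegral_inner_adjointDensity vectorFieldₗ_of_notMem hΩ hf hf'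
      (Lp.memLp G) s t v h).neg
  · rw [integral_neg, ← intervalIntegral.integral_of_le hts, ← intervalIntegral.integral_symm,
      ← hX.inner_compVariationCLM vectorFieldₗ_of_notMem hΩ hf hf',
      ContinuousLinearMap.comp_apply, innerSL_apply_apply]

end DataTerm

section Functional

variable {n : ℕ} {Ω : Set (EuclideanSpace ℝ (Fin n))}
  {V : Type*} [NormedAddCommGroup V] [InnerProductSpace ℝ V]
  [RKHS ℝ V Ω (EuclideanSpace ℝ (Fin n))] {C : ℝ}
  {Y : Type*} [NormedAddCommGroup Y] [InnerProductSpace ℝ Y] [CompleteSpace Y]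
  {N : ℕ} (T : ℝ → ImageSpace Ω →L[ℝ] Y) (g : ℝ → Y) {f : EuclideanSpace ℝ (Fin n) → ℝ}

lemma natCast_div_mem_Icc {i : ℕ} (hi : i ∈ Finset.Icc 1 N) : (i : ℝ) / N ∈ Icc (0 : ℝ) 1 :=
  ⟨by positivity, div_le_one_of_le₀ (by exact_mod_cast (Finset.mem_Icc.1 hi).2) (by positivity)⟩

lemma memLp_fderiv_of_memLp_gradient {E : Type*} [NormedAddCommGroup E] [InnerProductSpace ℝ E]
    [CompleteSpace E] [MeasurableSpace E] {μ : Measure E} {p : ENNReal} {f : E → ℝ}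
    (hf : MemLp (∇ f) p μ) : MemLp (fderiv ℝ f) p μ := by
  have h : fderiv ℝ f = InnerProductSpace.toDual ℝ E ∘ ∇ f := by
    funext x; simp [gradient]
  rw [h]
  exact (InnerProductSpace.toDual ℝ E).toContinuousLinearEquiv.toContinuousLinearMap.comp_memLp' hf

/-- `T_t*(T_t(f ∘ φ_{t,0}) - g_t)`, the adjoint of `T_t` applied to the residual at time `t`. -/
noncomputable def adjointResidual (T : ℝ → ImageSpace Ω →L[ℝ] Y) (g : ℝ → Y)
    (f : EuclideanSpace ℝ (Fin n) → ℝ) (v : VelocitySpace V) (t : ℝ) : ImageSpace Ω :=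
  (T t).adjoint (T t (toImage Ω (f ∘ flowBetween v t 0)) - g t)

/-- The vector field `h_{τ,t} ∇(f ∘ φ_{τ,0})` for `τ ≤ t`, in terms of flows on all of `ℝⁿ`. -/
noncomputable def dataDensity (T : ℝ → ImageSpace Ω →L[ℝ] Y) (g : ℝ → Y)
    (f : EuclideanSpace ℝ (Fin n) → ℝ) (v : VelocitySpace V) (t τ : ℝ) :
    EuclideanSpace ℝ (Fin n) → EuclideanSpace ℝ (Fin n) :=
  adjointDensity (vectorFieldₗ V) f (adjointResidual T g f v t) t 0 v τ

/-- The contribution of the single time `t` to `N ∇J_f(v)`, as a function of `τ`. -/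
noncomputable def termGradient [CompleteSpace V] (T : ℝ → ImageSpace Ω →L[ℝ] Y) (g : ℝ → Y)
    (μ₂ : ℝ) (f : EuclideanSpace ℝ (Fin n) → ℝ) (v : VelocitySpace V) (t : ℝ) : ℝ → V :=
  (Ioc 0 t).indicator fun τ => -(2 : ℝ) • (∫ y : Ω, RKHS.kerFun V y (dataDensity T g f v t τ y)
    ∂(volume.comap Subtype.val)) + (2 * μ₂) • v τ

lemma integrableOn_dataDensity (hX : IsBoundedC1Family (vectorFieldₗ V) C) (hΩ : IsOpen Ω)
    (hf : DifferentiableOn ℝ f Ω) (hf' : MemLp (fderiv ℝ f) 2 (volume.restrict Ω))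
    (v : VelocitySpace V) (t τ : ℝ) : IntegrableOn (dataDensity T g f v t τ) Ω :=
  hX.integrable_adjointDensity vectorFieldₗ_of_notMem hΩ hf hf' (Lp.memLp _) t 0 v τ

variable [CompleteSpace V]

theorem exists_hasFDerivAt_registrationTerm (hX : IsBoundedC1Family (vectorFieldₗ V) C)
    (hΩ : IsOpen Ω) (μ₂ : ℝ) (hf : DifferentiableOn ℝ f Ω) (hf2 : MemLp f 2 (volume.restrict Ω))
    (hf' : MemLp (fderiv ℝ f) 2 (volume.restrict Ω)) (v : VelocitySpace V) {t : ℝ}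
    (ht : t ∈ Icc (0 : ℝ) 1) :
    ∃ D : VelocitySpace V →L[ℝ] ℝ,
      HasFDerivAt (fun w : VelocitySpace V => ‖T t (toImage Ω (f ∘ flowBetween w t 0)) - g t‖ ^ 2
        + μ₂ * ∫ τ in (0 : ℝ)..t, ‖w τ‖ ^ 2) D v ∧
      HasDensity D (termGradient T g μ₂ f v t) := by
  have himage (w : VelocitySpace V) := toImage_comp_flowBetween hX hΩ.measurableSet hf2 w ht
    (left_mem_Icc.2 zero_le_one)
  obtain ⟨D, hD, hD_density⟩ := exists_hasFDerivAt_integral_norm_sq v ht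
  have hdata := hX.hasFDerivAt_norm_sq_sub vectorFieldₗ_of_notMem hΩ hf hf2 hf' (T t) (g t) t 0 v
  have hdata_density := hasDensity_innerSL_comp_compVariationCLM hX hΩ hf hf'
    (adjointResidual T g f v t) ht.1 v
  simp only [← himage] at hdata
  refine ⟨_, hdata.add (hD.const_mul μ₂), ?_⟩
  have hsum : termGradient T g μ₂ f v t = (2 : ℝ) • (Ioc 0 t).indicator (fun τ => -∫ y : Ω,
      RKHS.kerFun V y (dataDensity T g f v t τ y) ∂(volume.comap Subtype.val)) +
      μ₂ • (Ioc 0 t).indicator fun τ => (2 : ℝ) • v τ := by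
    funext τ
    by_cases hτ : τ ∈ Ioc 0 t
    · simp only [termGradient, Pi.add_apply, Pi.smul_apply, indicator_of_mem hτ, smul_neg, neg_smul,
        smul_smul, mul_comm μ₂]
    · simp only [termGradient, Pi.add_apply, Pi.smul_apply, indicator_of_notMem hτ, smul_zero,
        add_zero]
  rw [hsum]
  exact (hdata_density.const_smul 2).add (hD_density.const_smul μ₂)

theorem exists_hasFDerivAt_registrationFunctional (hX : IsBoundedC1Family (vectorFieldₗ V) C)
    (hΩ : IsOpen Ω) (μ₂ : ℝ) (hf : DifferentiableOn ℝ f Ω) (hf2 : MemLp f 2 (volume.restrict Ω))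
    (hf' : MemLp (fderiv ℝ f) 2 (volume.restrict Ω)) (v : VelocitySpace V) :
    ∃ D : VelocitySpace V →L[ℝ] ℝ, HasFDerivAt (registrationFunctional N T g μ₂ f) D v ∧
      HasDensity D
        ((1 / (N : ℝ)) • ∑ i ∈ Finset.Icc 1 N, termGradient T g μ₂ f v ((i : ℝ) / N)) := by
  have hterm (i : ℕ) (hi : i ∈ Finset.Icc 1 N) :=
    exists_hasFDerivAt_registrationTerm T g hX hΩ μ₂ hf hf2 hf' v (natCast_div_mem_Icc hi)
  choose! D hD hD_density using hterm
  exact ⟨_, (HasFDerivAt.fun_sum hD).const_mul (1 / (N : ℝ)),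
    (HasDensity.sum hD_density).const_smul (1 / (N : ℝ))⟩

theorem gradient_registrationFunctional_ae_eq (hX : IsBoundedC1Family (vectorFieldₗ V) C)
    (hΩ : IsOpen Ω) (μ₂ : ℝ) (hf : DifferentiableOn ℝ f Ω) (hf2 : MemLp f 2 (volume.restrict Ω))
    (hf' : MemLp (fderiv ℝ f) 2 (volume.restrict Ω)) (v : VelocitySpace V) :
    ⇑(∇ (registrationFunctional N T g μ₂ f : VelocitySpace V → ℝ) v) =ᵐ[μI]
      (1 / (N : ℝ)) • ∑ i ∈ Finset.Icc 1 N, termGradient T g μ₂ f v ((i : ℝ) / N) := by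
  obtain ⟨D, hD, hD_density⟩ :=
    exists_hasFDerivAt_registrationFunctional (N := N) T g hX hΩ μ₂ hf hf2 hf' v
  exact ae_eq_of_forall_inner_ae_eq hX (hD_density.inner_gradient_ae_eq hD)

lemma gradientIntegrand_eq_sum (hX : IsBoundedC1Family (vectorFieldₗ V) C) (hΩ : IsOpen Ω)
    (v : VelocitySpace V) {τ : ℝ} (hτ : τ ∈ Icc (0 : ℝ) 1) (x y : Ω) :
    gradientIntegrand N T g f v τ x y =
      ∑ i ∈ (Finset.Icc 1 N).filter (fun i : ℕ => τ ≤ (i : ℝ) / N),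
        RKHS.kernel V x y (dataDensity T g f v ((i : ℝ) / N) τ y) := by
  rw [gradientIntegrand, Finset.sum_smul, map_sum]
  refine Finset.sum_congr rfl fun i hi => ?_
  obtain ⟨hiN, hτi⟩ := Finset.mem_filter.1 hi
  have hi_mem := natCast_div_mem_Icc hiN
  rw [hTerm, if_pos hτi, dataDensity, adjointDensity, fderiv_flowBetween hX hΩ v hτ hi_mem y.2,
    eqOn_flowBetween hX v hτ hi_mem y.2,
    gradient_comp_flowBetween hX hΩ v hτ (left_mem_Icc.2 zero_le_one) y.2, adjointResidual]

lemma integrable_gradientIntegrand (hX : IsBoundedC1Family (vectorFieldₗ V) C) (hΩ : IsOpen Ω)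
    (hf : DifferentiableOn ℝ f Ω) (hf' : MemLp (fderiv ℝ f) 2 (volume.restrict Ω))
    (v : VelocitySpace V) {τ : ℝ} (hτ : τ ∈ Icc (0 : ℝ) 1) (x : Ω) :
    Integrable (gradientIntegrand N T g f v τ x) (volume.comap Subtype.val) := by
  rw [funext (gradientIntegrand_eq_sum T g hX hΩ v hτ x)]
  exact integrable_finsetSum _ fun i _ => integrable_kernel_apply hX hΩ.measurableSet
    (integrableOn_dataDensity T g hX hΩ hf hf' v _ τ) x

lemma termGradient_apply (hX : IsBoundedC1Family (vectorFieldₗ V) C) (hΩ : IsOpen Ω) (μ₂ : ℝ)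
    (hf : DifferentiableOn ℝ f Ω) (hf' : MemLp (fderiv ℝ f) 2 (volume.restrict Ω))
    (v : VelocitySpace V) {τ t : ℝ} (hτ : 0 < τ) (hτt : τ ≤ t) (x : Ω) :
    termGradient T g μ₂ f v t τ x =
      -(2 : ℝ) • (∫ y : Ω, RKHS.kernel V x y (dataDensity T g f v t τ y)
        ∂(volume.comap Subtype.val)) + (2 * μ₂) • truncatedVelocity v τ t x := by
  rw [termGradient, indicator_of_mem (mem_Ioc.2 ⟨hτ, hτt⟩), truncatedVelocity, if_pos hτt,
    RKHS.coe_add, Pi.add_apply, RKHS.coe_smul, Pi.smul_apply, RKHS.coe_smul, Pi.smul_apply,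
    integral_kerFun_apply_coe hX hΩ.measurableSet
      (integrableOn_dataDensity T g hX hΩ hf hf' v t τ)]

lemma sum_termGradient_apply (hX : IsBoundedC1Family (vectorFieldₗ V) C) (hΩ : IsOpen Ω) (μ₂ : ℝ)
    (hf : DifferentiableOn ℝ f Ω) (hf' : MemLp (fderiv ℝ f) 2 (volume.restrict Ω))
    (v : VelocitySpace V) {τ : ℝ} (hτ : τ ∈ Ioc (0 : ℝ) 1) (x : Ω) :
    (∑ i ∈ Finset.Icc 1 N, termGradient T g μ₂ f v ((i : ℝ) / N) τ) x =
      -(2 : ℝ) • (∫ y : Ω, gradientIntegrand N T g f v τ x y ∂(volume.comap Subtype.val))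
        + (2 * μ₂) • ∑ i ∈ (Finset.Icc 1 N).filter (fun i : ℕ => τ ≤ (i : ℝ) / N),
          truncatedVelocity v τ ((i : ℝ) / N) x := by
  have hcut : ∑ i ∈ Finset.Icc 1 N, termGradient T g μ₂ f v ((i : ℝ) / N) τ =
      ∑ i ∈ (Finset.Icc 1 N).filter (fun i : ℕ => τ ≤ (i : ℝ) / N),
        termGradient T g μ₂ f v ((i : ℝ) / N) τ :=
    (Finset.sum_filter_of_ne fun i _ hne => (mem_Ioc.1 (mem_of_indicator_ne_zero hne)).2).symm
  rw [hcut, ← RKHS.adjoint_kerFun, map_sum]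
  simp only [RKHS.adjoint_kerFun, gradientIntegrand_eq_sum T g hX hΩ v (Ioc_subset_Icc_self hτ)]
  rw [integral_finsetSum _ fun i _ => integrable_kernel_apply hX hΩ.measurableSet
    (integrableOn_dataDensity T g hX hΩ hf hf' v _ τ) x, Finset.smul_sum, Finset.smul_sum,
    ← Finset.sum_add_distrib]
  exact Finset.sum_congr rfl fun i hi =>
    termGradient_apply T g hX hΩ μ₂ hf hf' v hτ.1 (Finset.mem_filter.1 hi).2 x

end Functional

theorem mainTheorem3 {n : ℕ} {Ω : Set (EuclideanSpace ℝ (Fin n))} (hΩ : IsOpen Ω)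
    {V : Type*} [NormedAddCommGroup V] [InnerProductSpace ℝ V] [CompleteSpace V]
    [RKHS ℝ V Ω (EuclideanSpace ℝ (Fin n))] (hV : IsAdmissible V)
    {Y : Type*} [NormedAddCommGroup Y] [InnerProductSpace ℝ Y] [CompleteSpace Y]
    (N : ℕ) (hN : 1 ≤ N) (T : ℝ → ImageSpace Ω →L[ℝ] Y) (g : ℝ → Y) (μ₂ : ℝ)
    (f : EuclideanSpace ℝ (Fin n) → ℝ)
    (hf : DifferentiableOn ℝ f Ω)
    (hf_L2 : MemLp f 2 (volume.restrict Ω))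
    (hgrad_L2 : MemLp (fun x => ∇ f x) 2 (volume.restrict Ω)) :
    -- the objects entering the functional are well defined
    (∀ v : VelocitySpace V, IsFlow (⇑v) (flow v) ∧
      ∀ s ∈ Icc (0 : ℝ) 1, BijOn (flow v s) Ω Ω ∧
        (∀ t ∈ Icc (0 : ℝ) 1, ContDiffOn ℝ 1 (flowBetween v s t) Ω) ∧
        MemLp (f ∘ flowBetween v s 0) 2 (volume.restrict Ω)) ∧
    -- the functional is differentiable, with the stated gradient
    ∀ v : VelocitySpace V,
      DifferentiableAt ℝ (registrationFunctional N T g μ₂ f : VelocitySpace V → ℝ) v ∧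
      (∀ t ∈ Icc (0 : ℝ) 1, ∀ x : Ω,
        Integrable (gradientIntegrand N T g f v t x) (volume.comap Subtype.val)) ∧
      ∀ᵐ t ∂(volume.restrict (Icc (0 : ℝ) 1)), ∀ x : Ω,
        (∇ (registrationFunctional N T g μ₂ f : VelocitySpace V → ℝ) v) t x =
          -(2 / (N : ℝ)) • (∫ y : Ω, gradientIntegrand N T g f v t x y ∂(volume.comap Subtype.val))
            + (2 * μ₂ / (N : ℝ)) •
              ∑ i ∈ (Finset.Icc 1 N).filter (fun i : ℕ => t ≤ (i : ℝ) / N),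
                truncatedVelocity v t ((i : ℝ) / N) x := by
  obtain ⟨C, hX⟩ := hV.exists_isBoundedC1Family hΩ
  have hf' := memLp_fderiv_of_memLp_gradient hgrad_L2
  refine ⟨fun v => ⟨isFlow_flow hX v, fun s hs => ⟨bijOn_flow hX v hs,
    fun t ht => contDiffOn_flowBetween hX v hs ht, memLp_comp_flowBetween hX hΩ.measurableSet
      hf_L2 v hs (left_mem_Icc.2 zero_le_one)⟩⟩, fun v => ⟨?_, fun t ht x =>
    integrable_gradientIntegrand T g hX hΩ hf hf' v ht x, ?_⟩⟩
  · obtain ⟨D, hD, -⟩ := exists_hasFDerivAt_registrationFunctional T g hX hΩ μ₂ hf hf_L2 hf' v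
    exact hD.differentiableAt
  · filter_upwards [gradient_registrationFunctional_ae_eq T g hX hΩ μ₂ hf hf_L2 hf' v,
      ae_restrict_mem measurableSet_Icc, ae_restrict_of_ae (Measure.ae_ne volume 0)]
      with t hgrad ht ht0 x
    rw [hgrad, Pi.smul_apply, Finset.sum_apply, RKHS.coe_smul, Pi.smul_apply,
      sum_termGradient_apply T g hX hΩ μ₂ hf hf' v ⟨ht.1.lt_of_ne' ht0, ht.2⟩ x, smul_add,
      smul_smul, smul_smul]
    congr 2 <;> ring
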